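/- Let $d\ge1$, $p\in[1,\infty]$, $\kappa\ge0$, $\beta\in(0,1]$, $\alpha\ge0$ and $\lambda\ge e^{(3+2\alpha)/\beta}$. On $\mathbb R^d$, let $\frac{|D|^\beta}{\log^\alpha(\lambda+|D|)}$ be the Fourier multiplier $$\mathcal F\Big(\tfrac{|D|^\beta}{\log^\alpha(\lambda+|D|)}u\Big)(\xi)=\tfrac{|\xi|^\beta}{\log^\alpha(\lambda+|\xi|)}\,\mathcal F u(\xi),\qquad \mathcal F u(\xi)=\int_{\mathbb R^d}e^{-ix\cdot\xi}u(x)\,dx ,$$ the identity being understood for tempered distributions. Let $T>0$ and let $(\theta,v,f)$ be a smooth solution on $[0,T]\times\mathbb R^d$ of $$\partial_t\theta+v\cdot\nabla\theta+\kappa\,\frac{|D|^\beta}{\log^\alpha(\lambda+|D|)}\theta=f,\qquad \mathrm{div}\,v=0,\qquad \theta_{|t=0}=\theta_0,$$ where "smooth solution" means: $\theta,f:[0,T]\times\mathbb R^d\to\mathbb R$ and $v:[0,T]\times\mathbb R^d\to\mathbb R^d$ are $C^\infty$ (up to $t=0$ and $t=T$), the spatial derivatives of $\theta$ of every order $n\ge0$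 are bounded on $[0,T]\times\mathbb R^d$, $|v(t,x)|\le C(1+|x|)$ for some constant $C$, and the equation holds at every time. Then for every $t\in[0,T]$ $$\|\theta(t)\|_{L^p}\le\|\theta_0\|_{L^p}+\int_0^t\|f(\tau)\|_{L^p}\,d\tau ,$$ where the norms take values in $[0,\infty]$ (so $\theta(t)\in L^p$ whenever the right-hand side is finite). In particular, if $f=0$ on $[0,t]$, then $\|\theta(t)\|_{L^p}\le\|\theta_0\|_{L^p}$. -/

import Mathlib

open MeasureTheory Set
open scoped FourierTransform SchwartzMap ContDiff ENNReal

/-- The symbol `|η|^β / log^α (lam + |η|)` of the operator `|D|^β / log^α (lam + |D|)` on `ℝ^d`.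
It is written in the frequency variable `ξ` of Mathlib's Fourier transform
`𝓕 u ξ = ∫ exp (-2π i ⟨x, ξ⟩) u x dx`, so that `η = 2π ξ` is the variable dual to `D = -i ∇`
(the variable of the transform `∫ exp (-i ⟨x, η⟩) u x dx`). -/
noncomputable def logDissipationSymbol {d : ℕ} (α β lam : ℝ) (ξ : EuclideanSpace ℝ (Fin d)) : ℝ :=
  (2 * Real.pi * ‖ξ‖) ^ β / Real.log (lam + 2 * Real.pi * ‖ξ‖) ^ α

/-- `g` is the image of `u` under the Fourier multiplier with symbol `m`, i.e. `𝓕 g = m · 𝓕 u`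
as tempered distributions. As `⟨𝓕 g, φ⟩ = ⟨g, 𝓕 φ⟩` and `⟨m · 𝓕 u, φ⟩ = ⟨u, 𝓕 (m φ)⟩`, this says
`∫ g 𝓕 φ = ∫ u 𝓕 (m φ)` for all Schwartz functions `φ`, both integrals being convergent. -/
def IsFourierMultiplierImage {d : ℕ} (m : EuclideanSpace ℝ (Fin d) → ℝ)
    (u g : EuclideanSpace ℝ (Fin d) → ℝ) : Prop :=
  ∀ φ : 𝓢(EuclideanSpace ℝ (Fin d), ℂ),
    Integrable (fun x => (g x : ℂ) * 𝓕 (fun ξ => φ ξ) x) ∧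
    Integrable (fun x => (u x : ℂ) * 𝓕 (fun ξ => (m ξ : ℂ) * φ ξ) x) ∧
    ∫ x, (g x : ℂ) * 𝓕 (fun ξ => φ ξ) x = ∫ x, (u x : ℂ) * 𝓕 (fun ξ => (m ξ : ℂ) * φ ξ) x

/-- The divergence `∑ i, ∂ᵢ wᵢ` of a vector field `w` on `ℝ^d`, at the point `x`. -/
noncomputable def spaceDivergence {d : ℕ}
    (w : EuclideanSpace ℝ (Fin d) → EuclideanSpace ℝ (Fin d)) (x : EuclideanSpace ℝ (Fin d)) : ℝ :=
  ∑ i : Fin d, fderiv ℝ w x (EuclideanSpace.single i 1) i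

/-- `θ` is a smooth solution on `[0, T] × ℝ^d` of
`∂ₜ θ + v · ∇θ + κ |D|^β / log^α (lam + |D|) θ = f`, `div v = 0`, with initial datum `θ 0`:
* `θ`, `v`, `f` are smooth on `[0, T] × ℝ^d` (up to the times `0` and `T`);
* the spatial derivatives of `θ` of every order are bounded on `[0, T] × ℝ^d`;
* `v` grows at most linearly in space;
* `v` is divergence free, and the equation holds at every time of `[0, T]`. -/
structure IsSmoothSolution {d : ℕ} (κ α β lam T : ℝ)
    (v : ℝ → EuclideanSpace ℝ (Fin d) → EuclideanSpace ℝ (Fin d))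
    (f θ : ℝ → EuclideanSpace ℝ (Fin d) → ℝ) : Prop where
  smooth_theta : ContDiffOn ℝ ∞ (Function.uncurry θ) (Icc 0 T ×ˢ univ)
  smooth_v : ContDiffOn ℝ ∞ (Function.uncurry v) (Icc 0 T ×ˢ univ)
  smooth_f : ContDiffOn ℝ ∞ (Function.uncurry f) (Icc 0 T ×ˢ univ)
  bounded_theta : ∀ n : ℕ, ∃ C : ℝ, ∀ t ∈ Icc 0 T, ∀ x, ‖iteratedFDeriv ℝ n (θ t) x‖ ≤ C
  growth_v : ∃ C : ℝ, ∀ t ∈ Icc 0 T, ∀ x, ‖v t x‖ ≤ C * (1 + ‖x‖)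
  div_v : ∀ t ∈ Icc 0 T, ∀ x, spaceDivergence (v t) x = 0
  equation : ∀ t ∈ Icc 0 T,
    IsFourierMultiplierImage (fun ξ => κ * logDissipationSymbol α β lam ξ) (θ t)
      (fun x => f t x - derivWithin (fun s => θ s x) (Icc 0 T) t - fderiv ℝ (θ t) x (v t x))

/-! The dissipation is an average of heat differences. There is a positive measure `ν` on `(0, ∞)`
with `r ^ β / log ^ α (lam + r) = ∫ (1 - exp (-s r ^ 2)) dν(s)`, so the operator is `u ↦ ∫ (u - exp
(s Δ) u) dν(s)`. Convexity and Jensen's inequality for the Gaussian average `exp (s Δ)` then give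
the Córdoba–Córdoba inequality `φ'(u) (u - exp (s Δ) u) ≥ φ(u) - exp (s Δ) φ(u)`. Integrated with `φ
= |·| ^ q`, it says that the operator cannot increase `L^q` norms, while a divergence-free drift
preserves them.

Existence of `ν` (`exists_levy_measure`): the derivative in `r` of the symbol is a product of two
Laplace transforms of positive measures, hence itself one, and the subordination formula writes a
primitive of `exp (-x u)` as a mixture of `1 - exp (-s r ^ 2)`. The delicate factor carries the
logarithm. Its Laplace density is explicit, and `logDensity_nonneg` proves it nonnegative by
bounding the integrand below by the derivative of a nonnegative function vanishing at `0`; this is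
where the lower bound on `lam` enters.

Integrability at infinity: `θ` is only bounded and `v` may grow linearly, so every integral over
space carries a weight. With a Gaussian weight of width `σ`, the drift and the nonlocal operator
leave an error weight `gaussFlux` (`IsTransportSolution.energy`). It tends to `0` as `σ → ∞`, but a
Gaussian does not dominate its own flux, so Gronwall's lemma cannot be applied to it directly. The
superposition `dyadicWeight` of Gaussians decays only like a power and does dominate its flux, up to
a constant independent of its scale `4 ^ j` (`exists_tsum_gaussFlux_le`); this uses the fractional
moment `∫ min s (s ^ b) dν < ∞`. Gronwall's lemma then gives the claimed bound for weighted norms,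
with an extra factor `exp (c t / q)` where `c` depends neither on `q` nor on `j`.

The extra factor is removed in two ways. For `p = ∞`, the weight is fixed and `q → ∞`
(`IsTransportSolution.eLpNorm_top_le`). For `p = q < ∞`, letting `j → ∞` shows that `θ` is bounded
in `L^q` uniformly in time; this a priori bound makes the flux term of a single Gaussian vanish as
`σ → ∞` by dominated convergence, and the sharp inequality remains
(`IsTransportSolution.lintegral_rpow_le`). -/

/-! ### Gaussian subordination of the exponential. -/

/-- The Cauchy–Schlömilch substitution for the Gaussian. -/
theorem lintegral_exp_neg_sq_sub_div {a b : ℝ} (ha : 0 < a) (hb : 0 ≤ b) :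
    ∫⁻ v in Ioi (0 : ℝ), ENNReal.ofReal (Real.exp (-(a * v - b / v) ^ 2)) =
      ENNReal.ofReal (Real.sqrt Real.pi / (2 * a)) := by
  rcases hb.eq_or_lt with rfl | hb
  · have h1 : ∀ v : ℝ, Real.exp (-(a * v - 0 / v) ^ 2) = Real.exp (-(a ^ 2) * v ^ 2) := by
      intro v; congr 1; rw [zero_div, sub_zero]; ring
    simp_rw [h1]
    rw [← ofReal_integral_eq_lintegral_ofReal
      ((integrable_exp_neg_mul_sq (by positivity)).integrableOn)
      (Filter.Eventually.of_forall fun _ => (Real.exp_pos _).le), integral_gaussian_Ioi,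
      Real.sqrt_div Real.pi_pos.le, Real.sqrt_sq ha.le, div_div, mul_comm a 2]
  set F : ℝ → ℝ≥0∞ := fun v => ENNReal.ofReal (Real.exp (-(a * v - b / v) ^ 2)) with hF
  have hFm : Measurable F := by fun_prop
  set I := ∫⁻ v in Ioi (0 : ℝ), F v with hI
  -- The involution `v ↦ b / (a v)` changes the sign of `a v - b / v`, so it preserves `F` and only
  -- contributes its Jacobian.
  have e1 : ∫⁻ v in Ioi (0 : ℝ), ENNReal.ofReal (b / (a * v ^ 2)) * F v = I := by
    have himg : (fun v : ℝ => b / (a * v)) '' Ioi 0 = Ioi 0 := by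
      ext y; constructor
      · rintro ⟨v, hv, rfl⟩; exact div_pos hb (mul_pos ha hv)
      · intro hy
        have hy' : (0 : ℝ) < y := hy
        exact ⟨b / (a * y), div_pos hb (mul_pos ha hy), by beta_reduce; field_simp⟩
    have key := lintegral_image_eq_lintegral_abs_deriv_mul (f := fun v : ℝ => b / (a * v))
      (f' := fun v => -(b / (a * v ^ 2))) (s := Ioi 0) measurableSet_Ioi ?_ ?_ F
    · rw [himg] at key
      rw [hI, key]
      refine setLIntegral_congr_fun measurableSet_Ioi fun v hv => ?_
      have hv' : (0 : ℝ) < v := hv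
      rw [abs_neg, abs_of_pos (by positivity)]
      simp only [hF]
      have : a * (b / (a * v)) - b / (b / (a * v)) = -(a * v - b / v) := by field_simp; ring
      rw [this, neg_sq]
    · intro v hv
      have hv' : (0 : ℝ) < v := hv
      have := ((hasDerivAt_id v).const_mul a).inv (by simp; constructor <;> positivity)
      have := (this.const_mul b).hasDerivWithinAt (s := Ioi 0)
      refine (this.congr_deriv ?_).congr_of_mem ?_ hv
      · simp; field_simp
      · intro x _; simp [div_eq_mul_inv]
    · intro x hx y hy hxy
      have hx' : (0 : ℝ) < x := hx
      have hy' : (0 : ℝ) < y := hy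
      beta_reduce at hxy
      field_simp at hxy
      exact hxy.symm
  -- The change of variables `y = a v - b / v` from `(0, ∞)` onto `ℝ` has Jacobian `a + b / v ^ 2`.
  -- By `e1` both terms of this Jacobian contribute `a * I`, hence `2 a I = √π`.
  have e2 : ∫⁻ v in Ioi (0 : ℝ), ENNReal.ofReal (a + b / v ^ 2) * F v =
      ENNReal.ofReal (Real.sqrt Real.pi) := by
    have himg : (fun v : ℝ => a * v - b / v) '' Ioi 0 = univ := by
      refine eq_univ_of_forall fun y => ?_
      have hd : 0 < y ^ 2 + 4 * a * b := by positivity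
      have hs : |y| < Real.sqrt (y ^ 2 + 4 * a * b) := by
        rw [← Real.sqrt_sq_eq_abs]
        exact Real.sqrt_lt_sqrt (sq_nonneg y) (by nlinarith [mul_pos ha hb])
      have hp : 0 < y + Real.sqrt (y ^ 2 + 4 * a * b) := by linarith [neg_abs_le y]
      have hsq := Real.sq_sqrt hd.le
      -- The preimage of `y` is the positive root of `a v ^ 2 - y v - b = 0`.
      refine ⟨(y + Real.sqrt (y ^ 2 + 4 * a * b)) / (2 * a), div_pos hp (by positivity), ?_⟩
      beta_reduce
      set S := Real.sqrt (y ^ 2 + 4 * a * b)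
      have hS : S ^ 2 - y ^ 2 = 4 * a * b := by linarith
      rw [sub_eq_iff_eq_add, mul_div_assoc', div_div_eq_mul_div, div_eq_iff (by positivity)]
      field_simp
      nlinarith
    have hd : ∀ v ∈ Ioi (0 : ℝ), HasDerivWithinAt (fun v : ℝ => a * v - b / v)
        (a + b / v ^ 2) (Ioi 0) v := by
      intro v hv
      have hv' : (v : ℝ) ≠ 0 := ne_of_gt hv
      have := ((hasDerivAt_id v).const_mul a).sub ((hasDerivAt_inv hv').const_mul b)
      refine (this.hasDerivWithinAt.congr_deriv ?_).congr_of_mem ?_ hv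
      · simp; field_simp
      · intro x _; simp [div_eq_mul_inv]
    have := lintegral_image_eq_lintegral_abs_deriv_mul measurableSet_Ioi hd ?_
      (fun y => ENNReal.ofReal (Real.exp (-y ^ 2)))
    · rw [himg, setLIntegral_univ] at this
      calc _ = ∫⁻ y : ℝ, ENNReal.ofReal (Real.exp (-y ^ 2)) := by
            rw [this]
            refine setLIntegral_congr_fun measurableSet_Ioi fun v hv => ?_
            have hv' : (0 : ℝ) < v := hv
            rw [abs_of_pos (by positivity)]
        _ = _ := by
            have h1 : ∀ v : ℝ, Real.exp (-v ^ 2) = Real.exp (-1 * v ^ 2) := by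
              intro v; congr 1; ring
            simp_rw [h1]
            rw [← ofReal_integral_eq_lintegral_ofReal
              ((integrable_exp_neg_mul_sq (by positivity)))
              (Filter.Eventually.of_forall fun _ => (Real.exp_pos _).le), integral_gaussian, div_one]
    · intro x hx y hy hxy
      have hx' : (0 : ℝ) < x := hx
      have hy' : (0 : ℝ) < y := hy
      beta_reduce at hxy
      field_simp at hxy
      have : (x - y) * (a * x * y + b) = 0 := by linarith
      rcases mul_eq_zero.1 this with h | h
      · linarith
      · have : 0 < a * x * y + b := by positivity
        linarith
  have e3 : ∫⁻ v in Ioi (0 : ℝ), ENNReal.ofReal (a + b / v ^ 2) * F v =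
      ENNReal.ofReal a * I + ENNReal.ofReal a * I := by
    nth_rewrite 2 [← e1]
    rw [hI, ← lintegral_const_mul _ hFm, ← lintegral_const_mul _ (by fun_prop),
      ← lintegral_add_left (by fun_prop)]
    refine setLIntegral_congr_fun measurableSet_Ioi fun v hv => ?_
    have hv' : (0 : ℝ) < v := hv
    rw [show b / v ^ 2 = a * (b / (a * v ^ 2)) by field_simp, ENNReal.ofReal_add ha.le (by positivity),
      ENNReal.ofReal_mul ha.le, add_mul, mul_assoc]
  have e4 : ENNReal.ofReal (2 * a) * I = ENNReal.ofReal (Real.sqrt Real.pi) := by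
    rw [← e2, e3, ← add_mul, ← ENNReal.ofReal_add ha.le ha.le, two_mul]
  rw [ENNReal.ofReal_div_of_pos (by positivity), ← e4, mul_comm, mul_div_assoc,
    ENNReal.div_self (by simpa using ha) ENNReal.ofReal_ne_top, mul_one]

/-- The subordination formula for the square root, differentiated once. -/
theorem lintegral_subordination {x u : ℝ} (hx : 0 < x) (hu : 0 ≤ u) :
    ∫⁻ s in Ioi (0 : ℝ), ENNReal.ofReal
        (x / Real.sqrt Real.pi * s ^ (-(1 / 2) : ℝ) * Real.exp (-(s * x ^ 2) - u ^ 2 / (4 * s))) =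
      ENNReal.ofReal (Real.exp (-(x * u))) := by
  -- Substituting `s = v ^ 2` and completing the square reduces the integral to the previous one
  -- with `a = x` and `b = u / 2`.
  have himg : (fun v : ℝ => v ^ 2) '' Ioi 0 = Ioi 0 := by
    ext y; constructor
    · rintro ⟨v, hv, rfl⟩; exact pow_pos (mem_Ioi.1 hv) 2
    · intro hy; exact ⟨Real.sqrt y, Real.sqrt_pos.2 hy, Real.sq_sqrt (le_of_lt hy)⟩
  rw [← himg, lintegral_image_eq_lintegral_abs_deriv_mul (f' := fun v => 2 * v) measurableSet_Ioi]
  · calc _ = ∫⁻ v in Ioi (0 : ℝ), ENNReal.ofReal (2 * x / Real.sqrt Real.pi * Real.exp (-(x * u))) *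
          ENNReal.ofReal (Real.exp (-(x * v - (u / 2) / v) ^ 2)) := by
          refine setLIntegral_congr_fun measurableSet_Ioi fun v hv => ?_
          have hv' : (0 : ℝ) < v := hv
          rw [← ENNReal.ofReal_mul (by positivity), ← ENNReal.ofReal_mul (by positivity),
            abs_of_pos (by positivity)]
          congr 1
          have h1 : (v ^ 2) ^ (-(1 / 2) : ℝ) = v⁻¹ := by
            rw [← Real.rpow_natCast, ← Real.rpow_mul hv'.le]
            norm_num
            rw [Real.rpow_neg_one]
          rw [h1, mul_assoc (2 * x / _), ← Real.exp_add]
          have h2 : -(v ^ 2 * x ^ 2) - u ^ 2 / (4 * v ^ 2) =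
              -(x * u) + -(x * v - u / 2 / v) ^ 2 := by
            field_simp; ring
          rw [h2]
          field_simp
      _ = _ := by
          rw [lintegral_const_mul _ (by fun_prop), lintegral_exp_neg_sq_sub_div hx (by positivity),
            ← ENNReal.ofReal_mul (by positivity)]
          congr 1
          have := Real.sqrt_pos.2 Real.pi_pos
          field_simp
  · intro v hv
    have := (hasDerivAt_pow 2 v).hasDerivWithinAt (s := Ioi 0)
    simpa using this
  · intro a ha b hb hab
    have ha' : (0 : ℝ) < a := ha
    have hb' : (0 : ℝ) < b := hb
    exact (pow_left_inj₀ ha'.le hb'.le two_ne_zero).1 hab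

/-! ### Laplace transforms of positive measures. -/

/-- `h` is, on `(0, ∞)`, the Laplace transform of an s-finite measure on `[0, ∞)`. -/
def IsLaplaceTransform (h : ℝ → ℝ) : Prop :=
  ∃ M : Measure ℝ, SFinite M ∧ M (Iio 0) = 0 ∧
    ∀ x, 0 < x → ENNReal.ofReal (h x) = ∫⁻ u, ENNReal.ofReal (Real.exp (-(x * u))) ∂M

theorem isLaplaceTransform_const (c : ℝ) : IsLaplaceTransform fun _ => c := by
  refine ⟨ENNReal.ofReal c • Measure.dirac 0, inferInstance, by simp, fun x hx => ?_⟩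
  simp

/-- The convolution of the two measures represents the product. Nonnegativity of one factor is what
makes `ENNReal.ofReal` multiplicative. -/
theorem IsLaplaceTransform.mul {h₁ h₂ : ℝ → ℝ} (H₁ : IsLaplaceTransform h₁)
    (H₂ : IsLaplaceTransform h₂) (hn : ∀ x, 0 < x → 0 ≤ h₁ x) :
    IsLaplaceTransform fun x => h₁ x * h₂ x := by
  obtain ⟨M, hM, hM0, hMx⟩ := H₁
  obtain ⟨N, hN, hN0, hNx⟩ := H₂
  refine ⟨(M.prod N).map (fun p => p.1 + p.2), inferInstance, ?_, fun x hx => ?_⟩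
  · rw [Measure.map_apply (by fun_prop) measurableSet_Iio]
    refine measure_mono_null (t := (Iio 0 ×ˢ univ) ∪ (univ ×ˢ Iio 0)) ?_ ?_
    · rintro ⟨a, b⟩ h
      simp only [mem_preimage, mem_Iio] at h
      simp only [mem_union, mem_prod, mem_Iio, mem_univ, and_true, true_and]
      by_contra! hh
      linarith [hh.1, hh.2]
    · rw [measure_union_null_iff, Measure.prod_prod, Measure.prod_prod, hM0, hN0]
      simp
  · rw [ENNReal.ofReal_mul (hn x hx), hMx x hx, hNx x hx, lintegral_map (by fun_prop) (by fun_prop),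
      lintegral_prod _ (by fun_prop)]
    simp_rw [mul_add, neg_add, Real.exp_add, ENNReal.ofReal_mul (Real.exp_pos _).le]
    rw [← lintegral_mul_const _ (by fun_prop)]
    refine lintegral_congr fun a => ?_
    rw [lintegral_const_mul _ (by fun_prop)]

/-- This is Euler's integral for `Γ`, with density `y ^ (γ - 1) / Γ γ`. The endpoint `γ = 0`, which
corresponds to `β = 1`, is the Dirac mass at `0`. -/
theorem isLaplaceTransform_rpow_neg {γ : ℝ} (hγ : 0 ≤ γ) :
    IsLaplaceTransform fun x => x ^ (-γ) := by
  rcases hγ.eq_or_lt with rfl | hγ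
  · simpa using isLaplaceTransform_const 1
  refine ⟨(volume.restrict (Ioi 0)).withDensity
    (fun y => ENNReal.ofReal (y ^ (γ - 1) / Real.Gamma γ)), inferInstance, ?_, fun x hx => ?_⟩
  · refine withDensity_absolutelyContinuous _ _ ?_
    rw [Measure.restrict_apply measurableSet_Iio]
    have : Iio (0 : ℝ) ∩ Ioi 0 = ∅ := by ext y; simp; intro h; linarith
    rw [this, measure_empty]
  · rw [lintegral_withDensity_eq_lintegral_mul _ (by fun_prop) (by fun_prop)]
    have hG := Real.Gamma_pos_of_pos hγ
    have h := Real.integral_rpow_mul_exp_neg_mul_Ioi hγ hx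
    -- A nonzero value of the Bochner integral forces integrability.
    have hi : IntegrableOn (fun t : ℝ => t ^ (γ - 1) * Real.exp (-(x * t))) (Ioi 0) := by
      by_contra hcon
      rw [integral_undef hcon] at h
      have : 0 < (1 / x) ^ γ * Real.Gamma γ := by positivity
      linarith
    calc _ = ENNReal.ofReal ((Real.Gamma γ)⁻¹ * ∫ t in Ioi (0:ℝ), t ^ (γ - 1) * Real.exp (-(x * t))) := by
          beta_reduce; rw [h, one_div, Real.inv_rpow hx.le, Real.rpow_neg hx.le]
          congr 1; field_simp
      _ = _ := by
          rw [ENNReal.ofReal_mul (by positivity), ofReal_integral_eq_lintegral_ofReal hi,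
            ← lintegral_const_mul _ (by fun_prop)]
          · refine setLIntegral_congr_fun measurableSet_Ioi fun v hv => ?_
            have hv' : (0 : ℝ) < v := hv
            simp only [Pi.mul_apply]
            rw [← ENNReal.ofReal_mul (by positivity), ← ENNReal.ofReal_mul (by positivity)]
            congr 1; ring
          · refine (ae_restrict_mem measurableSet_Ioi).mono fun v hv => ?_
            have hv' : (0 : ℝ) < v := hv
            simp only [Pi.zero_apply]; positivity

/-- A primitive of a Laplace transform is a mixture of the functions `1 - exp (-s x ^ 2)`. -/
theorem IsLaplaceTransform.exists_measure {h : ℝ → ℝ} (H : IsLaplaceTransform h) :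
    ∃ ν : Measure ℝ, SFinite ν ∧ ν (Iic 0) = 0 ∧ ∀ r : ℝ, 0 ≤ r →
      ∫⁻ s, ENNReal.ofReal (1 - Real.exp (-(s * r ^ 2))) ∂ν =
        ∫⁻ x in Ioo 0 r, ENNReal.ofReal (h x) := by
  obtain ⟨M, hM, hM0, hMx⟩ := H
  -- Normalized so that `D s u` times `2 s x exp (-s x ^ 2)`, the derivative in `x` of `1 - exp (-s
  -- x ^ 2)`, is the kernel of `lintegral_subordination`. The measure `ν` has density `∫ D s u
  -- dM(u)`, and the identity follows from Tonelli.
  set D : ℝ → ℝ → ℝ≥0∞ := fun s u => ENNReal.ofReal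
    (1 / (2 * Real.sqrt Real.pi) * s ^ (-(3 / 2) : ℝ) * Real.exp (- (u ^ 2 / (4 * s)))) with hD
  have hDm : Measurable (Function.uncurry D) := by
    simp only [hD, Function.uncurry_def]; fun_prop
  have hDs : Measurable fun s => ∫⁻ u, D s u ∂M := hDm.lintegral_prod_right'
  refine ⟨(volume.restrict (Ioi 0)).withDensity (fun s => ∫⁻ u, D s u ∂M), inferInstance, ?_, ?_⟩
  · refine withDensity_absolutelyContinuous _ _ ?_
    rw [Measure.restrict_apply measurableSet_Iic]
    have : Iic (0 : ℝ) ∩ Ioi 0 = ∅ := by ext y; simp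
    rw [this, measure_empty]
  · intro r hr
    rw [lintegral_withDensity_eq_lintegral_mul _ hDs (by fun_prop)]
    have step1 : ∀ s : ℝ, 0 < s → ENNReal.ofReal (1 - Real.exp (-(s * r ^ 2))) =
        ∫⁻ x in Ioo 0 r, ENNReal.ofReal (2 * s * x * Real.exp (-(s * x ^ 2))) := by
      intro s hs
      have hd : ∀ x : ℝ, HasDerivAt (fun x => -Real.exp (-(s * x ^ 2)))
          (2 * s * x * Real.exp (-(s * x ^ 2))) x := by
        intro x
        have := (((hasDerivAt_pow 2 x).const_mul s).neg.exp).neg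
        refine this.congr_deriv ?_
        simp; ring
      have hint := intervalIntegral.integral_eq_sub_of_hasDerivAt (a := 0) (b := r)
        (fun x _ => hd x) (Continuous.intervalIntegrable (by fun_prop) _ _)
      have : 1 - Real.exp (-(s * r ^ 2)) =
          ∫ x in Ioo 0 r, 2 * s * x * Real.exp (-(s * x ^ 2)) := by
        rw [← integral_Ioc_eq_integral_Ioo, ← intervalIntegral.integral_of_le hr, hint]
        simp; ring
      rw [this, ofReal_integral_eq_lintegral_ofReal]
      · exact (Continuous.integrableOn_Icc (by fun_prop)).mono_set Ioo_subset_Icc_self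
      · refine (ae_restrict_mem measurableSet_Ioo).mono fun v hv => ?_
        have hv' : (0 : ℝ) < v := hv.1
        simp only [Pi.zero_apply]; positivity
    set G : ℝ → ℝ → ℝ≥0∞ := fun s x => ENNReal.ofReal (2 * s * x * Real.exp (-(s * x ^ 2))) with hG
    have hGm : Measurable (Function.uncurry G) := by
      simp only [hG, Function.uncurry_def]; fun_prop
    calc _ = ∫⁻ s in Ioi (0 : ℝ), ∫⁻ x in Ioo 0 r, G s x * ∫⁻ u, D s u ∂M := by
          refine setLIntegral_congr_fun measurableSet_Ioi fun s hs => ?_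
          simp only [Pi.mul_apply]
          rw [step1 s hs, mul_comm, lintegral_mul_const _ (by fun_prop)]
      _ = ∫⁻ x in Ioo 0 r, ∫⁻ s in Ioi (0 : ℝ), G s x * ∫⁻ u, D s u ∂M := by
          rw [lintegral_lintegral_swap]
          exact (hGm.mul (hDs.comp measurable_fst)).aemeasurable
      _ = ∫⁻ x in Ioo 0 r, ENNReal.ofReal (h x) := by
          refine setLIntegral_congr_fun measurableSet_Ioo fun x hx => ?_
          have hx' : 0 < x := hx.1
          have h1 : ∀ s, G s x * ∫⁻ u, D s u ∂M = ∫⁻ u, G s x * D s u ∂M := fun s => by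
            rw [lintegral_const_mul _ (by fun_prop)]
          simp_rw [h1]
          rw [lintegral_lintegral_swap, hMx x hx']
          · have hae : ∀ᵐ u ∂M, 0 ≤ u := by
              rw [ae_iff]; convert hM0 using 2; ext; simp
            refine lintegral_congr_ae (hae.mono fun u hu => ?_)
            beta_reduce
            rw [← lintegral_subordination hx' hu]
            refine setLIntegral_congr_fun measurableSet_Ioi fun s hs => ?_
            have hs' : (0 : ℝ) < s := hs
            simp only [hG, hD]
            rw [← ENNReal.ofReal_mul (by positivity)]
            congr 1
            have e1 : s ^ (-(1 / 2) : ℝ) = s * s ^ (-(3 / 2) : ℝ) := by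
              nth_rewrite 2 [← Real.rpow_one s]
              rw [← Real.rpow_add hs']; norm_num
            rw [e1, sub_eq_add_neg, Real.exp_add]
            have := Real.sqrt_pos.2 Real.pi_pos
            field_simp
          · refine Measurable.aemeasurable ?_
            refine Measurable.mul ?_ hDm
            exact hGm.comp (measurable_fst.prodMk measurable_const)

/-! ### Positivity of the Laplace density of the logarithmic factor. -/

/-- Here `ψ` is the logarithmic derivative of `Γ` at `t + 1`. As `log Γ` is convex, `ψ` is at least
the slope between `t` and `t + 1`, which is `log t` by the functional equation. -/
theorem hasDerivAt_Gamma_add_one {t : ℝ} (ht : 0 < t) :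
    ∃ ψ, Real.log t ≤ ψ ∧ HasDerivAt (fun s => Real.Gamma (s + 1)) (ψ * Real.Gamma (t + 1)) t := by
  have hG : DifferentiableAt ℝ Real.Gamma (t + 1) :=
    Real.differentiableAt_Gamma fun m => by
      have : (0 : ℝ) ≤ m := m.cast_nonneg
      linarith
  have hp : 0 < Real.Gamma (t + 1) := Real.Gamma_pos_of_pos (by linarith)
  have hp' : 0 < Real.Gamma t := Real.Gamma_pos_of_pos ht
  have hl := hG.hasDerivAt.log hp.ne'
  refine ⟨deriv Real.Gamma (t + 1) / Real.Gamma (t + 1), ?_, ?_⟩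
  · have := Real.convexOn_log_Gamma.slope_le_of_hasDerivAt (mem_Ioi.2 ht)
      (mem_Ioi.2 (by linarith : (0 : ℝ) < t + 1)) (lt_add_one t) hl
    have hs : slope (Real.log ∘ Real.Gamma) t (t + 1) = Real.log t := by
      rw [slope_def_field, Function.comp_apply, Function.comp_apply, Real.Gamma_add_one ht.ne',
        Real.log_mul ht.ne' hp'.ne']
      simp
    rwa [hs] at this
  · rw [div_mul_cancel₀ _ hp.ne']
    exact hG.hasDerivAt.comp_add_const t 1

/-- Young's inequality for the entropy: apply `log y ≤ y - 1` at `y = u exp (K - 1) / t`. The slope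
`K` in `t` is a free parameter. -/
theorem mul_log_sub_log_ge {t u K : ℝ} (ht : 0 < t) (hu : 0 < u) :
    K * t - u * Real.exp (K - 1) ≤ t * (Real.log t - Real.log u) := by
  have h := Real.log_le_sub_one_of_pos (x := u * Real.exp (K - 1) / t) (by positivity)
  rw [Real.log_div (by positivity) ht.ne', Real.log_mul hu.ne' (Real.exp_pos _).ne', Real.log_exp] at h
  have h2 := mul_le_mul_of_nonneg_left h ht.le
  have h3 : t * (u * Real.exp (K - 1) / t - 1) = u * Real.exp (K - 1) - t := by field_simp
  nlinarith

/-- The density, up to a factor `exp (-lam u)`, of the Laplace representation of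
`L ^ (-α) (β - α x / ((lam + x) L))`, where `L = log (lam + x)`. -/
noncomputable def logDensity (α β lam u : ℝ) : ℝ :=
  ∫ t in Ioi (0 : ℝ), u ^ (t - 1) * t ^ α / Real.Gamma (t + 1) * (β + lam * u - t)

/-- The factor `β + lam u - t` changes sign, so positivity comes from cancellation. The integrand is
at least the derivative of a function `Q` with `Q 0 = 0` and `Q ≥ 0`, so its integral over `[0, R]`
is at least `Q R ≥ 0`, and `R → ∞`. -/
theorem logDensity_nonneg {α β lam u : ℝ} (hβ : 0 < β) (hβ1 : β ≤ 1) (hα : 0 ≤ α)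
    (hlam : Real.exp ((3 + 2 * α) / β) ≤ lam) (hu : 0 < u) : 0 ≤ logDensity α β lam u := by
  unfold logDensity
  set φ : ℝ → ℝ := fun t => u ^ (t - 1) * t ^ α / Real.Gamma (t + 1) * (β + lam * u - t) with hφ
  by_cases hint : IntegrableOn φ (Ioi 0)
  swap
  · exact (integral_undef hint).ge
  have hα1 : 0 < α + 1 := by linarith
  set Q : ℝ → ℝ := fun t => β / (α + 1) * (u ^ (t - 1) * t ^ (α + 1) / Real.Gamma (t + 1)) with hQ
  have hGp : ∀ t : ℝ, 0 ≤ t → 0 < Real.Gamma (t + 1) := fun t ht => Real.Gamma_pos_of_pos (by linarith)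
  have hQ0 : Q 0 = 0 := by simp [hQ, Real.zero_rpow hα1.ne']
  have hQn : ∀ t, 0 ≤ t → 0 ≤ Q t := fun t ht => by
    have := hGp t ht
    simp only [hQ]; positivity
  have hlim : Filter.Tendsto (fun R : ℝ => ∫ t in (0 : ℝ)..R, φ t) Filter.atTop
      (nhds (∫ t in Ioi 0, φ t)) :=
    intervalIntegral_tendsto_integral_Ioi 0 hint Filter.tendsto_id
  refine ge_of_tendsto hlim ((Filter.eventually_ge_atTop 0).mono fun R hR => ?_)
  have hfin : IntegrableOn φ (Icc 0 R) := by
    rw [integrableOn_Icc_iff_integrableOn_Ioc]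
    exact hint.mono_set Ioc_subset_Ioi_self
  have hD : ∀ t ∈ Ioo 0 R, ∃ D, HasDerivAt Q D t ∧ D ≤ φ t := by
    intro t ht
    obtain ⟨ψ, hψ, hΓ⟩ := hasDerivAt_Gamma_add_one ht.1
    have ht0 : t ≠ 0 := ht.1.ne'
    have h1 : HasDerivAt (fun s : ℝ => u ^ (s - 1)) (u ^ (t - 1) * Real.log u) t := by
      have := ((hasDerivAt_id t).sub_const 1).const_rpow hu
      simpa [mul_comm] using this
    have h2 : HasDerivAt (fun s : ℝ => s ^ (α + 1)) ((α + 1) * t ^ α) t := by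
      have := Real.hasDerivAt_rpow_const (x := t) (p := α + 1) (Or.inl ht0)
      simpa using this
    have h3 := (((h1.mul h2).div hΓ (hGp t ht.1.le).ne').const_mul (β / (α + 1)))
    refine ⟨_, h3, ?_⟩
    have hG := hGp t ht.1.le
    set Γ := Real.Gamma (t + 1)
    have hpow : t ^ (α + 1) = t ^ α * t := by rw [Real.rpow_add ht.1, Real.rpow_one]
    set P := u ^ (t - 1) with hP
    have hPp : 0 < P := by positivity
    set A := t ^ α with hA
    have hAp : 0 < A := Real.rpow_pos_of_pos ht.1 _
    -- The choice `K = (α + 1) / β` makes the coefficient of `t` exactly `-1` after multiplication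
    -- by `β / (α + 1)`. What remains to check is `exp (K - 1) ≤ lam` and `β / (α + 1) ≤ 1`.
    have key : β / (α + 1) * (α + 1 + t * (Real.log u - ψ)) ≤ β + lam * u - t := by
      have hK := mul_log_sub_log_ge (t := t) (u := u) (K := (α + 1) / β) ht.1 hu
      have hK1 : 1 ≤ (α + 1) / β := by rw [le_div_iff₀ hβ]; linarith
      have hle : Real.exp ((α + 1) / β - 1) ≤ lam := by
        refine le_trans (Real.exp_le_exp.2 ?_) hlam
        have : (α + 1) / β ≤ (3 + 2 * α) / β := by gcongr ?_ / β; linarith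
        linarith
      have h5 : t * (Real.log u - ψ) ≤ t * (Real.log u - Real.log t) := by
        have := ht.1; gcongr
      have h6 : t * (Real.log u - ψ) ≤ u * lam - (α + 1) / β * t := by
        have : u * Real.exp ((α + 1) / β - 1) ≤ u * lam := by gcongr
        linarith
      have hb1 : β / (α + 1) ≤ 1 := by rw [div_le_one hα1]; linarith
      have hlam0 : 0 ≤ u * lam := mul_nonneg hu.le ((Real.exp_pos _).le.trans hlam)
      calc _ ≤ β / (α + 1) * (α + 1 + (u * lam - (α + 1) / β * t)) := by gcongr
        _ = β + β / (α + 1) * (u * lam) - t := by field_simp; ring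
        _ ≤ β + 1 * (u * lam) - t := by gcongr
        _ = _ := by ring
    simp only [hφ, Pi.mul_apply]
    rw [hpow]
    calc _ = P * A / Γ * (β / (α + 1) * (α + 1 + t * (Real.log u - ψ))) := by
          field_simp; ring
      _ ≤ _ := by gcongr
  choose! D hDd hDle using hD
  have hcont : ContinuousOn Q (Icc 0 R) := by
    refine ContinuousOn.mul continuousOn_const (ContinuousOn.div ?_ ?_ fun t ht => (hGp t ht.1).ne')
    · refine ContinuousOn.mul ?_ ?_
      · exact Continuous.continuousOn (continuous_const.rpow (by fun_prop) fun _ => Or.inl hu.ne')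
      · exact continuousOn_id.rpow_const fun _ _ => Or.inr hα1.le
    · intro t ht
      refine (DifferentiableAt.continuousAt (𝕜 := ℝ) ?_).continuousWithinAt
      refine (Real.differentiableAt_Gamma fun m => ?_).comp t (by fun_prop)
      have : (0 : ℝ) ≤ m := m.cast_nonneg
      linarith [ht.1]
  have := intervalIntegral.sub_le_integral_of_hasDeriv_right_of_le hR hcont
    (fun t ht => (hDd t ht).hasDerivWithinAt) hfin hDle
  linarith [hQn R hR]

/-- Integrating first in the second variable, Euler's integral gives `B ^ (-(t + c))`. Since `B ^
(-t) = exp (-t log B)`, a second Euler integral, in `t`, produces the power of `log B`. The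
integrand is positive, which justifies the iteration. -/
theorem integrable_exp_mul_rpow_div_Gamma {B a c : ℝ} (hB : 1 < B) (ha : 0 < a) (hc : 0 ≤ c) :
    Integrable (fun p : ℝ × ℝ => Real.exp (-(B * p.2)) * p.2 ^ (p.1 + c - 1) /
        Real.Gamma (p.1 + c) * p.1 ^ (a - 1))
      ((volume.restrict (Ioi 0)).prod (volume.restrict (Ioi 0))) ∧
    ∫ p, Real.exp (-(B * p.2)) * p.2 ^ (p.1 + c - 1) / Real.Gamma (p.1 + c) * p.1 ^ (a - 1)
      ∂((volume.restrict (Ioi 0)).prod (volume.restrict (Ioi (0 : ℝ)))) =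
      B ^ (-c) * (Real.Gamma a * Real.log B ^ (-a)) := by
  have hB0 : 0 < B := by linarith
  have hL : 0 < Real.log B := Real.log_pos hB
  have integ : ∀ {a r : ℝ}, 0 < a → 0 < r →
      IntegrableOn (fun t : ℝ => t ^ (a - 1) * Real.exp (-(r * t))) (Ioi 0) := by
    intro a r ha hr
    by_contra hcon
    have h := Real.integral_rpow_mul_exp_neg_mul_Ioi ha hr
    rw [integral_undef hcon] at h
    have := Real.Gamma_pos_of_pos ha
    have : 0 < (1 / r) ^ a * Real.Gamma a := by positivity
    linarith
  set k : ℝ × ℝ → ℝ := fun p => Real.exp (-(B * p.2)) * p.2 ^ (p.1 + c - 1) /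
        Real.Gamma (p.1 + c) * p.1 ^ (a - 1) with hk
  have hin : ∀ t : ℝ, 0 < t → ∫ u in Ioi (0 : ℝ), k (t, u) =
      B ^ (-c) * (t ^ (a - 1) * Real.exp (-(Real.log B * t))) := by
    intro t ht
    have htc : 0 < t + c := by linarith
    have hG := Real.Gamma_pos_of_pos htc
    have h1 : ∀ u, k (t, u) = (u ^ (t + c - 1) * Real.exp (-(B * u))) *
        (t ^ (a - 1) / Real.Gamma (t + c)) := by
      intro u; simp only [hk]; ring
    simp_rw [h1]
    rw [integral_mul_const, Real.integral_rpow_mul_exp_neg_mul_Ioi htc hB0]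
    have h2 : (1 / B) ^ (t + c) = B ^ (-c) * Real.exp (-(Real.log B * t)) := by
      rw [one_div, Real.inv_rpow hB0.le, ← Real.rpow_neg hB0.le, neg_add, add_comm,
        Real.rpow_add hB0, Real.rpow_def_of_pos hB0 (-t)]
      ring_nf
    rw [h2]; field_simp
  have hnn : ∀ t : ℝ, 0 < t → ∀ u : ℝ, 0 < u → 0 ≤ k (t, u) := by
    intro t ht u hu
    have hG := Real.Gamma_pos_of_pos (show 0 < t + c by linarith)
    simp only [hk]; positivity
  have hmeas : AEStronglyMeasurable k
      ((volume.restrict (Ioi 0)).prod (volume.restrict (Ioi 0))) := by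
    rw [Measure.prod_restrict]
    refine ContinuousOn.aestronglyMeasurable ?_ (measurableSet_Ioi.prod measurableSet_Ioi)
    refine ContinuousOn.mul (ContinuousOn.div (ContinuousOn.mul (by fun_prop) ?_) ?_ ?_) ?_
    · refine ContinuousOn.rpow (by fun_prop) (by fun_prop) ?_
      rintro ⟨t, u⟩ ⟨ht, hu⟩
      exact Or.inl (ne_of_gt hu)
    · rintro ⟨t, u⟩ ⟨ht, hu⟩
      have ht' : (0 : ℝ) < t := ht
      refine ContinuousAt.continuousWithinAt ?_
      refine ContinuousAt.comp (f := fun p : ℝ × ℝ => p.1 + c) (g := Real.Gamma) ?_ (by fun_prop)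
      refine (Real.differentiableAt_Gamma fun m => ?_).continuousAt
      have : (0 : ℝ) ≤ m := m.cast_nonneg
      simp only []
      linarith
    · rintro ⟨t, u⟩ ⟨ht, hu⟩
      have ht' : (0 : ℝ) < t := ht
      exact (Real.Gamma_pos_of_pos (show 0 < t + c by linarith)).ne'
    · refine ContinuousOn.rpow_const (by fun_prop) ?_
      rintro ⟨t, u⟩ ⟨ht, hu⟩
      exact Or.inl (ne_of_gt ht)
  have hI : Integrable k ((volume.restrict (Ioi 0)).prod (volume.restrict (Ioi 0))) := by
    rw [integrable_prod_iff hmeas]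
    constructor
    · refine (ae_restrict_mem measurableSet_Ioi).mono fun t ht => ?_
      have ht' : (0 : ℝ) < t := ht
      have := (integ (show 0 < t + c by linarith) hB0).mul_const (t ^ (a - 1) / Real.Gamma (t + c))
      refine this.congr (Filter.Eventually.of_forall fun u => ?_)
      simp only [hk]; ring
    · refine ((integ ha hL).const_mul (B ^ (-c))).congr
        ((ae_restrict_mem measurableSet_Ioi).mono fun t ht => ?_)
      beta_reduce
      rw [← hin t ht]
      refine setIntegral_congr_fun measurableSet_Ioi fun u hu => ?_
      exact (Real.norm_of_nonneg (hnn t ht u hu)).symm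
  refine ⟨hI, ?_⟩
  rw [integral_prod _ hI, setIntegral_congr_fun measurableSet_Ioi (fun t ht => hin t ht),
    integral_const_mul, Real.integral_rpow_mul_exp_neg_mul_Ioi ha hL, one_div,
    Real.inv_rpow hL.le, ← Real.rpow_neg hL.le, mul_comm (Real.log B ^ (-a))]

/-- With `B = lam + x` and `L = log B`, the identity `x / B = 1 - lam / B` turns the function into
`β L ^ (-α) + α lam B ^ (-1) L ^ (-α - 1) - α L ^ (-α - 1)`. Each term is a double integral from
`integrable_exp_mul_rpow_div_Gamma`, and after `Γ (t + 1) = t Γ t` the three integrands add up to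
that of `logDensity`. -/
theorem isLaplaceTransform_log {α β lam : ℝ} (hβ : 0 < β) (hβ1 : β ≤ 1) (hα : 0 < α)
    (hlam : Real.exp ((3 + 2 * α) / β) ≤ lam) :
    IsLaplaceTransform fun x => Real.log (lam + x) ^ (-α) *
      (β - α * x / ((lam + x) * Real.log (lam + x))) := by
  have hlam1 : 1 < lam := by
    refine lt_of_lt_of_le ?_ hlam
    rw [← Real.exp_zero]
    exact Real.exp_lt_exp.2 (by positivity)
  have hΓ := Real.Gamma_pos_of_pos hα
  set μ₀ : Measure ℝ := volume.restrict (Ioi 0) with hμ₀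
  have main : ∀ x, 0 < x →
      Integrable (fun u => Real.exp (-((lam + x) * u)) * logDensity α β lam u) μ₀ ∧
      ∫ u, Real.exp (-((lam + x) * u)) * logDensity α β lam u ∂μ₀ =
        Real.Gamma α * (Real.log (lam + x) ^ (-α) *
          (β - α * x / ((lam + x) * Real.log (lam + x)))) := by
    intro x hx
    have hB : 1 < lam + x := by linarith
    have hL := Real.log_pos hB
    obtain ⟨i1, v1⟩ := integrable_exp_mul_rpow_div_Gamma hB hα le_rfl
    obtain ⟨i2, v2⟩ := integrable_exp_mul_rpow_div_Gamma hB (show 0 < α + 1 by linarith) zero_le_one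
    obtain ⟨i3, v3⟩ := integrable_exp_mul_rpow_div_Gamma hB (show 0 < α + 1 by linarith) le_rfl
    have i := ((i1.const_mul β).add (i2.const_mul lam)).sub i3
    have v := integral_sub ((i1.const_mul β).add (i2.const_mul lam)) i3
    simp only [Pi.add_apply] at v
    rw [integral_add (i1.const_mul β) (i2.const_mul lam), integral_const_mul, integral_const_mul,
      v1, v2, v3] at v
    set k : ℝ × ℝ → ℝ := fun p => Real.exp (-((lam + x) * p.2)) *
      (p.2 ^ (p.1 - 1) * p.1 ^ α / Real.Gamma (p.1 + 1) * (β + lam * p.2 - p.1)) with hk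
    have hae : ∀ᵐ p ∂(μ₀.prod μ₀), 0 < p.1 ∧ 0 < p.2 := by
      rw [hμ₀, Measure.prod_restrict]
      exact (ae_restrict_mem (measurableSet_Ioi.prod measurableSet_Ioi)).mono fun p hp => hp
    have hkeq : ∀ p : ℝ × ℝ, 0 < p.1 ∧ 0 < p.2 →
        β * (Real.exp (-((lam + x) * p.2)) * p.2 ^ (p.1 + 0 - 1) /
          Real.Gamma (p.1 + 0) * p.1 ^ (α - 1)) +
        lam * (Real.exp (-((lam + x) * p.2)) * p.2 ^ (p.1 + 1 - 1) /
          Real.Gamma (p.1 + 1) * p.1 ^ (α + 1 - 1)) -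
        Real.exp (-((lam + x) * p.2)) * p.2 ^ (p.1 + 0 - 1) /
          Real.Gamma (p.1 + 0) * p.1 ^ (α + 1 - 1) = k p := by
      rintro ⟨t, u⟩ ⟨ht, hu⟩
      simp only [hk] at ht hu ⊢
      have hG := Real.Gamma_pos_of_pos ht
      rw [add_zero, Real.Gamma_add_one ht.ne', add_sub_cancel_right, add_sub_cancel_right,
        Real.rpow_sub_one ht.ne', Real.rpow_sub_one hu.ne']
      field_simp
    have ik : Integrable k (μ₀.prod μ₀) := i.congr (hae.mono fun p hp => hkeq p hp)
    have vk : ∫ p, k p ∂(μ₀.prod μ₀) = Real.Gamma α * (Real.log (lam + x) ^ (-α) *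
          (β - α * x / ((lam + x) * Real.log (lam + x)))) := by
      rw [← integral_congr_ae (hae.mono fun p hp => hkeq p hp), v, Real.Gamma_add_one hα.ne',
        neg_zero, Real.rpow_zero, neg_add, Real.rpow_add hL, Real.rpow_neg_one, Real.rpow_neg_one]
      have : 0 < lam + x := by linarith
      field_simp; ring
    have hsl : ∀ u, ∫ t, k (t, u) ∂μ₀ = Real.exp (-((lam + x) * u)) * logDensity α β lam u := by
      intro u
      simp only [hk, logDensity, hμ₀]
      rw [integral_const_mul]
    refine ⟨?_, ?_⟩
    · simpa only [hsl] using ik.integral_prod_right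
    · rw [← vk, integral_prod_symm _ ik]
      simp only [hsl]
  have hae : ∀ᵐ u ∂μ₀, 0 ≤ logDensity α β lam u :=
    (ae_restrict_mem measurableSet_Ioi).mono fun u hu =>
      logDensity_nonneg hβ hβ1 hα.le hlam hu
  have hN : AEMeasurable (fun u => ENNReal.ofReal
      (Real.exp (-(lam * u)) * logDensity α β lam u / Real.Gamma α)) μ₀ := by
    -- Measurability of the density is read off from integrability at `x = 1`; multiplying by `exp
    -- u` removes the extra factor `exp (-u)`.
    have h1 := (main 1 one_pos).1.aestronglyMeasurable.aemeasurable
    have h2 : AEMeasurable (fun u => Real.exp u *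
        (Real.exp (-((lam + 1) * u)) * logDensity α β lam u) / Real.Gamma α) μ₀ := by fun_prop
    refine (h2.congr (Filter.Eventually.of_forall fun u => ?_)).ennreal_ofReal
    beta_reduce
    rw [← mul_assoc, ← Real.exp_add]
    ring_nf
  refine ⟨μ₀.withDensity (fun u => ENNReal.ofReal
    (Real.exp (-(lam * u)) * logDensity α β lam u / Real.Gamma α)), inferInstance, ?_, fun x hx => ?_⟩
  · refine withDensity_absolutelyContinuous _ _ ?_
    rw [Measure.restrict_apply measurableSet_Iio]
    have : Iio (0 : ℝ) ∩ Ioi 0 = ∅ := by ext y; simp; intro h; linarith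
    rw [this, measure_empty]
  · obtain ⟨hi, hv⟩ := main x hx
    rw [lintegral_withDensity_eq_lintegral_mul₀ hN (by fun_prop)]
    have : Real.log (lam + x) ^ (-α) * (β - α * x / ((lam + x) * Real.log (lam + x))) =
        (∫ u, (Real.exp (-((lam + x) * u)) * logDensity α β lam u) / Real.Gamma α ∂μ₀) := by
      rw [integral_div, hv]; field_simp
    beta_reduce
    rw [this, ofReal_integral_eq_lintegral_ofReal (hi.div_const _)]
    · refine lintegral_congr_ae (hae.mono fun u hu => ?_)
      simp only [Pi.mul_apply]
      rw [← ENNReal.ofReal_mul (by positivity), add_mul, neg_add, Real.exp_add]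
      congr 1; ring
    · refine hae.mono fun u hu => ?_
      simp only [Pi.zero_apply]; positivity

/-! ### The Lévy measure of the symbol. -/

theorem div_two_le_one_sub_exp_neg {s : ℝ} (hs : 0 ≤ s) (hs1 : s ≤ 1) :
    s / 2 ≤ 1 - Real.exp (-s) := by
  have h1 : Real.exp (-s) ≤ 1 / (1 + s) := by
    rw [Real.exp_neg, ← one_div]
    exact one_div_le_one_div_of_le (by linarith) (by linarith [Real.add_one_le_exp s])
  have h2 : 1 / (1 + s) ≤ 1 - s / 2 := by
    rw [div_le_iff₀ (by linarith)]; nlinarith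
  linarith

/-- The function `r ^ β / log ^ α (lam + r)` is a mixture of the functions `1 - exp (-s r ^ 2)`. -/
theorem exists_levy_measure {α β lam : ℝ} (hβ : 0 < β) (hβ1 : β ≤ 1) (hα : 0 ≤ α)
    (hlam : Real.exp ((3 + 2 * α) / β) ≤ lam) :
    ∃ ν : Measure ℝ, SFinite ν ∧ ν (Iic 0) = 0 ∧
      (∀ r : ℝ, 0 ≤ r → ∫⁻ s, ENNReal.ofReal (1 - Real.exp (-(s * r ^ 2))) ∂ν =
        ENNReal.ofReal (r ^ β / Real.log (lam + r) ^ α)) ∧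
      ∫⁻ s, ENNReal.ofReal (min s (s ^ (β / 4))) ∂ν < ⊤ := by
  have hloglam : (3 + 2 * α) / β ≤ Real.log lam := by
    rw [Real.le_log_iff_exp_le (lt_of_lt_of_le (Real.exp_pos _) hlam)]; exact hlam
  have hlam1 : 1 < lam := by
    refine lt_of_lt_of_le ?_ hlam
    rw [← Real.exp_zero]
    exact Real.exp_lt_exp.2 (by positivity)
  have hLlow : ∀ x, 0 ≤ x → (3 + 2 * α) / β ≤ Real.log (lam + x) := fun x hx =>
    hloglam.trans (Real.log_le_log (by linarith) (by linarith))
  have hL1 : ∀ x, 0 ≤ x → 1 ≤ Real.log (lam + x) := fun x hx => by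
    refine le_trans ?_ (hLlow x hx)
    rw [le_div_iff₀ hβ]; linarith
  -- The derivative of `x ^ β log ^ (-α) (lam + x)` is `x ^ (β - 1) C x`. Both factors are Laplace
  -- transforms, hence so is the product.
  set C : ℝ → ℝ := fun x => Real.log (lam + x) ^ (-α) *
      (β - α * x / ((lam + x) * Real.log (lam + x))) with hC
  have hCn : ∀ x, 0 < x → 0 ≤ C x := by
    intro x hx
    have h1 := hL1 x hx.le
    have h2 := hLlow x hx.le
    have h3 : α * x / ((lam + x) * Real.log (lam + x)) ≤ β := by
      rw [div_le_iff₀ (by positivity)]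
      rw [div_le_iff₀ hβ] at h2
      have : α ≤ β * Real.log (lam + x) := by linarith
      calc α * x ≤ (β * Real.log (lam + x)) * x := by gcongr
        _ ≤ (β * Real.log (lam + x)) * (lam + x) := by gcongr; linarith
        _ = _ := by ring
    exact mul_nonneg (by positivity) (by linarith)
  have hlap : IsLaplaceTransform fun x => x ^ (-(1 - β)) * C x := by
    refine (isLaplaceTransform_rpow_neg (by linarith)).mul ?_ fun x hx => by positivity
    rcases hα.eq_or_lt with rfl | hα
    · simpa [hC] using isLaplaceTransform_const β
    · exact isLaplaceTransform_log hβ hβ1 hα hlam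
  obtain ⟨ν, hν, hν0, hνr⟩ := hlap.exists_measure
  have hrep : ∀ r : ℝ, 0 ≤ r → ∫⁻ s, ENNReal.ofReal (1 - Real.exp (-(s * r ^ 2))) ∂ν =
        ENNReal.ofReal (r ^ β / Real.log (lam + r) ^ α) := by
    intro r hr
    rw [hνr r hr]
    set g : ℝ → ℝ := fun r => r ^ β * Real.log (lam + r) ^ (-α) with hg
    have hcont : ContinuousOn g (Icc 0 r) := by
      refine ContinuousOn.mul (continuousOn_id.rpow_const fun _ _ => Or.inr hβ.le) ?_
      refine ContinuousOn.rpow_const (ContinuousOn.log (by fun_prop) ?_) ?_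
      · intro x hx; linarith [hx.1]
      · intro x hx; exact Or.inl (by linarith [hL1 x hx.1])
    have hder : ∀ x ∈ Ioo 0 r, HasDerivAt g (x ^ (-(1 - β)) * C x) x := by
      intro x hx
      have hx0 : 0 < x := hx.1
      have hl := hL1 x hx0.le
      have hlx : 0 < lam + x := by linarith
      have h1 := Real.hasDerivAt_rpow_const (x := x) (p := β) (Or.inl hx0.ne')
      have h2 := (((hasDerivAt_id x).const_add lam).log hlx.ne').rpow_const (p := -α)
        (Or.inl (by simp only [id]; linarith))
      refine (h1.mul h2).congr_deriv ?_
      simp only [hC, id]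
      have e1 : x ^ β = x ^ (-(1 - β)) * x := by
        nth_rewrite 3 [← Real.rpow_one x]
        rw [← Real.rpow_add hx0]; ring_nf
      have e2 : x ^ (β - 1) = x ^ (-(1 - β)) := by ring_nf
      have e3 : Real.log (lam + x) ^ (-α - 1) =
          Real.log (lam + x) ^ (-α) / Real.log (lam + x) := Real.rpow_sub_one (by linarith) _
      rw [e2, e1, e3]
      field_simp
      ring
    have hpos : ∀ x ∈ Ioo 0 r, 0 ≤ x ^ (-(1 - β)) * C x := fun x hx =>
      mul_nonneg (Real.rpow_nonneg hx.1.le _) (hCn x hx.1)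
    have hi := intervalIntegral.integrableOn_deriv_of_nonneg hcont hder hpos
    have hv := intervalIntegral.integral_eq_sub_of_hasDerivAt_of_le hr hcont hder
      ((intervalIntegrable_iff_integrableOn_Ioc_of_le hr).2 hi)
    have hgr : r ^ β / Real.log (lam + r) ^ α = g r - g 0 := by
      simp only [hg]
      rw [Real.zero_rpow hβ.ne', zero_mul, sub_zero, Real.rpow_neg (by linarith [hL1 r hr])]
      rfl
    rw [hgr, ← hv, intervalIntegral.integral_of_le hr, integral_Ioc_eq_integral_Ioo,
      ofReal_integral_eq_lintegral_ofReal (hi.mono_set Ioo_subset_Ioc_self)]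
    exact (ae_restrict_mem measurableSet_Ioo).mono fun x hx => hpos x hx
  refine ⟨ν, hν, hν0, hrep, ?_⟩
  -- Any positive `b < β / 2` would make the geometric ratio `4 ^ b (1 / 2) ^ β` below smaller than
  -- `1`.
  set b := β / 4 with hb
  have hb0 : 0 < b := by positivity
  have hb1 : b ≤ 1 := by linarith
  -- The representation evaluated at `r = 2 ^ (-k)` detects the mass of `ν` at scales `s ≥ 4 ^ k`.
  -- One term of the series suffices: `k = 0` if `s ≤ 1`, and `k = n` if `4 ^ n ≤ s < 4 ^ (n + 1)`.
  have hpt : ∀ s, 0 < s → ENNReal.ofReal (min s (s ^ b)) ≤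
      8 * ∑' k : ℕ, ENNReal.ofReal ((4 ^ b) ^ k) *
        ENNReal.ofReal (1 - Real.exp (-(s * ((1 / 2) ^ k) ^ 2))) := by
    intro s hs
    have hsuff : ∀ k : ℕ, min s (s ^ b) ≤
        8 * ((4 ^ b) ^ k * (1 - Real.exp (-(s * ((1 / 2) ^ k) ^ 2)))) →
        ENNReal.ofReal (min s (s ^ b)) ≤
      8 * ∑' k : ℕ, ENNReal.ofReal ((4 ^ b) ^ k) *
        ENNReal.ofReal (1 - Real.exp (-(s * ((1 / 2) ^ k) ^ 2))) := by
      intro k hk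
      refine (ENNReal.ofReal_le_ofReal hk).trans ?_
      rw [ENNReal.ofReal_mul (by norm_num), ENNReal.ofReal_mul (by positivity)]
      gcongr
      · simp
      · exact ENNReal.le_tsum (f := fun k : ℕ => ENNReal.ofReal ((4 ^ b) ^ k) *
          ENNReal.ofReal (1 - Real.exp (-(s * ((1 / 2) ^ k) ^ 2)))) k
    rcases le_total s 1 with h1 | h1
    · refine hsuff 0 ((min_le_left _ _).trans ?_)
      have := div_two_le_one_sub_exp_neg hs.le h1
      simp only [pow_zero, one_pow, mul_one, one_mul]
      linarith
    · obtain ⟨n, hn1, hn2⟩ := exists_nat_pow_near h1 (show (1 : ℝ) < 4 by norm_num)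
      refine hsuff n ((min_le_right _ _).trans ?_)
      have e1 : (1 : ℝ) ≤ s * ((1 / 2) ^ n) ^ 2 := by
        rw [← pow_mul, mul_comm n 2, pow_mul]
        norm_num
        rwa [← inv_eq_one_div, inv_pow, ← div_eq_mul_inv, le_div_iff₀ (by positivity), one_mul]
      have e2 : (1 : ℝ) / 2 ≤ 1 - Real.exp (-(s * ((1 / 2) ^ n) ^ 2)) := by
        have := div_two_le_one_sub_exp_neg zero_le_one le_rfl
        have : Real.exp (-(s * ((1 / 2) ^ n) ^ 2)) ≤ Real.exp (-1) :=
          Real.exp_le_exp.2 (by linarith)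
        linarith
      have e3 : s ^ b ≤ 4 * (4 ^ b) ^ n := by
        calc s ^ b ≤ (4 ^ (n + 1)) ^ b := by gcongr
          _ = 4 ^ b * (4 ^ b) ^ n := by
              rw [← Real.rpow_natCast, ← Real.rpow_mul (by norm_num), mul_comm, Real.rpow_mul (by norm_num),
                Real.rpow_natCast, pow_succ, mul_comm]
          _ ≤ 4 ^ (1 : ℝ) * (4 ^ b) ^ n := by gcongr; norm_num
          _ = _ := by rw [Real.rpow_one]
      calc s ^ b ≤ 4 * (4 ^ b) ^ n := e3
        _ = 8 * ((4 ^ b) ^ n * (1 / 2)) := by ring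
        _ ≤ _ := by gcongr
  have hae : ∀ᵐ s ∂ν, 0 < s := by
    rw [ae_iff]; convert hν0 using 2; ext; simp
  calc _ ≤ ∫⁻ s, 8 * ∑' k : ℕ, ENNReal.ofReal ((4 ^ b) ^ k) *
        ENNReal.ofReal (1 - Real.exp (-(s * ((1 / 2) ^ k) ^ 2))) ∂ν :=
        lintegral_mono_ae (hae.mono hpt)
    _ = 8 * ∑' k : ℕ, ENNReal.ofReal ((4 ^ b) ^ k) *
          ENNReal.ofReal (((1 / 2) ^ k) ^ β / Real.log (lam + (1 / 2) ^ k) ^ α) := by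
        rw [lintegral_const_mul' _ _ (by norm_num), lintegral_tsum fun k => by fun_prop]
        congr 2; ext k
        rw [lintegral_const_mul _ (by fun_prop), hrep _ (by positivity)]
    _ ≤ 8 * ∑' k : ℕ, ENNReal.ofReal ((4 ^ b * (1 / 2) ^ β) ^ k) := by
        gcongr with k
        rw [← ENNReal.ofReal_mul (by positivity)]
        refine ENNReal.ofReal_le_ofReal ?_
        rw [mul_pow]
        gcongr
        calc _ ≤ ((1 / 2 : ℝ) ^ k) ^ β := div_le_self (by positivity)
              (Real.one_le_rpow (hL1 _ (by positivity)) hα)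
          _ = _ := by
              rw [← Real.rpow_natCast, ← Real.rpow_mul (by norm_num), mul_comm,
                Real.rpow_mul (by norm_num), Real.rpow_natCast]
    _ < ⊤ := by
        refine ENNReal.mul_lt_top (by norm_num) ?_
        have hq : (4 : ℝ) ^ b * (1 / 2) ^ β < 1 := by
          have : (4 : ℝ) = 2 ^ (2 : ℝ) := by norm_num
          rw [this, ← Real.rpow_mul (by norm_num), one_div, Real.inv_rpow (by norm_num),
            ← Real.rpow_neg (by norm_num), ← Real.rpow_add (by norm_num)]
          exact Real.rpow_lt_one_of_one_lt_of_neg (by norm_num) (by rw [hb]; linarith)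
        have hs := summable_geometric_of_lt_one (by positivity) hq
        rw [← ENNReal.ofReal_tsum_of_nonneg (fun n => by positivity) hs]
        exact ENNReal.ofReal_lt_top

/-! ### The heat semigroup as a Gaussian average. -/

section Heat

open ProbabilityTheory Filter Topology

set_option linter.unusedSectionVars false

variable {V : Type*} [NormedAddCommGroup V] [InnerProductSpace ℝ V] [FiniteDimensional ℝ V]
  [MeasurableSpace V] [BorelSpace V]

/-- The heat semigroup `exp (r Δ) u`, written as a Gaussian average of translates of `u`. -/
noncomputable def heatMean (r : ℝ) (u : V → ℝ) (x : V) : ℝ :=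
  ∫ z, u (x + Real.sqrt (2 * r) • z) ∂(stdGaussian V)

/-- The unnormalized heat kernel `exp (-‖x‖ ^ 2 / (4 σ))`. -/
noncomputable def gaussWeight (σ : ℝ) (x : V) : ℝ := Real.exp (-‖x‖ ^ 2 / (4 * σ))

theorem integral_stdGaussian_comp_neg {F : Type*} [NormedAddCommGroup F] [NormedSpace ℝ F]
    (h : V → F) : ∫ z, h (-z) ∂(stdGaussian V) = ∫ z, h z ∂(stdGaussian V) := by
  have hm : (stdGaussian V).map (LinearIsometryEquiv.neg ℝ (E := V)) = stdGaussian V :=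
    stdGaussian_map _
  conv_rhs => rw [← hm]
  exact ((LinearIsometryEquiv.neg ℝ (E := V)).toHomeomorph.measurableEmbedding.integral_map h).symm

theorem integrable_norm_sq_stdGaussian :
    Integrable (fun z : V => ‖z‖ ^ 2) (stdGaussian V) := by
  have : MemLp (id : V → V) 2 (stdGaussian V) := IsGaussian.memLp_id _ 2 (by norm_num)
  exact this.integrable_norm_pow (by norm_num)

theorem integral_cexp_inner_stdGaussian (c : ℝ) (ξ : V) :
    ∫ z, Complex.exp (↑(-2 * Real.pi * inner ℝ ξ (c • z)) * Complex.I) ∂(stdGaussian V) =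
      (Real.exp (-(2 * Real.pi ^ 2 * c ^ 2 * ‖ξ‖ ^ 2)) : ℝ) := by
  have := charFun_stdGaussian (E := V) ((-2 * Real.pi * c) • ξ)
  rw [charFun_apply] at this
  convert this using 1
  · congr 1; ext z
    rw [inner_smul_right, inner_smul_right, real_inner_comm]
    congr 3; ring
  · rw [norm_smul, Complex.ofReal_exp]
    congr 1
    rw [← Complex.ofReal_pow, mul_pow, Real.norm_eq_abs, sq_abs]
    push_cast; ring

/-- The heat semigroup is a Fourier multiplier. -/
theorem fourier_exp_mul {φ : V → ℂ} (hφ : Integrable φ) {r : ℝ} (hr : 0 ≤ r) (x : V) :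
    𝓕 (fun ξ => ((Real.exp (-(4 * Real.pi ^ 2 * r * ‖ξ‖ ^ 2)) : ℝ) : ℂ) * φ ξ) x =
      ∫ z, 𝓕 φ (x + Real.sqrt (2 * r) • z) ∂(stdGaussian V) := by
  simp only [Real.fourier_eq', smul_eq_mul]
  set c := Real.sqrt (2 * r) with hc
  have hc2 : c ^ 2 = 2 * r := Real.sq_sqrt (by positivity)
  rw [integral_integral_swap]
  · congr 1; ext ξ
    have h1 : ∀ z : V, Complex.exp (↑(-2 * Real.pi * inner ℝ ξ (x + c • z)) * Complex.I) * φ ξ =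
        Complex.exp (↑(-2 * Real.pi * inner ℝ ξ (c • z)) * Complex.I) *
          (Complex.exp (↑(-2 * Real.pi * inner ℝ ξ x) * Complex.I) * φ ξ) := by
      intro z
      rw [← mul_assoc, ← Complex.exp_add]
      congr 2
      rw [inner_add_right]; push_cast; ring
    simp_rw [h1]
    rw [integral_mul_const, integral_cexp_inner_stdGaussian, hc2]
    have : 2 * Real.pi ^ 2 * (2 * r) * ‖ξ‖ ^ 2 = 4 * Real.pi ^ 2 * r * ‖ξ‖ ^ 2 := by ring
    rw [this]; ring
  · have h2 : Integrable (fun p : V × V => φ p.2) ((stdGaussian V).prod volume) :=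
      hφ.comp_snd _
    refine h2.norm.mono' ?_ (Eventually.of_forall fun p => ?_)
    · refine AEStronglyMeasurable.mul ?_ h2.aestronglyMeasurable
      exact Continuous.aestronglyMeasurable (by fun_prop)
    · simp only [Function.uncurry]
      rw [norm_mul, Complex.norm_exp_ofReal_mul_I, one_mul]

theorem fourier_exp_neg_norm_sq {σ : ℝ} (hσ : 0 < σ) (x : V) :
    𝓕 (fun ξ : V => ((Real.exp (-(4 * Real.pi ^ 2 * σ * ‖ξ‖ ^ 2)) : ℝ) : ℂ)) x =
      (((4 * Real.pi * σ)⁻¹ ^ (Module.finrank ℝ V / 2 : ℝ) * gaussWeight σ x : ℝ) : ℂ) := by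
  have hb : 0 < 4 * Real.pi ^ 2 * σ := by have := Real.pi_pos; positivity
  have h := fourier_gaussian_innerProductSpace (V := V) (b := ((4 * Real.pi ^ 2 * σ : ℝ) : ℂ))
    (by rw [Complex.ofReal_re]; exact hb) x
  have h1 : (fun ξ : V => ((Real.exp (-(4 * Real.pi ^ 2 * σ * ‖ξ‖ ^ 2)) : ℝ) : ℂ)) =
      fun v : V => Complex.exp (-((4 * Real.pi ^ 2 * σ : ℝ) : ℂ) * (‖v‖ : ℂ) ^ 2) := by
    ext ξ; rw [Complex.ofReal_exp]; congr 1; push_cast; ring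
  rw [h1, h, Complex.ofReal_mul (_ ^ _)]
  have hpi := Real.pi_pos
  congr 1
  · rw [Complex.ofReal_cpow (by positivity)]
    congr 1
    · rw [← Complex.ofReal_div]; congr 1; field_simp
    · push_cast; ring
  · rw [gaussWeight, Complex.ofReal_exp]
    congr 1
    push_cast
    have : (Real.pi : ℂ) ≠ 0 := by exact_mod_cast hpi.ne'
    have : (σ : ℂ) ≠ 0 := by exact_mod_cast hσ.ne'
    field_simp

theorem integrable_gaussWeight {σ : ℝ} (hσ : 0 < σ) : Integrable (gaussWeight σ : V → ℝ) := by
  have := GaussianFourier.integrable_cexp_neg_mul_sq_norm_add (V := V) (b := ((1 / (4 * σ) : ℝ) : ℂ))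
    (by rw [Complex.ofReal_re]; positivity) 0 0
  refine this.norm.congr (Eventually.of_forall fun x => ?_)
  beta_reduce
  rw [gaussWeight, Complex.norm_exp]
  congr 1
  have : -((1 / (4 * σ) : ℝ) : ℂ) * (‖x‖ : ℂ) ^ 2 + 0 * ((inner ℝ 0 x : ℝ) : ℂ) =
    ((-‖x‖ ^ 2 / (4 * σ) : ℝ) : ℂ) := by push_cast; ring
  rw [this, Complex.ofReal_re]

/-- On the Fourier side two Gaussians are multiplied, so their widths add. The prefactor is the
ratio of the normalizations of the two heat kernels. -/
theorem heatMean_gaussWeight {σ r : ℝ} (hσ : 0 < σ) (hr : 0 ≤ r) (x : V) :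
    heatMean r (gaussWeight σ) x =
      (σ / (σ + r)) ^ (Module.finrank ℝ V / 2 : ℝ) * gaussWeight (σ + r) x := by
  have hpi := Real.pi_pos
  set φ : V → ℂ := fun ξ => ((Real.exp (-(4 * Real.pi ^ 2 * σ * ‖ξ‖ ^ 2)) : ℝ) : ℂ) with hφ
  have hint : Integrable φ := by
    refine Integrable.ofReal ?_
    refine (integrable_gaussWeight (V := V) (σ := 1 / (16 * Real.pi ^ 2 * σ)) (by positivity)).congr
      (Eventually.of_forall fun ξ => ?_)
    simp only [gaussWeight]
    congr 1; field_simp; ring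
  have h := fourier_exp_mul hint hr x
  have h1 : (fun ξ => ((Real.exp (-(4 * Real.pi ^ 2 * r * ‖ξ‖ ^ 2)) : ℝ) : ℂ) * φ ξ) =
      fun ξ => ((Real.exp (-(4 * Real.pi ^ 2 * (σ + r) * ‖ξ‖ ^ 2)) : ℝ) : ℂ) := by
    ext ξ
    simp only [hφ]
    rw [← Complex.ofReal_mul, ← Real.exp_add]; congr 2; ring
  rw [h1, fourier_exp_neg_norm_sq (by positivity)] at h
  simp_rw [hφ, fourier_exp_neg_norm_sq hσ] at h
  rw [integral_complex_ofReal, Complex.ofReal_inj, integral_const_mul] at h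
  rw [heatMean]
  set I := ∫ z, gaussWeight σ (x + Real.sqrt (2 * r) • z) ∂(stdGaussian V)
  have h2 : ((4 * Real.pi * σ)⁻¹) ^ (Module.finrank ℝ V / 2 : ℝ) *
      ((σ / (σ + r)) ^ (Module.finrank ℝ V / 2 : ℝ)) =
      ((4 * Real.pi * (σ + r))⁻¹) ^ (Module.finrank ℝ V / 2 : ℝ) := by
    rw [← Real.mul_rpow (by positivity) (by positivity)]
    congr 1; field_simp
  have h3 : 0 < ((4 * Real.pi * σ)⁻¹) ^ (Module.finrank ℝ V / 2 : ℝ) := by positivity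
  rw [← h2, mul_assoc] at h
  exact (mul_left_cancel₀ h3.ne' h).symm

theorem continuous_gaussWeight (σ : ℝ) : Continuous (gaussWeight σ : V → ℝ) := by
  unfold gaussWeight; fun_prop

theorem gaussWeight_pos (σ : ℝ) (x : V) : 0 < gaussWeight σ x := Real.exp_pos _

theorem continuous_heatMean {u : V → ℝ} (hu : Continuous u) {M : ℝ} (hM : ∀ x, |u x| ≤ M) :
    Continuous fun p : ℝ × V => heatMean p.1 u p.2 := by
  unfold heatMean
  refine continuous_of_dominated (bound := fun _ => M) ?_ ?_ (integrable_const _) ?_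
  · intro p
    exact Continuous.aestronglyMeasurable (by fun_prop)
  · intro p
    exact Eventually.of_forall fun z => hM _
  · exact Eventually.of_forall fun z => by fun_prop

theorem integrable_heatMean_integrand {u : V → ℝ} (hu : Continuous u) {M : ℝ}
    (hM : ∀ x, |u x| ≤ M) (r : ℝ) (x : V) :
    Integrable (fun z => u (x + Real.sqrt (2 * r) • z)) (stdGaussian V) :=
  (integrable_const M).mono' (Continuous.aestronglyMeasurable (by fun_prop))
    (Eventually.of_forall fun _ => hM _)

theorem abs_heatMean_le {u : V → ℝ} {M : ℝ} (hM : ∀ x, |u x| ≤ M) (r : ℝ) (x : V) :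
    |heatMean r u x| ≤ M := by
  unfold heatMean
  have := norm_integral_le_of_norm_le_const (μ := stdGaussian V) (C := M)
    (f := fun z => u (x + Real.sqrt (2 * r) • z)) (Eventually.of_forall fun z => hM _)
  simpa using this

/-- Justifies exchanging the space integral with the Gaussian average: for each `z` the slice is a
bounded function times a translate of `ψ`, with `L¹` norm at most `M ∫ ‖ψ‖`. -/
theorem integrable_mul_translates {u ψ : V → ℝ} (hu : Continuous u) {M : ℝ}
    (hM : ∀ x, |u x| ≤ M) (hψ : Integrable ψ) (hψc : Continuous ψ) (a b : ℝ) :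
    Integrable (Function.uncurry fun (x : V) (z : V) => u (x + a • z) * ψ (x + b • z))
      ((volume : Measure V).prod (stdGaussian V)) := by
  have hcont : Continuous (Function.uncurry fun (x : V) (z : V) =>
    u (x + a • z) * ψ (x + b • z)) := by simp only [Function.uncurry_def]; fun_prop
  rw [integrable_prod_iff' hcont.aestronglyMeasurable]
  constructor
  · refine Eventually.of_forall fun z => ?_
    exact (hψ.comp_add_right (b • z)).bdd_mul (f := fun x => u (x + a • z))
      (Continuous.aestronglyMeasurable (by fun_prop)) (Eventually.of_forall fun x => hM _)
  · refine (integrable_const (M * ∫ x, ‖ψ x‖)).mono' ?_ (Eventually.of_forall fun z => ?_)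
    · exact hcont.norm.stronglyMeasurable.integral_prod_left' |>.aestronglyMeasurable
    · rw [Real.norm_of_nonneg (integral_nonneg fun _ => norm_nonneg _)]
      simp only [Function.uncurry]
      rw [← integral_add_right_eq_self (fun x => ‖ψ x‖) (b • z), ← integral_const_mul]
      refine integral_mono_of_nonneg (Eventually.of_forall fun _ => norm_nonneg _)
        ((hψ.comp_add_right _).norm.const_mul _) (Eventually.of_forall fun x => ?_)
      beta_reduce
      rw [norm_mul]
      gcongr
      exact hM _

/-- The heat semigroup is symmetric. -/
theorem integral_mul_heatMean {u ψ : V → ℝ} (hu : Continuous u) {M : ℝ} (hM : ∀ x, |u x| ≤ M)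
    (hψ : Integrable ψ) (hψc : Continuous ψ) (r : ℝ) :
    ∫ x, u x * heatMean r ψ x = ∫ x, heatMean r u x * ψ x := by
  unfold heatMean
  set c := Real.sqrt (2 * r)
  have h0 := integrable_mul_translates hu hM hψ hψc 0 c
  have h1 := integrable_mul_translates hu hM hψ hψc c 0
  simp only [zero_smul, add_zero] at h0 h1
  simp_rw [← integral_const_mul, ← integral_mul_const]
  -- For fixed `z`, translating `x` by `c • z` moves the shift from `ψ` to `u` with the opposite
  -- sign, and the Gaussian measure is even.
  rw [integral_integral_swap h0, integral_integral_swap h1,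
    ← integral_stdGaussian_comp_neg (fun z => ∫ x, u (x + c • z) * ψ x)]
  congr 1; ext z
  refine Eq.trans ?_ (integral_add_right_eq_self (fun x => u (x + c • -z) * ψ x) (c • z))
  simp

theorem integrable_mul_heatMean {u ψ : V → ℝ} (hu : Continuous u) {M : ℝ}
    (hM : ∀ x, |u x| ≤ M) (hψ : Integrable ψ) (hψc : Continuous ψ) (r : ℝ) :
    Integrable fun x => u x * heatMean r ψ x := by
  have h0 := integrable_mul_translates hu hM hψ hψc 0 (Real.sqrt (2 * r))
  simp only [zero_smul, add_zero] at h0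
  refine h0.integral_prod_left.congr (Eventually.of_forall fun x => ?_)
  simp only [Function.uncurry, heatMean]
  rw [integral_const_mul]

theorem integrable_heatMean {ψ : V → ℝ} (hψ : Integrable ψ) (hψc : Continuous ψ) (r : ℝ) :
    Integrable (heatMean r ψ) := by
  simpa using integrable_mul_heatMean (u := fun _ => 1) (M := 1) continuous_const (by simp) hψ hψc r

/-- The symmetric second difference of `u`. -/
theorem sub_heatMean_eq {u : V → ℝ} {r : ℝ} {x : V}
    (hi : Integrable (fun z => u (x + Real.sqrt (2 * r) • z)) (stdGaussian V)) :
    u x - heatMean r u x = -(1 / 2) * ∫ z, (u (x + Real.sqrt (2 * r) • z) +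
      u (x - Real.sqrt (2 * r) • z) - 2 * u x) ∂(stdGaussian V) := by
  have hm : (stdGaussian V).map (LinearIsometryEquiv.neg ℝ (E := V)) = stdGaussian V :=
    stdGaussian_map _
  have hi' : Integrable (fun z => u (x - Real.sqrt (2 * r) • z)) (stdGaussian V) := by
    rw [← hm] at hi
    have := ((LinearIsometryEquiv.neg ℝ (E := V)).toHomeomorph.measurableEmbedding.integrable_map_iff).1 hi
    refine this.congr (Eventually.of_forall fun z => ?_)
    simp [sub_eq_add_neg]
  have hneg : ∫ z, u (x - Real.sqrt (2 * r) • z) ∂(stdGaussian V) = heatMean r u x := by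
    rw [heatMean, ← integral_stdGaussian_comp_neg]
    simp [sub_eq_add_neg]
  have h := integral_sub (hi.add hi') (integrable_const (μ := stdGaussian V) (2 * u x))
  simp only [Pi.add_apply] at h
  rw [h, integral_add hi hi', hneg, heatMean]
  simp; ring

/-- A function with Lipschitz derivative has quadratically small second differences. -/
theorem abs_second_difference_le {u : V → ℝ} (hu : Differentiable ℝ u) {A : ℝ} (hA : 0 ≤ A)
    (hlip : ∀ x y, ‖fderiv ℝ u x - fderiv ℝ u y‖ ≤ A * ‖x - y‖) (x y : V) :
    |u (x + y) + u (x - y) - 2 * u x| ≤ 2 * A * ‖y‖ ^ 2 := by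
  have key : ∀ y : V, |u (x + y) - u x - fderiv ℝ u x y| ≤ A * ‖y‖ ^ 2 := by
    intro y
    have := (convex_closedBall x ‖y‖).norm_image_sub_le_of_norm_hasFDerivWithin_le' (f := u)
      (f' := fderiv ℝ u) (φ := fderiv ℝ u x) (C := A * ‖y‖) (x := x) (y := x + y)
      (fun z _ => (hu z).hasFDerivAt.hasFDerivWithinAt) (fun z hz => ?_) (by simp) (by simp)
    · simpa [pow_two, mul_assoc] using this
    · refine (hlip z x).trans ?_
      gcongr
      simpa [dist_eq_norm] using hz
  have h1 := abs_le.1 (key y)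
  have h2 := abs_le.1 (key (-y))
  rw [map_neg, norm_neg, ← sub_eq_add_neg] at h2
  rw [abs_le]
  constructor <;> linarith [h1.1, h1.2, h2.1, h2.2]

/-- The second moment of the standard Gaussian measure. -/
noncomputable def gaussSecondMoment (V : Type*) [NormedAddCommGroup V] [InnerProductSpace ℝ V]
    [FiniteDimensional ℝ V] [MeasurableSpace V] [BorelSpace V] : ℝ :=
  ∫ z : V, ‖z‖ ^ 2 ∂(stdGaussian V)

variable (V) in
theorem gaussSecondMoment_nonneg : 0 ≤ gaussSecondMoment V :=
  integral_nonneg fun _ => by positivity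

/-- For large `r` the sup bound suffices. For small `r` the evenness of the Gaussian removes the
first-order term, and the second difference is at most `4 A r ‖z‖ ^ 2`, whose average is finite. The
factor `min 1 r` is what a Lévy measure integrates. -/
theorem abs_sub_heatMean_le {u : V → ℝ} (hu : Differentiable ℝ u) {M A : ℝ} (hM : ∀ x, |u x| ≤ M)
    (hA : 0 ≤ A) (hlip : ∀ x y, ‖fderiv ℝ u x - fderiv ℝ u y‖ ≤ A * ‖x - y‖) {r : ℝ}
    (hr : 0 ≤ r) (x : V) :
    |u x - heatMean r u x| ≤ 2 * (M + A * gaussSecondMoment V) * min 1 r := by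
  have hM0 : 0 ≤ M := (abs_nonneg _).trans (hM x)
  have hm0 : 0 ≤ gaussSecondMoment V := gaussSecondMoment_nonneg V
  have h1 : |u x - heatMean r u x| ≤ 2 * M := by
    have := abs_heatMean_le hM r x
    calc _ ≤ |u x| + |heatMean r u x| := abs_sub _ _
      _ ≤ 2 * M := by linarith [hM x]
  have h2 : |u x - heatMean r u x| ≤ 2 * A * gaussSecondMoment V * r := by
    rw [sub_heatMean_eq (integrable_heatMean_integrand hu.continuous hM r x), abs_mul]
    have : |∫ z, (u (x + Real.sqrt (2 * r) • z) +
      u (x - Real.sqrt (2 * r) • z) - 2 * u x) ∂(stdGaussian V)| ≤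
        ∫ z, 4 * A * r * ‖z‖ ^ 2 ∂(stdGaussian V) := by
      rw [← Real.norm_eq_abs]
      refine norm_integral_le_of_norm_le ((integrable_norm_sq_stdGaussian (V := V)).const_mul _)
        (Eventually.of_forall fun z => ?_)
      refine (abs_second_difference_le hu hA hlip x _).trans (le_of_eq ?_)
      rw [norm_smul, mul_pow, Real.norm_eq_abs, sq_abs, Real.sq_sqrt (by positivity)]
      ring
    rw [integral_const_mul] at this
    rw [show |(-(1 / 2) : ℝ)| = 1 / 2 by norm_num]
    rw [gaussSecondMoment]
    linarith
  rcases le_total r 1 with h | h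
  · rw [min_eq_right h]
    refine h2.trans ?_
    rw [mul_assoc 2 A]; gcongr; linarith
  · rw [min_eq_left h, mul_one]
    have : 0 ≤ A * gaussSecondMoment V := by positivity
    linarith

/-- The `L¹` modulus of continuity of the heat semigroup at a test function. -/
theorem exists_integral_abs_sub_heatMean_le {ψ : V → ℝ} (hψ : ContDiff ℝ 2 ψ)
    (hc : HasCompactSupport ψ) :
    ∃ C, ∀ r, 0 ≤ r → ∫ x, |ψ x - heatMean r ψ x| ≤ C * min 1 r := by
  have hcont := hψ.continuous
  have hint : Integrable ψ := hcont.integrable_of_hasCompactSupport hc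
  obtain ⟨M, hM⟩ := hc.exists_bound_of_continuous hcont
  obtain ⟨A, hlip⟩ : ∃ A : ℝ, 0 ≤ A ∧ ∀ x y, ‖fderiv ℝ ψ x - fderiv ℝ ψ y‖ ≤ A * ‖x - y‖ := by
    have h1 : ContDiff ℝ 1 (fderiv ℝ ψ) := hψ.fderiv_right (by norm_num)
    obtain ⟨K, hK⟩ := h1.lipschitzWith_of_hasCompactSupport (hc.fderiv ℝ) (by norm_num)
    exact ⟨K, K.2, fun x y => hK.norm_sub_le x y⟩
  obtain ⟨R, hR⟩ : ∃ R : ℝ, ∀ x, R < ‖x‖ → ψ x = 0 := by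
    obtain ⟨R, hR⟩ := hc.isCompact.isBounded.subset_closedBall 0
    refine ⟨R, fun x hx => ?_⟩
    by_contra h
    have := hR (subset_tsupport _ h)
    simp at this; linarith
  set D : V → V → ℝ := fun y x => ψ (x + y) + ψ (x - y) - 2 * ψ x with hD
  have hDint : ∀ y, Integrable (D y) := fun y =>
    ((hint.comp_add_right y).add (hint.comp_sub_right y)).sub (hint.const_mul 2)
  set v := (volume : Measure V).real (Metric.closedBall 0 (R + 1))
  set N := ∫ x, |ψ x|
  have hN0 : 0 ≤ N := integral_nonneg fun _ => abs_nonneg _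
  have hv0 : 0 ≤ v := measureReal_nonneg
  have hA := hlip.1
  -- For `‖y‖ ≤ 1` the second difference is supported in the ball of radius `R + 1`, where the
  -- pointwise quadratic bound is integrated. For `‖y‖ > 1` the bound `4 N` suffices.
  have hNy : ∀ y, ∫ x, |D y x| ≤ (2 * A * v + 4 * N) * ‖y‖ ^ 2 := by
    intro y
    rcases le_or_gt ‖y‖ 1 with hy | hy
    · have hb : ∀ x, |D y x| ≤ (Metric.closedBall (0 : V) (R + 1)).indicator
          (fun _ => 2 * A * ‖y‖ ^ 2) x := by
        intro x
        by_cases hx : x ∈ Metric.closedBall (0 : V) (R + 1)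
        · rw [indicator_of_mem hx]
          exact abs_second_difference_le (hψ.differentiable (by norm_num)) hA hlip.2 x y
        · rw [indicator_of_notMem hx]
          have hx' : R + 1 < ‖x‖ := by simpa using hx
          have e1 : ψ x = 0 := hR x (by linarith)
          have e2 : ψ (x + y) = 0 := hR _ (by
            have := norm_sub_norm_le x (-y); rw [norm_neg, sub_neg_eq_add] at this; linarith)
          have e3 : ψ (x - y) = 0 := hR _ (by have := norm_sub_norm_le x y; linarith)
          simp [hD, e1, e2, e3]
      calc _ ≤ ∫ x, (Metric.closedBall (0 : V) (R + 1)).indicator (fun _ => 2 * A * ‖y‖ ^ 2) x :=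
            integral_mono (hDint y).abs ((integrable_indicator_iff measurableSet_closedBall).2
              (integrableOn_const (measure_closedBall_lt_top.ne))) hb
        _ = v * (2 * A * ‖y‖ ^ 2) := by
            rw [integral_indicator measurableSet_closedBall, setIntegral_const, smul_eq_mul]
        _ ≤ _ := by nlinarith [mul_nonneg hN0 (sq_nonneg ‖y‖)]
    · calc _ ≤ ∫ x, (|ψ (x + y)| + |ψ (x - y)| + 2 * |ψ x|) := by
            refine integral_mono (hDint y).abs (((hint.comp_add_right y).abs.add
              (hint.comp_sub_right y).abs).add (hint.abs.const_mul 2)) fun x => ?_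
            simp only [hD]
            have h1 := abs_sub (ψ (x + y) + ψ (x - y)) (2 * ψ x)
            have h2 := abs_add_le (ψ (x + y)) (ψ (x - y))
            rw [abs_mul, abs_two] at h1
            linarith
        _ = 4 * N := by
            have h1 := integral_add ((hint.comp_add_right y).abs.add (hint.comp_sub_right y).abs)
              (hint.abs.const_mul 2)
            simp only [Pi.add_apply] at h1
            rw [h1, integral_add (hint.comp_add_right y).abs (hint.comp_sub_right y).abs,
              integral_add_right_eq_self (fun x => |ψ x|), integral_sub_right_eq_self (fun x => |ψ x|),
              integral_const_mul]
            ring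
        _ ≤ _ := by
            have : (1 : ℝ) ≤ ‖y‖ ^ 2 := one_le_pow₀ hy.le
            have h3 : 0 ≤ 2 * A * v * ‖y‖ ^ 2 := by positivity
            nlinarith
  refine ⟨2 * N + (2 * A * v + 4 * N) * gaussSecondMoment V, fun r hr => ?_⟩
  have hm0 : 0 ≤ gaussSecondMoment V := gaussSecondMoment_nonneg V
  set c := Real.sqrt (2 * r) with hcdef
  have hc2 : c ^ 2 = 2 * r := Real.sq_sqrt (by positivity)
  have hprod : ∀ b : ℝ, Integrable (Function.uncurry fun (x : V) (z : V) => ψ (x + b • z))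
      ((volume : Measure V).prod (stdGaussian V)) := fun b => by
    simpa using integrable_mul_translates (u := fun _ => 1) (M := 1) continuous_const (by simp)
      hint hcont 0 b
  have hDprod : Integrable (Function.uncurry fun (x : V) (z : V) => |D (c • z) x|)
      ((volume : Measure V).prod (stdGaussian V)) := by
    refine ((((hprod c).add (hprod (-c))).sub ((hprod 0).const_mul 2)).abs).congr
      (Eventually.of_forall fun p => ?_)
    simp [Function.uncurry, hD, sub_eq_add_neg]
  have hpt : ∀ x, |ψ x - heatMean r ψ x| ≤ 1 / 2 * ∫ z, |D (c • z) x| ∂(stdGaussian V) := by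
    intro x
    rw [sub_heatMean_eq (integrable_heatMean_integrand hcont hM r x), abs_mul,
      show |(-(1 / 2) : ℝ)| = 1 / 2 by norm_num]
    gcongr
    exact abs_integral_le_integral_abs
  have hdiff : Integrable fun x => ψ x - heatMean r ψ x := hint.sub (integrable_heatMean hint hcont r)
  have h2 : ∫ x, |ψ x - heatMean r ψ x| ≤ (2 * A * v + 4 * N) * gaussSecondMoment V * r := by
    calc _ ≤ ∫ x, 1 / 2 * ∫ z, |D (c • z) x| ∂(stdGaussian V) :=
          integral_mono hdiff.abs (hDprod.integral_prod_left.const_mul _) hpt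
      _ = 1 / 2 * ∫ z, (∫ x, |D (c • z) x|) ∂(stdGaussian V) := by
          rw [integral_const_mul, integral_integral_swap hDprod]
      _ ≤ 1 / 2 * ∫ z, (2 * A * v + 4 * N) * (2 * r) * ‖z‖ ^ 2 ∂(stdGaussian V) := by
          refine mul_le_mul_of_nonneg_left ?_ (by norm_num)
          refine integral_mono hDprod.integral_prod_right
            ((integrable_norm_sq_stdGaussian (V := V)).const_mul _) fun z => ?_
          refine (hNy _).trans (le_of_eq ?_)
          rw [norm_smul, mul_pow, Real.norm_eq_abs, sq_abs, hc2]; ring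
      _ = _ := by rw [integral_const_mul, gaussSecondMoment]; ring
  have h1 : ∫ x, |ψ x - heatMean r ψ x| ≤ 2 * N := by
    calc _ ≤ ∫ x, (|ψ x| + ∫ z, |ψ (x + c • z)| ∂(stdGaussian V)) := by
          refine integral_mono hdiff.abs (hint.abs.add (hprod c).abs.integral_prod_left) fun x => ?_
          refine (abs_sub _ _).trans ?_
          gcongr
          exact abs_integral_le_integral_abs
      _ = N + ∫ z, (∫ x, |ψ (x + c • z)|) ∂(stdGaussian V) := by
          have := integral_add hint.abs (hprod c).abs.integral_prod_left
          simp only [Function.uncurry] at this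
          rw [this, integral_integral_swap (hprod c).abs]
      _ = 2 * N := by
          simp_rw [integral_add_right_eq_self (fun x => |ψ x|)]
          simp; ring
  rcases le_total r 1 with h | h
  · rw [min_eq_right h]
    refine h2.trans ?_
    gcongr; linarith
  · rw [min_eq_left h, mul_one]
    have : 0 ≤ (2 * A * v + 4 * N) * gaussSecondMoment V := by positivity
    linarith

end Heat

/-! ### The multiplier as an average of heat differences. -/

section LevyOperator

open ProbabilityTheory Filter Topology

set_option linter.unusedSectionVars false

variable {d : ℕ}

/-- `m` is the symbol of the operator `u ↦ ∫ (u - exp (s Δ) u) dν(s)`. -/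
structure IsLevySymbol (ν : Measure ℝ) (m : EuclideanSpace ℝ (Fin d) → ℝ) : Prop where
  pos : ∀ᵐ s ∂ν, 0 < s
  integrable_min : Integrable (fun s => min 1 s) ν
  nonneg : ∀ ξ, 0 ≤ m ξ
  lintegral_eq : ∀ ξ, ∫⁻ s, ENNReal.ofReal (1 - Real.exp (-(4 * Real.pi ^ 2 * s * ‖ξ‖ ^ 2))) ∂ν =
    ENNReal.ofReal (m ξ)

theorem one_sub_exp_neg_mul_le {s R : ℝ} (hs : 0 ≤ s) (hR : 0 ≤ R) :
    1 - Real.exp (-(s * R)) ≤ min 1 s * (1 + R) := by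
  have h1 := Real.add_one_le_exp (-(s * R))
  have h2 := Real.exp_pos (-(s * R))
  rcases le_total s 1 with h | h
  · rw [min_eq_right h]; nlinarith
  · rw [min_eq_left h]; nlinarith

variable {ν : Measure ℝ} [SFinite ν] {m : EuclideanSpace ℝ (Fin d) → ℝ}

/-- Insert the integral representation of `m`, exchange the integrals, and recognize each factor
`exp (-4 π ^ 2 s ‖ξ‖ ^ 2)` as a heat flow by `fourier_exp_mul`. The exchange is dominated by `(1 + 4
π ^ 2 ‖ξ‖ ^ 2) min 1 s ‖φ ξ‖`. -/
theorem IsLevySymbol.fourier_mul (H : IsLevySymbol ν m) (κ : ℝ)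
    (φ : 𝓢(EuclideanSpace ℝ (Fin d), ℂ)) (x : EuclideanSpace ℝ (Fin d)) :
    𝓕 (fun ξ => ((κ * m ξ : ℝ) : ℂ) * φ ξ) x =
      κ * ∫ s, (𝓕 (fun ξ => φ ξ) x -
        ∫ z, 𝓕 (fun ξ => φ ξ) (x + Real.sqrt (2 * s) • z) ∂(stdGaussian _)) ∂ν := by
  set k : EuclideanSpace ℝ (Fin d) → ℝ → ℝ := fun ξ s =>
    1 - Real.exp (-(4 * Real.pi ^ 2 * s * ‖ξ‖ ^ 2)) with hk
  have hk0 : ∀ ξ s, 0 < s → 0 ≤ k ξ s := fun ξ s hs => by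
    have : Real.exp (-(4 * Real.pi ^ 2 * s * ‖ξ‖ ^ 2)) ≤ 1 := by
      rw [Real.exp_le_one_iff]
      have : 0 ≤ 4 * Real.pi ^ 2 * s * ‖ξ‖ ^ 2 := by positivity
      linarith
    simp only [hk]; linarith
  have hkle : ∀ ξ s, 0 < s → k ξ s ≤ (1 + 4 * Real.pi ^ 2 * ‖ξ‖ ^ 2) * min 1 s := fun ξ s hs => by
    have := one_sub_exp_neg_mul_le hs.le (show 0 ≤ 4 * Real.pi ^ 2 * ‖ξ‖ ^ 2 by positivity)
    simp only [hk]
    rw [mul_comm _ (min 1 s)]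
    convert this using 4; ring
  have hm : ∀ ξ, m ξ = ∫ s, k ξ s ∂ν := fun ξ => by
    rw [integral_eq_lintegral_of_nonneg_ae (H.pos.mono fun s hs => hk0 ξ s hs)
      (Continuous.aestronglyMeasurable (by fun_prop)), H.lintegral_eq, ENNReal.toReal_ofReal (H.nonneg ξ)]
  set e : EuclideanSpace ℝ (Fin d) → ℂ := fun ξ =>
    Complex.exp (↑(-2 * Real.pi * inner ℝ ξ x) * Complex.I) with he
  have hen : ∀ ξ, ‖e ξ‖ = 1 := fun ξ => Complex.norm_exp_ofReal_mul_I _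
  have hφ : Integrable (fun ξ => φ ξ) := φ.integrable
  have hbound : Integrable fun ξ => (1 + 4 * Real.pi ^ 2 * ‖ξ‖ ^ 2) * ‖φ ξ‖ := by
    refine (hφ.norm.add ((φ.integrable_pow_mul volume 2).const_mul (4 * Real.pi ^ 2))).congr
      (Eventually.of_forall fun ξ => ?_)
    simp only [Pi.add_apply]; ring
  have hprod : Integrable (Function.uncurry fun (ξ : EuclideanSpace ℝ (Fin d)) (s : ℝ) =>
      e ξ * ((k ξ s : ℂ) * φ ξ)) (volume.prod ν) := by
    refine (hbound.mul_prod H.integrable_min).mono' ?_ ?_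
    · refine Continuous.aestronglyMeasurable ?_
      have := φ.continuous
      simp only [Function.uncurry_def, he, hk]
      fun_prop
    · have : ∀ᵐ p ∂((volume : Measure (EuclideanSpace ℝ (Fin d))).prod ν), 0 < p.2 :=
        Measure.quasiMeasurePreserving_snd.ae H.pos
      refine this.mono ?_
      rintro ⟨ξ, s⟩ hs
      simp only [Function.uncurry]
      rw [norm_mul, norm_mul, hen, one_mul, Complex.norm_real, Real.norm_of_nonneg (hk0 ξ s hs)]
      calc _ ≤ (1 + 4 * Real.pi ^ 2 * ‖ξ‖ ^ 2) * min 1 s * ‖φ ξ‖ := by gcongr; exact hkle ξ s hs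
        _ = _ := by ring
  calc _ = ∫ ξ, (κ : ℂ) * ∫ s, e ξ * ((k ξ s : ℂ) * φ ξ) ∂ν := by
        rw [Real.fourier_eq']
        congr 1; ext ξ
        rw [integral_const_mul, integral_mul_const, integral_complex_ofReal, ← hm, smul_eq_mul]
        simp only [he]
        push_cast; ring
    _ = κ * ∫ s, (∫ ξ, e ξ * ((k ξ s : ℂ) * φ ξ)) ∂ν := by
        rw [integral_const_mul, integral_integral_swap hprod]
    _ = _ := by
        congr 1
        refine integral_congr_ae (H.pos.mono fun s hs => ?_)
        beta_reduce
        rw [← fourier_exp_mul hφ hs.le, Real.fourier_eq', Real.fourier_eq', ← integral_sub]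
        · congr 1; ext ξ
          simp only [he, hk, smul_eq_mul]
          push_cast; ring
        · refine hφ.norm.mono' ?_ (Eventually.of_forall fun ξ => ?_)
          · have := φ.continuous
            exact Continuous.aestronglyMeasurable (by fun_prop)
          · rw [norm_smul, Complex.norm_exp_ofReal_mul_I, one_mul]
        · refine hφ.norm.mono' ?_ (Eventually.of_forall fun ξ => ?_)
          · have := φ.continuous
            exact Continuous.aestronglyMeasurable (by fun_prop)
          · rw [norm_smul, Complex.norm_exp_ofReal_mul_I, one_mul, norm_mul, Complex.norm_real,
              Real.norm_of_nonneg (Real.exp_pos _).le]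
            refine mul_le_of_le_one_left (norm_nonneg _) ?_
            rw [Real.exp_le_one_iff]
            have : 0 ≤ 4 * Real.pi ^ 2 * s * ‖ξ‖ ^ 2 := by positivity
            linarith

theorem integrable_mul_sub_heatMean {V : Type*} [NormedAddCommGroup V] [InnerProductSpace ℝ V]
    [FiniteDimensional ℝ V] [MeasurableSpace V] [BorelSpace V]
    (hpos : ∀ᵐ s ∂ν, 0 < s) (hmin : Integrable (fun s => min 1 s) ν) {u ψ : V → ℝ} {C M : ℝ}
    (hu : Continuous u) (hM : ∀ x, |u x| ≤ M)
    (hC : ∀ r, 0 ≤ r → ∀ x, |u x - heatMean r u x| ≤ C * min 1 r)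
    (hψ : Integrable ψ) :
    Integrable (Function.uncurry fun (x : V) (s : ℝ) => ψ x * (u x - heatMean s u x))
      (volume.prod ν) := by
  refine ((hψ.norm.mul_prod (hmin.const_mul C))).mono' ?_ ?_
  · refine (hψ.aestronglyMeasurable.comp_fst).mul ?_
    refine Continuous.aestronglyMeasurable ?_
    exact (hu.comp continuous_fst).sub ((continuous_heatMean hu hM).comp
      (continuous_snd.prodMk continuous_fst))
  · have : ∀ᵐ p ∂((volume : Measure V).prod ν), 0 < p.2 :=
        Measure.quasiMeasurePreserving_snd.ae hpos
    refine this.mono ?_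
    rintro ⟨x, s⟩ hs
    simp only [Function.uncurry]
    rw [norm_mul]
    gcongr
    exact hC s hs.le x

/-- Pointwise form of the multiplier operator on functions with bounded second derivatives. -/
theorem IsLevySymbol.ae_eq (H : IsLevySymbol ν m) {κ : ℝ}
    {u g : EuclideanSpace ℝ (Fin d) → ℝ} {C M : ℝ} (hu : Continuous u) (hM : ∀ x, |u x| ≤ M)
    (hC : ∀ r, 0 ≤ r → ∀ x, |u x - heatMean r u x| ≤ C * min 1 r) (hg : Continuous g)
    (h : IsFourierMultiplierImage (fun ξ => κ * m ξ) u g) :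
    ∀ᵐ x, g x = κ * ∫ s, (u x - heatMean s u x) ∂ν := by
  have hcontu : Continuous fun p : ℝ × EuclideanSpace ℝ (Fin d) => u p.2 - heatMean p.1 u p.2 :=
    (hu.comp continuous_snd).sub (continuous_heatMean hu hM)
  refine ae_eq_of_integral_contDiff_smul_eq hg.locallyIntegrable ?_ ?_
  · have hcont : Continuous fun x => κ * ∫ s, (u x - heatMean s u x) ∂ν := by
      refine continuous_const.mul (continuous_of_dominated (bound := fun s => C * min 1 s) ?_ ?_
        (H.integrable_min.const_mul C) ?_)
      · intro x
        exact (hcontu.comp (continuous_id.prodMk continuous_const)).aestronglyMeasurable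
      · exact fun x => H.pos.mono fun s hs => hC s hs.le x
      · exact Eventually.of_forall fun s => hcontu.comp (continuous_const.prodMk continuous_id)
    exact hcont.locallyIntegrable
  intro ψ hψ hψc
  have hψcont := hψ.continuous
  have hψint : Integrable ψ := hψcont.integrable_of_hasCompactSupport hψc
  obtain ⟨Mψ, hMψ⟩ := hψc.exists_bound_of_continuous hψcont
  obtain ⟨Cψ, hCψ⟩ := exists_integral_abs_sub_heatMean_le
    (hψ.of_le (by norm_cast)) hψc
  have hΨc : HasCompactSupport (fun x => (ψ x : ℂ)) := hψc.comp_left (g := fun y : ℝ => (y : ℂ)) (by simp)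
  have hΨd : ContDiff ℝ ∞ (fun x => (ψ x : ℂ)) := Complex.ofRealCLM.contDiff.comp hψ
  set Ψ : 𝓢(EuclideanSpace ℝ (Fin d), ℂ) := hΨc.toSchwartzMap hΨd with hΨ
  -- The weak definition of the multiplier tests against `𝓕 φ`; this choice of `φ` makes `𝓕 φ` the
  -- given test function `ψ`.
  set φ : 𝓢(EuclideanSpace ℝ (Fin d), ℂ) := 𝓕⁻ Ψ with hφ
  have hFφ : 𝓕 (fun ξ => φ ξ) = fun x => (ψ x : ℂ) := by
    have h1 : 𝓕 φ = Ψ := FourierTransform.fourier_fourierInv_eq Ψ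
    have h2 := SchwartzMap.fourier_coe φ
    rw [h1] at h2
    exact h2.symm
  obtain ⟨-, -, h3⟩ := h φ
  simp_rw [H.fourier_mul κ φ, hFφ, integral_complex_ofReal] at h3
  have e1 : ∀ s x, (ψ x : ℂ) - ((∫ z, ψ (x + Real.sqrt (2 * s) • z)
      ∂(stdGaussian (EuclideanSpace ℝ (Fin d))) : ℝ) : ℂ) = ((ψ x - heatMean s ψ x : ℝ) : ℂ) := by
    intro s x; rw [heatMean]; push_cast; rfl
  simp_rw [e1, integral_complex_ofReal, ← Complex.ofReal_mul, integral_complex_ofReal] at h3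
  have h4 := Complex.ofReal_inj.1 h3
  -- As `u` is only bounded, integrability in `x` comes from the `L¹` bound `Cψ * min 1 s` on the
  -- heat difference of `ψ`.
  have hprodψ : Integrable (Function.uncurry fun (x : EuclideanSpace ℝ (Fin d)) (s : ℝ) =>
      u x * (ψ x - heatMean s ψ x)) (volume.prod ν) := by
    have hcontψ : Continuous (Function.uncurry fun (x : EuclideanSpace ℝ (Fin d)) (s : ℝ) =>
        u x * (ψ x - heatMean s ψ x)) :=
      (hu.comp continuous_fst).mul ((hψcont.comp continuous_fst).sub
        ((continuous_heatMean hψcont hMψ).comp (continuous_snd.prodMk continuous_fst)))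
    have hsl : ∀ s, Integrable fun x => ψ x - heatMean s ψ x := fun s =>
      hψint.sub (integrable_heatMean hψint hψcont s)
    have hM0 : 0 ≤ M := (abs_nonneg _).trans (hM 0)
    rw [integrable_prod_iff' hcontψ.aestronglyMeasurable]
    constructor
    · refine Eventually.of_forall fun s => ?_
      exact (hsl s).bdd_mul hu.aestronglyMeasurable (Eventually.of_forall hM)
    · refine (H.integrable_min.const_mul (M * Cψ)).mono' ?_ (H.pos.mono fun s hs => ?_)
      · exact hcontψ.norm.stronglyMeasurable.integral_prod_left' |>.aestronglyMeasurable
      · rw [Real.norm_of_nonneg (integral_nonneg fun _ => norm_nonneg _), mul_assoc]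
        refine le_trans ?_ (mul_le_mul_of_nonneg_left (hCψ s hs.le) hM0)
        rw [← integral_const_mul]
        refine integral_mono_of_nonneg (Eventually.of_forall fun _ => norm_nonneg _)
          ((hsl s).abs.const_mul _) (Eventually.of_forall fun x => ?_)
        simp only [Function.uncurry]
        rw [norm_mul]
        gcongr
        · exact hM x
        · exact le_rfl
  have hprodu := integrable_mul_sub_heatMean H.pos H.integrable_min hu hM hC hψint
  -- The operator is moved from `ψ` to `u` one `s` at a time, by the symmetry of `heatMean`; Fubini
  -- is used before and after.
  calc ∫ x, ψ x • g x = ∫ x, g x * ψ x := by simp_rw [smul_eq_mul, mul_comm]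
    _ = ∫ x, u x * (κ * ∫ s, (ψ x - heatMean s ψ x) ∂ν) := h4
    _ = κ * ∫ x, ∫ s, u x * (ψ x - heatMean s ψ x) ∂ν := by
        rw [← integral_const_mul]; congr 1; ext x; rw [integral_const_mul]; ring
    _ = κ * ∫ s, (∫ x, u x * (ψ x - heatMean s ψ x)) ∂ν := by rw [integral_integral_swap hprodψ]
    _ = κ * ∫ s, (∫ x, ψ x * (u x - heatMean s u x)) ∂ν := by
        congr 2; ext s
        have i1 : Integrable fun x => u x * ψ x := hψint.bdd_mul hu.aestronglyMeasurable (Eventually.of_forall hM)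
        have i2 := integrable_mul_heatMean hu hM hψint hψcont s
        have i3 : Integrable fun x => heatMean s u x * ψ x :=
          hψint.bdd_mul ((continuous_heatMean hu hM).comp
            (continuous_const.prodMk continuous_id)).aestronglyMeasurable
            (Eventually.of_forall (abs_heatMean_le hM s))
        calc _ = (∫ x, u x * ψ x) - ∫ x, u x * heatMean s ψ x := by
              rw [← integral_sub i1 i2]; congr 1; ext x; ring
          _ = (∫ x, u x * ψ x) - ∫ x, heatMean s u x * ψ x := by
              rw [integral_mul_heatMean hu hM hψint hψcont]
          _ = _ := by rw [← integral_sub i1 i3]; congr 1; ext x; ring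
    _ = κ * ∫ x, ∫ s, ψ x * (u x - heatMean s u x) ∂ν := by rw [integral_integral_swap hprodu]
    _ = _ := by
        rw [← integral_const_mul]; congr 1; ext x; rw [integral_const_mul, smul_eq_mul]; ring

end LevyOperator

/-! ### The weighted Córdoba–Córdoba inequality. -/

section Convexity

open ProbabilityTheory Filter Topology

set_option linter.unusedSectionVars false

variable {V : Type*} [NormedAddCommGroup V] [InnerProductSpace ℝ V] [FiniteDimensional ℝ V]
  [MeasurableSpace V] [BorelSpace V] {ν : Measure ℝ} [SFinite ν]

theorem gaussWeight_le_one {σ : ℝ} (hσ : 0 ≤ σ) (x : V) : gaussWeight σ x ≤ 1 := by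
  rw [gaussWeight, Real.exp_le_one_iff]
  exact div_nonpos_of_nonpos_of_nonneg (by simp) (by positivity)

theorem gaussWeight_mono {σ τ : ℝ} (hσ : 0 < σ) (h : σ ≤ τ) (x : V) :
    gaussWeight σ x ≤ gaussWeight τ x := by
  rw [gaussWeight, gaussWeight, Real.exp_le_exp, neg_div, neg_div, neg_le_neg_iff]
  gcongr

/-- A quadratic factor costs a doubling of the width: half of the exponent is spent on `y exp (-y) ≤
1` with `y = ‖x‖ ^ 2 / (16 σ)`. -/
theorem norm_sq_mul_gaussWeight_le {σ : ℝ} (hσ : 0 < σ) (x : V) :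
    ‖x‖ ^ 2 * gaussWeight (2 * σ) x ≤ 16 * σ * gaussWeight (4 * σ) x := by
  have h1 : gaussWeight (2 * σ) x = gaussWeight (4 * σ) x * Real.exp (-(‖x‖ ^ 2 / (16 * σ))) := by
    simp only [gaussWeight]; rw [← Real.exp_add]; congr 1; field_simp; ring
  have h2 : ‖x‖ ^ 2 / (16 * σ) * Real.exp (-(‖x‖ ^ 2 / (16 * σ))) ≤ 1 := by
    rw [Real.exp_neg, ← div_eq_mul_inv, div_le_one (Real.exp_pos _)]
    linarith [Real.add_one_le_exp (‖x‖ ^ 2 / (16 * σ))]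
  rw [h1]
  calc _ = 16 * σ * gaussWeight (4 * σ) x *
        (‖x‖ ^ 2 / (16 * σ) * Real.exp (-(‖x‖ ^ 2 / (16 * σ)))) := by field_simp
    _ ≤ 16 * σ * gaussWeight (4 * σ) x * 1 := by
        have := gaussWeight_pos (4 * σ) x
        gcongr
    _ = _ := mul_one _

/-- The positive part of `exp (s Δ) g - g` for a Gaussian weight `g`. -/
noncomputable def gaussGain (σ s : ℝ) (x : V) : ℝ :=
  max 0 (heatMean s (gaussWeight σ) x - gaussWeight σ x)

/-- The average of `gaussGain` with respect to a Lévy measure. -/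
noncomputable def gaussExcess (ν : Measure ℝ) (σ : ℝ) (x : V) : ℝ := ∫ s, gaussGain σ s x ∂ν

theorem gaussGain_nonneg (σ s : ℝ) (x : V) : 0 ≤ gaussGain σ s x := le_max_left _ _

theorem abs_gaussWeight_le_one {σ : ℝ} (hσ : 0 ≤ σ) (x : V) : |gaussWeight σ x| ≤ 1 := by
  rw [abs_of_pos (gaussWeight_pos σ x)]; exact gaussWeight_le_one hσ x

theorem continuous_gaussGain {σ : ℝ} (hσ : 0 ≤ σ) :
    Continuous fun p : V × ℝ => gaussGain σ p.2 p.1 := by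
  unfold gaussGain
  refine continuous_const.max (Continuous.sub ?_ ((continuous_gaussWeight σ).comp continuous_fst))
  exact (continuous_heatMean (continuous_gaussWeight σ) (abs_gaussWeight_le_one hσ)).comp
    (continuous_snd.prodMk continuous_fst)

theorem heatMean_gaussWeight_nonneg (σ s : ℝ) (x : V) : 0 ≤ heatMean s (gaussWeight σ) x :=
  integral_nonneg fun _ => (gaussWeight_pos σ _).le

theorem gaussGain_le_heatMean (σ s : ℝ) (x : V) :
    gaussGain σ s x ≤ heatMean s (gaussWeight σ) x :=
  max_le (heatMean_gaussWeight_nonneg σ s x) (by linarith [gaussWeight_pos σ x])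

theorem gaussGain_le_one {σ : ℝ} (hσ : 0 ≤ σ) (s : ℝ) (x : V) : gaussGain σ s x ≤ 1 :=
  (gaussGain_le_heatMean σ s x).trans
    ((le_abs_self _).trans (abs_heatMean_le (abs_gaussWeight_le_one hσ) s x))

/-- The heat flow of the weight is at most the weight of width `σ + s`, which exceeds that of width
`σ` by at most a factor `‖x‖ ^ 2 s / (4 σ ^ 2)` times itself. Widening to `4 σ` absorbs `‖x‖ ^ 2`
and leaves the small factor `s / σ`. -/
theorem gaussGain_le_of_le {σ s : ℝ} (hσ : 0 < σ) (hs : 0 ≤ s) (h : s ≤ σ) (x : V) :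
    gaussGain σ s x ≤ 4 * (s / σ) * gaussWeight (4 * σ) x := by
  have hg := gaussWeight_pos (4 * σ) x
  refine max_le (by positivity) ?_
  have h1 : heatMean s (gaussWeight σ) x ≤ gaussWeight (σ + s) x := by
    rw [heatMean_gaussWeight hσ hs]
    refine mul_le_of_le_one_left (gaussWeight_pos _ _).le (Real.rpow_le_one (by positivity) ?_ (by positivity))
    rw [div_le_one (by positivity)]; linarith
  have h2 : gaussWeight (σ + s) x - gaussWeight σ x ≤
      gaussWeight (σ + s) x * (‖x‖ ^ 2 * (s / (4 * σ ^ 2))) := by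
    have e1 : gaussWeight σ x = gaussWeight (σ + s) x *
        Real.exp (-(‖x‖ ^ 2 * (s / (4 * σ * (σ + s))))) := by
      simp only [gaussWeight]; rw [← Real.exp_add]; congr 1; field_simp; ring
    have e2 := Real.add_one_le_exp (-(‖x‖ ^ 2 * (s / (4 * σ * (σ + s)))))
    have e3 : s / (4 * σ * (σ + s)) ≤ s / (4 * σ ^ 2) :=
      div_le_div_of_nonneg_left hs (by positivity) (by nlinarith)
    have e4 : ‖x‖ ^ 2 * (s / (4 * σ * (σ + s))) ≤ ‖x‖ ^ 2 * (s / (4 * σ ^ 2)) := by gcongr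
    have hp := gaussWeight_pos (σ + s) x
    rw [e1]
    nlinarith
  calc _ ≤ gaussWeight (σ + s) x * (‖x‖ ^ 2 * (s / (4 * σ ^ 2))) := by linarith
    _ ≤ gaussWeight (2 * σ) x * (‖x‖ ^ 2 * (s / (4 * σ ^ 2))) := by
        gcongr
        exact gaussWeight_mono (by positivity) (by linarith) x
    _ = (‖x‖ ^ 2 * gaussWeight (2 * σ) x) * (s / (4 * σ ^ 2)) := by ring
    _ ≤ (16 * σ * gaussWeight (4 * σ) x) * (s / (4 * σ ^ 2)) := by
        have := norm_sq_mul_gaussWeight_le hσ x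
        gcongr
    _ = _ := by field_simp; ring

theorem gaussGain_le_min {σ : ℝ} (hσ : 0 < σ) {s : ℝ} (hs : 0 ≤ s) (x : V) :
    gaussGain σ s x ≤ (1 + 4 / σ) * min 1 s := by
  have hg1 := gaussGain_le_one hσ.le s x
  have h4 : (0 : ℝ) < 4 / σ := by positivity
  rcases le_total s 1 with h1 | h1
  · rw [min_eq_right h1]
    rcases le_total s σ with h | h
    · refine (gaussGain_le_of_le hσ hs h x).trans ?_
      have := gaussWeight_le_one (show 0 ≤ 4 * σ by positivity) x
      calc _ ≤ 4 * (s / σ) * 1 := by gcongr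
        _ = 4 / σ * s := by ring
        _ ≤ _ := by gcongr; linarith
    · refine hg1.trans ?_
      have : 1 ≤ s / σ := by rw [le_div_iff₀ hσ]; linarith
      have e : 4 / σ * s = 4 * (s / σ) := by ring
      nlinarith
  · rw [min_eq_left h1]; linarith

theorem integral_heatMean {ψ : V → ℝ} (hψ : Integrable ψ) (hψc : Continuous ψ) (r : ℝ) :
    ∫ x, heatMean r ψ x = ∫ x, ψ x := by
  have := integral_mul_heatMean (u := fun _ => 1) (M := 1) continuous_const (by simp) hψ hψc r
  simpa [heatMean] using this

theorem integrable_gaussGain {σ : ℝ} (hσ : 0 < σ) (s : ℝ) :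
    Integrable (fun x : V => gaussGain σ s x) := by
  refine (integrable_heatMean (integrable_gaussWeight hσ) (continuous_gaussWeight σ) s).mono' ?_
    (Eventually.of_forall fun x => ?_)
  · exact ((continuous_gaussGain hσ.le).comp
      (continuous_id.prodMk continuous_const)).aestronglyMeasurable
  · rw [Real.norm_of_nonneg (gaussGain_nonneg _ _ _)]; exact gaussGain_le_heatMean _ _ _

variable (V) in
-- For `s ≤ σ` the pointwise bound `gaussGain_le_of_le` is integrated; otherwise conservation of
-- mass by the heat flow suffices.
theorem exists_integral_gaussGain_le {σ : ℝ} (hσ : 0 < σ) :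
    ∃ C, ∀ s, 0 ≤ s → ∫ x : V, gaussGain σ s x ≤ C * min 1 s := by
  set I₁ := ∫ x : V, gaussWeight (4 * σ) x
  set I₂ := ∫ x : V, gaussWeight σ x
  have hI₁ : 0 ≤ I₁ := integral_nonneg fun _ => (gaussWeight_pos _ _).le
  have hI₂ : 0 ≤ I₂ := integral_nonneg fun _ => (gaussWeight_pos _ _).le
  have hle : ∀ s : ℝ, ∫ x : V, gaussGain σ s x ≤ I₂ := fun s => by
    exact (integral_mono (integrable_gaussGain hσ s)
      (integrable_heatMean (integrable_gaussWeight hσ) (continuous_gaussWeight σ) s)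
      (gaussGain_le_heatMean σ s)).trans_eq
      (integral_heatMean (integrable_gaussWeight hσ) (continuous_gaussWeight σ) s)
  refine ⟨4 / σ * I₁ + I₂ + I₂ / σ, fun s hs => ?_⟩
  rcases le_total s 1 with h1 | h1
  · rw [min_eq_right h1]
    rcases le_total s σ with h | h
    · calc _ ≤ ∫ x : V, 4 * (s / σ) * gaussWeight (4 * σ) x :=
            integral_mono (integrable_gaussGain hσ s)
              ((integrable_gaussWeight (by positivity)).const_mul _)
              (gaussGain_le_of_le hσ hs h)
        _ = 4 / σ * I₁ * s := by rw [integral_const_mul]; ring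
        _ ≤ _ := by
            gcongr
            have : 0 ≤ I₂ / σ := by positivity
            linarith
    · refine (hle s).trans ?_
      have h2 : I₂ ≤ I₂ / σ * s := by
        rw [div_mul_eq_mul_div, le_div_iff₀ hσ]; gcongr
      have : 0 ≤ 4 / σ * I₁ * s := by positivity
      nlinarith [mul_nonneg hI₂ hs]
  · rw [min_eq_left h1, mul_one]
    refine (hle s).trans ?_
    have : 0 ≤ I₂ / σ := by positivity
    have : 0 ≤ 4 / σ * I₁ := by positivity
    linarith

theorem integrable_mul_gaussGain (hpos : ∀ᵐ s ∂ν, 0 < s) (hmin : Integrable (fun s => min 1 s) ν)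
    {w : V → ℝ} (hw : Continuous w) {M : ℝ} (hM : ∀ x, |w x| ≤ M) {σ : ℝ} (hσ : 0 < σ) :
    Integrable (Function.uncurry fun (x : V) (s : ℝ) => w x * gaussGain σ s x)
      (volume.prod ν) := by
  have hcont : Continuous (Function.uncurry fun (x : V) (s : ℝ) => w x * gaussGain σ s x) :=
    (hw.comp continuous_fst).mul (continuous_gaussGain hσ.le)
  obtain ⟨C, hC⟩ := exists_integral_gaussGain_le V hσ
  have hM0 : 0 ≤ M := (abs_nonneg _).trans (hM 0)
  rw [integrable_prod_iff' hcont.aestronglyMeasurable]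
  constructor
  · refine Eventually.of_forall fun s => ?_
    exact (integrable_gaussGain hσ s).bdd_mul hw.aestronglyMeasurable (Eventually.of_forall hM)
  · refine (hmin.const_mul (M * C)).mono' ?_ (hpos.mono fun s hs => ?_)
    · exact hcont.norm.stronglyMeasurable.integral_prod_left' |>.aestronglyMeasurable
    · rw [Real.norm_of_nonneg (integral_nonneg fun _ => norm_nonneg _), mul_assoc]
      refine le_trans ?_ (mul_le_mul_of_nonneg_left (hC s hs.le) hM0)
      rw [← integral_const_mul]
      refine integral_mono_of_nonneg (Eventually.of_forall fun _ => norm_nonneg _)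
        ((integrable_gaussGain hσ s).const_mul _) (Eventually.of_forall fun x => ?_)
      simp only [Function.uncurry]
      rw [norm_mul, Real.norm_of_nonneg (gaussGain_nonneg _ _ _)]
      have := gaussGain_nonneg σ s x
      gcongr
      exact hM x

theorem integrable_mul_gaussExcess (hpos : ∀ᵐ s ∂ν, 0 < s)
    (hmin : Integrable (fun s => min 1 s) ν)
    {w : V → ℝ} (hw : Continuous w) {M : ℝ} (hM : ∀ x, |w x| ≤ M) {σ : ℝ} (hσ : 0 < σ) :
    Integrable (fun x => w x * gaussExcess ν σ x) := by
  refine (integrable_mul_gaussGain hpos hmin hw hM hσ).integral_prod_left.congr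
    (Eventually.of_forall fun x => ?_)
  simp only [Function.uncurry, gaussExcess]
  rw [integral_const_mul]

/-- Jensen's inequality: average over the Gaussian the tangent-line inequality at `a = u x`. -/
theorem sub_heatMean_convex {u : V → ℝ} (hu : Continuous u) {M : ℝ} (hM : ∀ x, |u x| ≤ M)
    {φ φ' : ℝ → ℝ} (hφ : Continuous φ) (htan : ∀ a b, φ a + φ' a * (b - a) ≤ φ b)
    {K : ℝ} (hK : ∀ x, |φ (u x)| ≤ K) (s : ℝ) (x : V) :
    φ (u x) - heatMean s (fun y => φ (u y)) x ≤ φ' (u x) * (u x - heatMean s u x) := by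
  have i1 := integrable_heatMean_integrand hu hM s x
  have i2 := integrable_heatMean_integrand (hφ.comp hu) hK s x
  have h := integral_mono (((i1.sub (integrable_const (u x))).const_mul (φ' (u x))).add
    (integrable_const (φ (u x)))) i2 (fun z => by
      simp only [Pi.add_apply, Pi.sub_apply]
      have := htan (u x) (u (x + Real.sqrt (2 * s) • z))
      simp only [Function.comp_apply]; linarith)
  have h2 := integral_add ((i1.sub (integrable_const (u x))).const_mul (φ' (u x)))
    (integrable_const (μ := stdGaussian V) (φ (u x)))
  have h3 := integral_sub i1 (integrable_const (μ := stdGaussian V) (u x))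
  simp only [Pi.add_apply, Pi.sub_apply] at h h2 h3
  rw [h2, integral_const_mul, h3] at h
  simp only [integral_const, probReal_univ, one_smul, Function.comp_apply] at h
  simp only [heatMean]
  linarith

/-- The weighted Córdoba–Córdoba inequality. -/
theorem IsLevySymbol.le_integral_mul {d : ℕ} {m : EuclideanSpace ℝ (Fin d) → ℝ}
    (H : IsLevySymbol ν m) {κ : ℝ} (hκ : 0 ≤ κ)
    {u g : EuclideanSpace ℝ (Fin d) → ℝ} {C M : ℝ} (hu : Continuous u) (hM : ∀ x, |u x| ≤ M)
    (hC : ∀ r, 0 ≤ r → ∀ x, |u x - heatMean r u x| ≤ C * min 1 r) (hg : Continuous g)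
    (h : IsFourierMultiplierImage (fun ξ => κ * m ξ) u g)
    {φ φ' : ℝ → ℝ} (hφ : Continuous φ) (hφ' : Continuous φ') (hφ0 : ∀ a, 0 ≤ φ a)
    (htan : ∀ a b, φ a + φ' a * (b - a) ≤ φ b) {σ : ℝ} (hσ : 0 < σ) :
    -(κ * ∫ x, φ (u x) * gaussExcess ν σ x) ≤ ∫ x, φ' (u x) * g x * gaussWeight σ x := by
  obtain ⟨K, hK⟩ : ∃ K, ∀ x, |φ (u x)| ≤ K := by
    obtain ⟨K, hK⟩ := (isCompact_Icc (a := -M) (b := M)).exists_bound_of_continuousOn hφ.continuousOn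
    exact ⟨K, fun x => hK _ (abs_le.1 (hM x))⟩
  obtain ⟨K', hK'⟩ : ∃ K, ∀ x, |φ' (u x)| ≤ K := by
    obtain ⟨K, hK⟩ := (isCompact_Icc (a := -M) (b := M)).exists_bound_of_continuousOn hφ'.continuousOn
    exact ⟨K, fun x => hK _ (abs_le.1 (hM x))⟩
  have hgi : Integrable (gaussWeight σ : EuclideanSpace ℝ (Fin d) → ℝ) := integrable_gaussWeight hσ
  have hgc : Continuous (gaussWeight σ : EuclideanSpace ℝ (Fin d) → ℝ) := continuous_gaussWeight σ
  have hφu : Continuous fun x => φ (u x) := hφ.comp hu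
  set ψ : EuclideanSpace ℝ (Fin d) → ℝ := fun x => φ' (u x) * gaussWeight σ x with hψ
  have hψi : Integrable ψ := hgi.bdd_mul (hφ'.comp hu).aestronglyMeasurable (Eventually.of_forall hK')
  have hprod := integrable_mul_sub_heatMean H.pos H.integrable_min hu hM hC hψi
  have hgain := integrable_mul_gaussGain H.pos H.integrable_min hφu hK hσ
    (V := EuclideanSpace ℝ (Fin d))
  have e1 : ∫ x, φ' (u x) * g x * gaussWeight σ x =
      κ * ∫ s, (∫ x, ψ x * (u x - heatMean s u x)) ∂ν := by
    rw [← integral_integral_swap hprod, ← integral_const_mul]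
    refine integral_congr_ae ((H.ae_eq hu hM hC hg h).mono fun x hx => ?_)
    beta_reduce
    rw [hx, integral_const_mul]; simp only [hψ]; ring
  have e2 : ∫ x, φ (u x) * gaussExcess ν σ x =
      ∫ s, (∫ x, φ (u x) * gaussGain σ s x) ∂ν := by
    rw [← integral_integral_swap hgain]
    congr 1; ext x; rw [integral_const_mul]; rfl
  rw [e1, e2, ← mul_neg, ← integral_neg]
  refine mul_le_mul_of_nonneg_left ?_ hκ
  refine integral_mono_ae hgain.integral_prod_right.neg hprod.integral_prod_right
    (Eventually.of_forall fun s => ?_)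
  beta_reduce
  have i1 : Integrable fun x => φ (u x) * gaussWeight σ x :=
    hgi.bdd_mul hφu.aestronglyMeasurable (Eventually.of_forall hK)
  have i2 := integrable_mul_heatMean hφu hK hgi hgc s
  have i3 : Integrable fun x => heatMean s (fun y => φ (u y)) x * gaussWeight σ x :=
    hgi.bdd_mul ((continuous_heatMean hφu hK).comp
      (continuous_const.prodMk continuous_id)).aestronglyMeasurable
      (Eventually.of_forall (abs_heatMean_le hK s))
  have i4 : Integrable fun x => ψ x * (u x - heatMean s u x) := by
    have hb : ∀ x, |u x - heatMean s u x| ≤ 2 * M := fun x => by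
      have := abs_heatMean_le hM s x
      have := abs_sub (u x) (heatMean s u x)
      linarith [hM x]
    refine hψi.mul_bdd (hu.sub ((continuous_heatMean hu hM).comp
      (continuous_const.prodMk continuous_id))).aestronglyMeasurable (Eventually.of_forall hb)
  -- By symmetry the heat flow acting on `φ (u ·)` is moved to the weight. Since `φ ≥ 0`, only the
  -- positive part of the resulting change of the weight needs to be kept.
  calc -∫ x, φ (u x) * gaussGain σ s x
      ≤ -∫ x, (φ (u x) * heatMean s (gaussWeight σ) x - φ (u x) * gaussWeight σ x) := by
        rw [neg_le_neg_iff]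
        refine integral_mono (i2.sub i1)
          ((integrable_gaussGain hσ s).bdd_mul hφu.aestronglyMeasurable (Eventually.of_forall hK))
          fun x => ?_
        beta_reduce
        rw [← mul_sub]
        exact mul_le_mul_of_nonneg_left (le_max_right _ _) (hφ0 _)
    _ = ∫ x, (φ (u x) * gaussWeight σ x - heatMean s (fun y => φ (u y)) x * gaussWeight σ x) := by
        rw [integral_sub i2 i1, integral_sub i1 i3, integral_mul_heatMean hφu hK hgi hgc s]
        ring
    _ ≤ _ := by
        refine integral_mono (i1.sub i3) i4 fun x => ?_
        simp only [hψ]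
        have := sub_heatMean_convex hu hM hφ htan hK s x
        have hp := gaussWeight_pos σ x
        nlinarith

end Convexity

/-! ### Integration against a divergence-free field of linear growth. -/

section Divergence

open Filter Topology

variable {d : ℕ}

theorem euclidean_fderiv_apply_eq_sum (h : EuclideanSpace ℝ (Fin d) → ℝ)
    (x y : EuclideanSpace ℝ (Fin d)) :
    fderiv ℝ h x y = ∑ i : Fin d, fderiv ℝ h x (EuclideanSpace.single i 1) * y i := by
  have hy : y = ∑ i : Fin d, y i • EuclideanSpace.single i (1 : ℝ) := by
    ext j
    simp [Finset.sum_apply, Pi.single_apply]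
  conv_lhs => rw [hy]
  rw [map_sum]
  exact Finset.sum_congr rfl fun i _ => by rw [map_smul, smul_eq_mul, mul_comm]

theorem integral_fderiv_apply_eq_zero_of_hasCompactSupport
    {w : EuclideanSpace ℝ (Fin d) → EuclideanSpace ℝ (Fin d)} (hw : ContDiff ℝ 1 w)
    (hdiv : ∀ x, spaceDivergence w x = 0) {h : EuclideanSpace ℝ (Fin d) → ℝ}
    (hh : ContDiff ℝ 1 h) (hs : HasCompactSupport h) :
    ∫ x, fderiv ℝ h x (w x) = 0 := by
  have hwi : ∀ i, ContDiff ℝ 1 fun x => w x i := fun i =>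
    (contDiff_euclidean.1 hw) i
  have hfw : ∀ i x y, fderiv ℝ (fun x => w x i) x y = fderiv ℝ w x y i := fun i x y => by
    have := ((EuclideanSpace.proj (𝕜 := ℝ) i).hasFDerivAt (x := w x)).comp x
      (hw.differentiable one_ne_zero x).hasFDerivAt
    exact congrArg (· y) this.fderiv
  have c1 : ∀ i, Continuous fun x => fderiv ℝ h x (EuclideanSpace.single i 1) := fun i =>
    (hh.continuous_fderiv one_ne_zero).clm_apply continuous_const
  have c2 : ∀ i, Continuous fun x => fderiv ℝ (fun x => w x i) x (EuclideanSpace.single i 1) :=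
    fun i => ((hwi i).continuous_fderiv one_ne_zero).clm_apply continuous_const
  have i1 : ∀ i, Integrable fun x => fderiv ℝ h x (EuclideanSpace.single i 1) * w x i := fun i =>
    ((c1 i).mul (hwi i).continuous).integrable_of_hasCompactSupport
      ((hs.fderiv_apply ℝ (EuclideanSpace.single i 1)).mul_right)
  have i2 : ∀ i, Integrable fun x => h x *
      fderiv ℝ (fun x => w x i) x (EuclideanSpace.single i 1) := fun i =>
    (hh.continuous.mul (c2 i)).integrable_of_hasCompactSupport hs.mul_right
  have i3 : ∀ i, Integrable fun x => h x * w x i := fun i =>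
    (hh.continuous.mul (hwi i).continuous).integrable_of_hasCompactSupport hs.mul_right
  rw [integral_congr_ae (Eventually.of_forall fun x => euclidean_fderiv_apply_eq_sum h x (w x)),
    integral_finsetSum _ fun i _ => i1 i]
  have key : ∀ i, ∫ x, fderiv ℝ h x (EuclideanSpace.single i 1) * w x i =
      -∫ x, h x * fderiv ℝ (fun x => w x i) x (EuclideanSpace.single i 1) := fun i => by
    rw [integral_mul_fderiv_eq_neg_fderiv_mul_of_integrable (i1 i) (i2 i) (i3 i)
      (fun x _ => hh.differentiable one_ne_zero x)
      (fun x _ => (hwi i).differentiable one_ne_zero x), neg_neg]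
  simp_rw [key]
  rw [Finset.sum_neg_distrib, ← integral_finsetSum _ fun i _ => i2 i, neg_eq_zero]
  simp_rw [← Finset.mul_sum, hfw]
  simp [spaceDivergence] at hdiv
  simp [hdiv]

/-- Cut off with `χ (x / (n + 1))`. On the support of the gradient of the cutoff one has `‖x‖ ≤ 2 (n
+ 1)`, so the linear growth of `w` is compensated by the factor `1 / (n + 1)`. The commutator is
thus at most a constant times `|h|` and tends to `0` pointwise, and dominated convergence applies.
-/
theorem integral_fderiv_apply_eq_zero
    {w : EuclideanSpace ℝ (Fin d) → EuclideanSpace ℝ (Fin d)} (hw : ContDiff ℝ 1 w)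
    (hdiv : ∀ x, spaceDivergence w x = 0) {C : ℝ} (hC : ∀ x, ‖w x‖ ≤ C * (1 + ‖x‖))
    {h : EuclideanSpace ℝ (Fin d) → ℝ} (hh : ContDiff ℝ 1 h) (hi : Integrable h)
    (hi' : Integrable fun x => fderiv ℝ h x (w x)) :
    ∫ x, fderiv ℝ h x (w x) = 0 := by
  have hC0 : 0 ≤ C := by simpa using (norm_nonneg _).trans (hC 0)
  let χ : ContDiffBump (0 : EuclideanSpace ℝ (Fin d)) := ⟨1, 2, one_pos, one_lt_two⟩
  have hχ : ContDiff ℝ 1 χ := χ.contDiff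
  obtain ⟨K, hK⟩ : ∃ K, ∀ x, ‖fderiv ℝ χ x‖ ≤ K :=
    (χ.hasCompactSupport.fderiv ℝ).exists_bound_of_continuous
      (hχ.continuous_fderiv one_ne_zero)
  have hK0 : 0 ≤ K := (norm_nonneg _).trans (hK 0)
  have hsupp : ∀ y, 2 < ‖y‖ → fderiv ℝ χ y = 0 := fun y hy => by
    refine image_eq_zero_of_notMem_tsupport fun hmem => ?_
    have := tsupport_fderiv_subset ℝ hmem
    rw [χ.tsupport_eq, Metric.mem_closedBall, dist_zero_right] at this
    exact absurd this (not_le.2 hy)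
  let c : ℕ → ℝ := fun n => ((n : ℝ) + 1)⁻¹
  have hc0 : ∀ n, 0 < c n := fun n => by positivity
  have hc1 : ∀ n, c n ≤ 1 := fun n => inv_le_one_of_one_le₀ (by linarith [n.cast_nonneg (α := ℝ)])
  have hc : Tendsto c atTop (𝓝 0) := by
    simpa [c, one_div] using tendsto_one_div_add_atTop_nhds_zero_nat (𝕜 := ℝ)
  have hlin : ∀ n, ContDiff ℝ 1 fun x : EuclideanSpace ℝ (Fin d) => c n • x :=
    fun n => contDiff_id.const_smul (c n)
  have hχn : ∀ n, ContDiff ℝ 1 fun x => χ (c n • x) := fun n => hχ.comp (hlin n)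
  have hder : ∀ n x, fderiv ℝ (fun x => χ (c n • x)) x = c n • fderiv ℝ χ (c n • x) :=
    fun n x => fderiv_comp_smul (f := χ) (c n)
  have hbd : ∀ n x, |fderiv ℝ (fun x => χ (c n • x)) x (w x)| ≤ K * (C * (1 + ‖x‖)) * c n :=
    fun n x => by
      rw [hder, ← Real.norm_eq_abs]
      refine (ContinuousLinearMap.le_opNorm _ _).trans ?_
      rw [norm_smul, Real.norm_of_nonneg (hc0 n).le]
      have := hC x
      have := hK (c n • x)
      have := (hc0 n).le
      calc _ ≤ c n * K * (C * (1 + ‖x‖)) := by gcongr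
        _ = _ := by ring
  have hbd2 : ∀ n x, |fderiv ℝ (fun x => χ (c n • x)) x (w x)| ≤ 3 * (K * C) := fun n x => by
    by_cases hx : 2 < ‖c n • x‖
    · rw [hder, hsupp _ hx]; simpa using by positivity
    · refine (hbd n x).trans ?_
      rw [norm_smul, Real.norm_of_nonneg (hc0 n).le] at hx
      -- Here `c n ≤ 1` and `c n * ‖x‖ ≤ 2`, the outer radius of the bump.
      have : (1 + ‖x‖) * c n ≤ 3 := by nlinarith [hc1 n, not_lt.1 hx]
      calc _ = K * C * ((1 + ‖x‖) * c n) := by ring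
        _ ≤ K * C * 3 := by gcongr
        _ = _ := by ring
  have hzero : ∀ n, ∫ x, (χ (c n • x) * fderiv ℝ h x (w x) +
      h x * fderiv ℝ (fun x => χ (c n • x)) x (w x)) = 0 := fun n => by
    rw [← integral_fderiv_apply_eq_zero_of_hasCompactSupport hw hdiv
      (h := fun x => χ (c n • x) * h x) ((hχn n).mul hh)]
    · congr 1; ext x
      rw [fderiv_fun_mul ((hχn n).differentiable one_ne_zero x)
        (hh.differentiable one_ne_zero x)]
      simp
    · exact HasCompactSupport.mul_right
        (χ.hasCompactSupport.comp_homeomorph (Homeomorph.smulOfNeZero _ (hc0 n).ne'))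
  have hlim : Tendsto (fun n => ∫ x, (χ (c n • x) * fderiv ℝ h x (w x) +
      h x * fderiv ℝ (fun x => χ (c n • x)) x (w x))) atTop
      (𝓝 (∫ x, fderiv ℝ h x (w x))) := by
    have cder : ∀ n, Continuous fun x => fderiv ℝ (fun x => χ (c n • x)) x (w x) := fun n =>
      ((hχn n).continuous_fderiv one_ne_zero).clm_apply hw.continuous
    refine tendsto_integral_of_dominated_convergence
      (fun x => |fderiv ℝ h x (w x)| + 3 * (K * C) * |h x|) (fun n => ?_)
      (hi'.abs.add (hi.abs.const_mul _)) (fun n => Eventually.of_forall fun x => ?_)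
      (Eventually.of_forall fun x => ?_)
    · exact ((((hχn n).continuous).mul ((hh.continuous_fderiv one_ne_zero).clm_apply
        hw.continuous)).add (hh.continuous.mul (cder n))).aestronglyMeasurable
    · rw [Real.norm_eq_abs]
      refine (abs_add_le _ _).trans ?_
      rw [abs_mul, abs_mul, abs_of_nonneg χ.nonneg, mul_comm |h x|]
      have h1 := hbd2 n x
      have h2 : χ (c n • x) ≤ 1 := χ.le_one
      gcongr
      exact mul_le_of_le_one_left (abs_nonneg _) h2
    · have e1 : Tendsto (fun n => χ (c n • x)) atTop (𝓝 1) := by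
        have : Tendsto (fun n => c n • x) atTop (𝓝 ((0 : ℝ) • x)) := hc.smul_const x
        have h2 := (χ.continuous.tendsto ((0 : ℝ) • x)).comp this
        rwa [zero_smul, χ.one_of_mem_closedBall (by simp [χ.rIn_pos.le])] at h2
      have e2 : Tendsto (fun n => fderiv ℝ (fun x => χ (c n • x)) x (w x)) atTop (𝓝 0) := by
        refine squeeze_zero_norm (hbd · x) ?_
        simpa using hc.const_mul (K * (C * (1 + ‖x‖)))
      simpa using (e1.mul_const (fderiv ℝ h x (w x))).add (e2.const_mul (h x))
  simp_rw [hzero] at hlim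
  exact tendsto_nhds_unique hlim tendsto_const_nhds

end Divergence

/-! ### The error weight produced by drift and dissipation. -/

section Flux

open Filter Topology

set_option linter.unusedSectionVars false

variable {V : Type*} [NormedAddCommGroup V] [InnerProductSpace ℝ V] [FiniteDimensional ℝ V]
  [MeasurableSpace V] [BorelSpace V] {ν : Measure ℝ} [SFinite ν]

theorem hasFDerivAt_gaussWeight (σ : ℝ) (x : V) :
    HasFDerivAt (gaussWeight σ) ((-(gaussWeight σ x / (2 * σ))) • innerSL ℝ x) x := by
  have h1 : HasFDerivAt (fun x : V => -‖x‖ ^ 2 / (4 * σ)) ((4 * σ)⁻¹ • -((2 : ℕ) • innerSL ℝ x)) x := by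
    simp only [div_eq_inv_mul]
    exact (hasStrictFDerivAt_norm_sq x).hasFDerivAt.neg.const_mul _
  have h2 := h1.exp
  refine h2.congr_fderiv ?_
  ext y
  simp only [smul_apply, neg_apply, smul_eq_mul, innerSL_apply_apply, gaussWeight, nsmul_eq_mul]
  push_cast
  ring

theorem abs_fderiv_gaussWeight_le {σ : ℝ} (hσ : 0 < σ) (x y : V) :
    |fderiv ℝ (gaussWeight σ) x y| ≤ ‖y‖ * (‖x‖ / (2 * σ)) * gaussWeight σ x := by
  rw [(hasFDerivAt_gaussWeight σ x).fderiv, smul_apply, innerSL_apply_apply,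
    smul_eq_mul, abs_mul, abs_neg, abs_of_pos (div_pos (gaussWeight_pos σ x) (by positivity))]
  have := abs_real_inner_le_norm x y
  have := gaussWeight_pos σ x
  calc _ ≤ gaussWeight σ x / (2 * σ) * (‖x‖ * ‖y‖) := by gcongr
    _ = _ := by ring

theorem contDiff_gaussWeight (σ : ℝ) : ContDiff ℝ 1 (gaussWeight σ : V → ℝ) := by
  unfold gaussWeight
  exact ((contDiff_norm_sq ℝ).neg.div_const _).exp

/-- One factor of growth comes from the drift, the other from the gradient of the weight. The
division by `σ` balances the factor lost in `norm_sq_mul_gaussWeight_le`, so the constant stays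
bounded for `σ ≥ 1`. -/
theorem one_add_norm_mul_norm_gaussWeight_le {σ : ℝ} (hσ : 0 < σ) (x : V) :
    (1 + ‖x‖) * (‖x‖ / (2 * σ)) * gaussWeight σ x ≤ (1 / (2 * σ) + 8) * gaussWeight (2 * σ) x := by
  have h1 := norm_sq_mul_gaussWeight_le (half_pos hσ) x
  rw [show 2 * (σ / 2) = σ by ring, show 4 * (σ / 2) = 2 * σ by ring,
    show 16 * (σ / 2) = 8 * σ by ring] at h1
  have h2 := gaussWeight_mono hσ (show σ ≤ 2 * σ by linarith) x
  have h3 := gaussWeight_pos σ x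
  have h4 : (1 + ‖x‖) * ‖x‖ ≤ 1 + 2 * ‖x‖ ^ 2 := by nlinarith [sq_nonneg (‖x‖ - 1), sq_nonneg ‖x‖]
  calc _ = (1 + ‖x‖) * ‖x‖ * gaussWeight σ x / (2 * σ) := by ring
    _ ≤ (1 + 2 * ‖x‖ ^ 2) * gaussWeight σ x / (2 * σ) := by gcongr
    _ = (gaussWeight σ x + 2 * (‖x‖ ^ 2 * gaussWeight σ x)) / (2 * σ) := by ring
    _ ≤ (gaussWeight (2 * σ) x + 2 * (8 * σ * gaussWeight (2 * σ) x)) / (2 * σ) := by gcongr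
    _ = _ := by field_simp

/-- A bound for the effect on the weight `gaussWeight σ` of a drift of growth `A * (1 + ‖x‖)` and
of the dissipation generated by the Lévy measure `κ ν`. -/
noncomputable def gaussFlux (ν : Measure ℝ) (κ A σ : ℝ) (x : V) : ℝ :=
  A * ((1 + ‖x‖) * (‖x‖ / (2 * σ)) * gaussWeight σ x) + κ * gaussExcess ν σ x

theorem gaussExcess_nonneg (ν : Measure ℝ) (σ : ℝ) (x : V) : 0 ≤ gaussExcess ν σ x :=
  integral_nonneg fun _ => gaussGain_nonneg _ _ _

theorem gaussFlux_nonneg {κ A σ : ℝ} (hκ : 0 ≤ κ) (hA : 0 ≤ A) (hσ : 0 < σ) (x : V) :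
    0 ≤ gaussFlux ν κ A σ x := by
  have := gaussExcess_nonneg ν σ x
  have := gaussWeight_pos σ x
  unfold gaussFlux; positivity

theorem continuous_gaussExcess (hpos : ∀ᵐ s ∂ν, 0 < s) (hmin : Integrable (fun s => min 1 s) ν)
    {σ : ℝ} (hσ : 0 < σ) : Continuous (gaussExcess ν σ : V → ℝ) := by
  unfold gaussExcess
  refine continuous_of_dominated (F := fun x s => gaussGain σ s x)
    (bound := fun s => (1 + 4 / σ) * min 1 s) (fun x => ?_)
    (fun x => hpos.mono fun s hs => ?_) (hmin.const_mul _) (Eventually.of_forall fun s => ?_)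
  · exact ((continuous_gaussGain hσ.le).comp
      (by fun_prop : Continuous fun s : ℝ => (x, s))).aestronglyMeasurable
  · rw [Real.norm_of_nonneg (gaussGain_nonneg _ _ _)]
    exact gaussGain_le_min hσ hs.le x
  · have h := (continuous_gaussGain (V := V) hσ.le).comp
      (by fun_prop : Continuous fun x : V => (x, s))
    exact h

theorem continuous_gaussFlux (hpos : ∀ᵐ s ∂ν, 0 < s) (hmin : Integrable (fun s => min 1 s) ν)
    (κ A : ℝ) {σ : ℝ} (hσ : 0 < σ) : Continuous (gaussFlux ν κ A σ : V → ℝ) := by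
  have := continuous_gaussExcess (V := V) hpos hmin hσ
  have := continuous_gaussWeight (V := V) σ
  unfold gaussFlux; fun_prop

theorem integrable_one_add_norm_mul_gaussWeight {σ : ℝ} (hσ : 0 < σ) :
    Integrable fun x : V => (1 + ‖x‖) * gaussWeight σ x := by
  have hc := continuous_gaussWeight (V := V) σ
  refine ((integrable_gaussWeight (V := V) (σ := 2 * σ) (by positivity)).const_mul
    (2 + 8 * σ)).mono' (by fun_prop) (Eventually.of_forall fun x => ?_)
  have h3 := gaussWeight_pos σ x
  rw [Real.norm_of_nonneg (by positivity)]
  have h1 := norm_sq_mul_gaussWeight_le (half_pos hσ) x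
  rw [show 2 * (σ / 2) = σ by ring, show 4 * (σ / 2) = 2 * σ by ring,
    show 16 * (σ / 2) = 8 * σ by ring] at h1
  have h2 := gaussWeight_mono hσ (show σ ≤ 2 * σ by linarith) x
  have h4 : 1 + ‖x‖ ≤ 2 + ‖x‖ ^ 2 := by nlinarith [sq_nonneg (‖x‖ - 1)]
  calc _ ≤ (2 + ‖x‖ ^ 2) * gaussWeight σ x := by gcongr
    _ = 2 * gaussWeight σ x + ‖x‖ ^ 2 * gaussWeight σ x := by ring
    _ ≤ 2 * gaussWeight (2 * σ) x + 8 * σ * gaussWeight (2 * σ) x := by gcongr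
    _ = _ := by ring

theorem integrable_gaussFlux (hpos : ∀ᵐ s ∂ν, 0 < s) (hmin : Integrable (fun s => min 1 s) ν)
    (κ A : ℝ) {σ : ℝ} (hσ : 0 < σ) : Integrable (gaussFlux ν κ A σ : V → ℝ) := by
  have hc := continuous_gaussWeight (V := V) σ
  unfold gaussFlux
  refine Integrable.add (Integrable.const_mul ?_ A) (Integrable.const_mul ?_ κ)
  · refine ((integrable_gaussWeight (V := V) (σ := 2 * σ) (by positivity)).const_mul
      (1 / (2 * σ) + 8)).mono' (by fun_prop) (Eventually.of_forall fun x => ?_)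
    have := gaussWeight_pos σ x
    rw [Real.norm_of_nonneg (by positivity)]
    exact one_add_norm_mul_norm_gaussWeight_le hσ x
  · simpa using integrable_mul_gaussExcess hpos hmin (w := fun _ : V => (1 : ℝ)) (M := 1)
      continuous_const (by simp) hσ

end Flux

/-! ### Transport with an abstract dissipation; the drift term. -/

section Energy

open Filter Topology

set_option linter.unusedSectionVars false

variable {d : ℕ}

/-- `θ` solves `∂ₜ θ + v · ∇θ + B = f` on `[0, T]`, where `B` is dissipative in the sense of the
weighted Córdoba–Córdoba inequality for the Lévy measure `κ ν`. -/
structure IsTransportSolution (ν : Measure ℝ) (κ T A : ℝ)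
    (θ f B : ℝ → EuclideanSpace ℝ (Fin d) → ℝ)
    (v : ℝ → EuclideanSpace ℝ (Fin d) → EuclideanSpace ℝ (Fin d)) : Prop where
  continuous_theta : Continuous (Function.uncurry θ)
  continuous_f : Continuous (Function.uncurry f)
  continuous_B : Continuous (Function.uncurry B)
  continuous_v : Continuous (Function.uncurry v)
  contDiff_theta : ∀ t, ContDiff ℝ 1 (θ t)
  contDiff_v : ∀ t, ContDiff ℝ 1 (v t)
  continuous_fderiv :
    Continuous fun p : ℝ × EuclideanSpace ℝ (Fin d) => fderiv ℝ (θ p.1) p.2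
  div_v : ∀ t x, spaceDivergence (v t) x = 0
  growth_v : ∀ t x, ‖v t x‖ ≤ A * (1 + ‖x‖)
  bounded_theta : ∃ M, ∀ t x, |θ t x| ≤ M
  bounded_fderiv : ∃ M, ∀ t x, ‖fderiv ℝ (θ t) x‖ ≤ M
  bounded_B : ∃ M, ∀ t x, |B t x| ≤ M
  hasDerivAt : ∀ t ∈ Ioo 0 T, ∀ x,
    HasDerivAt (fun s => θ s x) (f t x - B t x - fderiv ℝ (θ t) x (v t x)) t
  dissipative : ∀ φ φ' : ℝ → ℝ, Continuous φ → Continuous φ' → (∀ a, 0 ≤ φ a) →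
    (∀ a b, φ a + φ' a * (b - a) ≤ φ b) → ∀ σ, 0 < σ → ∀ t,
    -(κ * ∫ x, φ (θ t x) * gaussExcess ν σ x) ≤ ∫ x, φ' (θ t x) * B t x * gaussWeight σ x

variable {ν : Measure ℝ} [SFinite ν] {κ T A : ℝ} {θ f B : ℝ → EuclideanSpace ℝ (Fin d) → ℝ}
  {v : ℝ → EuclideanSpace ℝ (Fin d) → EuclideanSpace ℝ (Fin d)}

/-- By the product rule, the transport term is the derivative of `φ (θ) * gaussWeight σ` along `v`,
which integrates to `0`, minus `φ (θ)` times the derivative of the weight along `v`. -/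
theorem IsTransportSolution.integral_fderiv_mul_gaussWeight_le
    (H : IsTransportSolution ν κ T A θ f B v)
    {φ φ' : ℝ → ℝ} (hφ : ∀ a, HasDerivAt φ (φ' a) a) (hφ' : Continuous φ') (hφ0 : ∀ a, 0 ≤ φ a)
    {σ : ℝ} (hσ : 0 < σ) (t : ℝ) :
    -∫ x, φ' (θ t x) * fderiv ℝ (θ t) x (v t x) * gaussWeight σ x ≤
      ∫ x, φ (θ t x) * (A * ((1 + ‖x‖) * (‖x‖ / (2 * σ)) * gaussWeight σ x)) := by
  have hφc : Continuous φ := continuous_iff_continuousAt.2 fun a => (hφ a).continuousAt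
  have hφ1 : ContDiff ℝ 1 φ := by
    rw [contDiff_one_iff_deriv]
    refine ⟨fun a => (hφ a).differentiableAt, ?_⟩
    rwa [show deriv φ = φ' from funext fun a => (hφ a).deriv]
  obtain ⟨M, hM⟩ := H.bounded_theta
  obtain ⟨M', hM'⟩ := H.bounded_fderiv
  have hM'0 : 0 ≤ M' := (norm_nonneg _).trans (hM' 0 0)
  obtain ⟨K, hK⟩ : ∃ K, ∀ t x, |φ (θ t x)| ≤ K := by
    obtain ⟨K, hK⟩ := (isCompact_Icc (a := -M) (b := M)).exists_bound_of_continuousOn hφc.continuousOn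
    exact ⟨K, fun t x => hK _ (abs_le.1 (hM t x))⟩
  obtain ⟨K', hK'⟩ : ∃ K, ∀ t x, |φ' (θ t x)| ≤ K := by
    obtain ⟨K, hK⟩ := (isCompact_Icc (a := -M) (b := M)).exists_bound_of_continuousOn hφ'.continuousOn
    exact ⟨K, fun t x => hK _ (abs_le.1 (hM t x))⟩
  have hK'0 : 0 ≤ K' := (abs_nonneg _).trans (hK' 0 0)
  have hA0 : 0 ≤ A := by simpa using (norm_nonneg _).trans (H.growth_v 0 0)
  have hg := integrable_gaussWeight (V := EuclideanSpace ℝ (Fin d)) hσ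
  have hgc := continuous_gaussWeight (V := EuclideanSpace ℝ (Fin d)) σ
  have hθc := (H.contDiff_theta t).continuous
  have hθd := (H.contDiff_theta t).continuous_fderiv one_ne_zero
  have hvc := (H.contDiff_v t).continuous
  set h : EuclideanSpace ℝ (Fin d) → ℝ := fun x => φ (θ t x) * gaussWeight σ x with hh
  have hh1 : ContDiff ℝ 1 h := (hφ1.comp (H.contDiff_theta t)).mul (contDiff_gaussWeight σ)
  have hder : ∀ x, fderiv ℝ h x (v t x) = φ' (θ t x) * fderiv ℝ (θ t) x (v t x) * gaussWeight σ x +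
      φ (θ t x) * fderiv ℝ (gaussWeight σ) x (v t x) := fun x => by
    have h1 : HasFDerivAt (fun x => φ (θ t x)) (φ' (θ t x) • fderiv ℝ (θ t) x) x :=
      (hφ (θ t x)).comp_hasFDerivAt x ((H.contDiff_theta t).differentiable one_ne_zero x).hasFDerivAt
    have h2 : HasFDerivAt h _ x := h1.mul (hasFDerivAt_gaussWeight σ x)
    rw [h2.fderiv, (hasFDerivAt_gaussWeight σ x).fderiv]
    simp only [add_apply, smul_apply, smul_eq_mul]
    ring
  have i1 : Integrable fun x => φ' (θ t x) * fderiv ℝ (θ t) x (v t x) * gaussWeight σ x := by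
    refine ((integrable_one_add_norm_mul_gaussWeight hσ).const_mul (K' * (M' * A))).mono'
      (by fun_prop) (Eventually.of_forall fun x => ?_)
    have := gaussWeight_pos σ x
    rw [norm_mul, norm_mul, Real.norm_of_nonneg this.le]
    calc _ ≤ K' * (M' * (A * (1 + ‖x‖))) * gaussWeight σ x := by
          gcongr
          · exact hK' t x
          · exact ((fderiv ℝ (θ t) x).le_opNorm _).trans
              (mul_le_mul (hM' t x) (H.growth_v t x) (norm_nonneg _) hM'0)
      _ = _ := by ring
  have hbd : ∀ x, |φ (θ t x) * fderiv ℝ (gaussWeight σ) x (v t x)| ≤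
      φ (θ t x) * (A * ((1 + ‖x‖) * (‖x‖ / (2 * σ)) * gaussWeight σ x)) := fun x => by
    rw [abs_mul, abs_of_nonneg (hφ0 _)]
    refine mul_le_mul_of_nonneg_left ((abs_fderiv_gaussWeight_le hσ x _).trans ?_) (hφ0 _)
    have := gaussWeight_pos σ x
    calc _ ≤ A * (1 + ‖x‖) * (‖x‖ / (2 * σ)) * gaussWeight σ x := by
          gcongr; exact H.growth_v t x
      _ = _ := by ring
  have i2 : Integrable fun x : EuclideanSpace ℝ (Fin d) =>
      φ (θ t x) * (A * ((1 + ‖x‖) * (‖x‖ / (2 * σ)) * gaussWeight σ x)) := by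
    refine Integrable.bdd_mul (c := K) (Integrable.const_mul ?_ A)
      (hφc.comp hθc).aestronglyMeasurable (Eventually.of_forall (hK t))
    refine ((integrable_gaussWeight (σ := 2 * σ) (by positivity)).const_mul
      (1 / (2 * σ) + 8)).mono' (by fun_prop) (Eventually.of_forall fun x => ?_)
    have := gaussWeight_pos σ x
    rw [Real.norm_of_nonneg (by positivity)]
    exact one_add_norm_mul_norm_gaussWeight_le hσ x
  have i3 : Integrable fun x => φ (θ t x) * fderiv ℝ (gaussWeight σ) x (v t x) :=
    i2.mono' ((hφc.comp hθc).mul (((contDiff_gaussWeight σ).continuous_fderiv one_ne_zero).clm_apply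
      hvc)).aestronglyMeasurable (Eventually.of_forall hbd)
  have hz := integral_fderiv_apply_eq_zero (H.contDiff_v t) (H.div_v t) (H.growth_v t) hh1
    (hg.bdd_mul (hφc.comp hθc).aestronglyMeasurable (Eventually.of_forall (hK t)))
    ((i1.add i3).congr (Eventually.of_forall fun x => (hder x).symm))
  simp_rw [hder] at hz
  rw [integral_add i1 i3] at hz
  rw [show -∫ x, φ' (θ t x) * fderiv ℝ (θ t) x (v t x) * gaussWeight σ x =
    ∫ x, φ (θ t x) * fderiv ℝ (gaussWeight σ) x (v t x) by linarith]
  exact integral_mono i3 i2 fun x => (le_abs_self _).trans (hbd x)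

end Energy

/-! ### The weighted energy inequality, integrated in time. -/

section EnergyInequality

open Filter Topology

set_option linter.unusedSectionVars false

variable {d : ℕ} {ν : Measure ℝ} [SFinite ν] {κ T A : ℝ}
  {θ f B : ℝ → EuclideanSpace ℝ (Fin d) → ℝ}
  {v : ℝ → EuclideanSpace ℝ (Fin d) → EuclideanSpace ℝ (Fin d)}

theorem IsTransportSolution.A_nonneg (H : IsTransportSolution ν κ T A θ f B v) : 0 ≤ A := by
  simpa using (norm_nonneg _).trans (H.growth_v 0 0)

theorem IsTransportSolution.exists_bound_comp (H : IsTransportSolution ν κ T A θ f B v)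
    {φ : ℝ → ℝ} (hφ : Continuous φ) : ∃ K, ∀ t x, |φ (θ t x)| ≤ K := by
  obtain ⟨M, hM⟩ := H.bounded_theta
  obtain ⟨K, hK⟩ := (isCompact_Icc (a := -M) (b := M)).exists_bound_of_continuousOn hφ.continuousOn
  exact ⟨K, fun t x => hK _ (abs_le.1 (hM t x))⟩

theorem integrable_of_lintegral_ofReal_abs_lt_top {Ω Ω' : Type*} [MeasurableSpace Ω]
    [MeasurableSpace Ω'] {μ : Measure Ω} {μ' : Measure Ω'} [SFinite μ'] {P : Ω × Ω' → ℝ}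
    (hP : AEStronglyMeasurable P (μ.prod μ'))
    (h : ∫⁻ s, ∫⁻ x, ENNReal.ofReal |P (s, x)| ∂μ' ∂μ < ⊤) : Integrable P (μ.prod μ') := by
  refine ⟨hP, ?_⟩
  rw [hasFiniteIntegral_iff_norm, lintegral_prod]
  · exact h
  · exact hP.norm.aemeasurable.ennreal_ofReal

/-- The weighted energy inequality for a Gaussian weight, in integrated form. -/
theorem IsTransportSolution.energy (H : IsTransportSolution ν κ T A θ f B v) (hκ : 0 ≤ κ)
    (hpos : ∀ᵐ s ∂ν, 0 < s) (hmin : Integrable (fun s => min 1 s) ν)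
    {φ φ' : ℝ → ℝ} (hφ : ∀ a, HasDerivAt φ (φ' a) a) (hφ' : Continuous φ') (hφ0 : ∀ a, 0 ≤ φ a)
    (htan : ∀ a b, φ a + φ' a * (b - a) ≤ φ b) {σ : ℝ} (hσ : 0 < σ) {a b : ℝ} (ha : 0 ≤ a)
    (hab : a ≤ b) (hb : b ≤ T) :
    ∫⁻ x, ENNReal.ofReal (φ (θ b x) * gaussWeight σ x) ≤
      (∫⁻ x, ENNReal.ofReal (φ (θ a x) * gaussWeight σ x)) +
      (∫⁻ s in Ioc a b, ∫⁻ x, ENNReal.ofReal (|φ' (θ s x)| * |f s x| * gaussWeight σ x)) +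
      ∫⁻ s in Ioc a b, ∫⁻ x, ENNReal.ofReal (φ (θ s x) * gaussFlux ν κ A σ x) := by
  have hA := H.A_nonneg
  have hφc : Continuous φ := continuous_iff_continuousAt.2 fun a => (hφ a).continuousAt
  obtain ⟨K, hK⟩ := H.exists_bound_comp hφc
  obtain ⟨K', hK'⟩ := H.exists_bound_comp hφ'
  obtain ⟨M', hM'⟩ := H.bounded_fderiv
  obtain ⟨KB, hKB⟩ := H.bounded_B
  have hM'0 : 0 ≤ M' := (norm_nonneg _).trans (hM' 0 0)
  have hK'0 : 0 ≤ K' := (abs_nonneg _).trans (hK' 0 0)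
  have hKB0 : 0 ≤ KB := (abs_nonneg _).trans (hKB 0 0)
  have hg := integrable_gaussWeight (V := EuclideanSpace ℝ (Fin d)) hσ
  have hgc := continuous_gaussWeight (V := EuclideanSpace ℝ (Fin d)) σ
  have hgp := gaussWeight_pos (V := EuclideanSpace ℝ (Fin d)) σ
  set μ : Measure (ℝ × EuclideanSpace ℝ (Fin d)) := (volume.restrict (Ioc a b)).prod volume with hμ
  have cθ : Continuous fun p : ℝ × EuclideanSpace ℝ (Fin d) => θ p.1 p.2 := H.continuous_theta
  have cf : Continuous fun p : ℝ × EuclideanSpace ℝ (Fin d) => f p.1 p.2 := H.continuous_f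
  have cB : Continuous fun p : ℝ × EuclideanSpace ℝ (Fin d) => B p.1 p.2 := H.continuous_B
  have cv : Continuous fun p : ℝ × EuclideanSpace ℝ (Fin d) => v p.1 p.2 := H.continuous_v
  have cd := H.continuous_fderiv
  have cdv : Continuous fun p : ℝ × EuclideanSpace ℝ (Fin d) =>
      fderiv ℝ (θ p.1) p.2 (v p.1 p.2) := cd.clm_apply cv
  have cφ : Continuous fun p : ℝ × EuclideanSpace ℝ (Fin d) => φ (θ p.1 p.2) := hφc.comp cθ
  have cφ' : Continuous fun p : ℝ × EuclideanSpace ℝ (Fin d) => φ' (θ p.1 p.2) := hφ'.comp cθ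
  have cg : Continuous fun p : ℝ × EuclideanSpace ℝ (Fin d) => gaussWeight σ p.2 :=
    hgc.comp continuous_snd
  set P : ℝ × EuclideanSpace ℝ (Fin d) → ℝ :=
    fun p => φ' (θ p.1 p.2) * f p.1 p.2 * gaussWeight σ p.2 with hP
  set Q : ℝ × EuclideanSpace ℝ (Fin d) → ℝ :=
    fun p => φ' (θ p.1 p.2) * B p.1 p.2 * gaussWeight σ p.2 with hQ
  set R : ℝ × EuclideanSpace ℝ (Fin d) → ℝ :=
    fun p => φ' (θ p.1 p.2) * fderiv ℝ (θ p.1) p.2 (v p.1 p.2) * gaussWeight σ p.2 with hR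
  set S : ℝ × EuclideanSpace ℝ (Fin d) → ℝ :=
    fun p => φ (θ p.1 p.2) * gaussFlux ν κ A σ p.2 with hS
  have cP : Continuous P := (cφ'.mul cf).mul cg
  have cQ : Continuous Q := (cφ'.mul cB).mul cg
  have cR : Continuous R := (cφ'.mul cdv).mul cg
  have cS : Continuous S := cφ.mul ((continuous_gaussFlux hpos hmin κ A hσ).comp continuous_snd)
  have hPabs : ∀ s x, |P (s, x)| = |φ' (θ s x)| * |f s x| * gaussWeight σ x := fun s x => by
    rw [hP, abs_mul, abs_mul, abs_of_pos (hgp x)]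
  have hS0 : ∀ p, 0 ≤ S p := fun p => mul_nonneg (hφ0 _) (gaussFlux_nonneg hκ hA hσ _)
  -- No growth bound on `f` is available, so integrability of the forcing term is obtained from
  -- finiteness of the right-hand side; otherwise there is nothing to prove.
  rcases eq_or_ne (∫⁻ s in Ioc a b, ∫⁻ x,
    ENNReal.ofReal (|φ' (θ s x)| * |f s x| * gaussWeight σ x)) ⊤ with htop | hfin
  · rw [htop]; simp
  have iP : Integrable P μ := by
    refine integrable_of_lintegral_ofReal_abs_lt_top cP.aestronglyMeasurable ?_
    simp_rw [hPabs]; exact hfin.lt_top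
  have iQ : Integrable Q μ := by
    refine ((hg.const_mul (K' * KB)).comp_snd (volume.restrict (Ioc a b))).mono'
      cQ.aestronglyMeasurable (Eventually.of_forall fun p => ?_)
    simp only [hQ]
    rw [norm_mul, norm_mul, Real.norm_of_nonneg (hgp _).le]
    have := (hgp p.2).le
    gcongr
    · exact hK' _ _
    · exact hKB _ _
  have iR : Integrable R μ := by
    refine (((integrable_one_add_norm_mul_gaussWeight hσ).const_mul (K' * (M' * A))).comp_snd
      (volume.restrict (Ioc a b))).mono' cR.aestronglyMeasurable (Eventually.of_forall fun p => ?_)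
    simp only [hR]
    rw [norm_mul, norm_mul, Real.norm_of_nonneg (hgp _).le]
    have := (hgp p.2).le
    calc _ ≤ K' * (M' * (A * (1 + ‖p.2‖))) * gaussWeight σ p.2 := by
          gcongr
          · exact hK' _ _
          · exact ((fderiv ℝ (θ p.1) p.2).le_opNorm _).trans
              (mul_le_mul (hM' _ _) (H.growth_v _ _) (norm_nonneg _) hM'0)
      _ = _ := by ring
  have iS : Integrable S μ :=
    ((integrable_gaussFlux hpos hmin κ A hσ).comp_snd (volume.restrict (Ioc a b))).bdd_mul
      cφ.aestronglyMeasurable (Eventually.of_forall fun p => hK p.1 p.2)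
  have iX : ∀ t, Integrable fun x => φ (θ t x) * gaussWeight σ x := fun t =>
    hg.bdd_mul (hφc.comp (H.contDiff_theta t).continuous).aestronglyMeasurable
      (Eventually.of_forall (hK t))
  have X0 : ∀ t, 0 ≤ fun x => φ (θ t x) * gaussWeight σ x := fun t x =>
    mul_nonneg (hφ0 _) (hgp x).le
  have iPQR : Integrable (fun p => P p - Q p - R p) μ := (iP.sub iQ).sub iR
  -- The time derivative is integrated at fixed `x` and then over space, which avoids
  -- differentiating a space integral in time.
  have hftc : ∀ x, φ (θ b x) * gaussWeight σ x - φ (θ a x) * gaussWeight σ x =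
      ∫ s in Ioc a b, (P (s, x) - Q (s, x) - R (s, x)) := fun x => by
    rw [← intervalIntegral.integral_of_le hab]
    have cont : Continuous fun s => P (s, x) - Q (s, x) - R (s, x) := by fun_prop
    refine (intervalIntegral.integral_eq_sub_of_hasDerivAt_of_le
      (f := fun s => φ (θ s x) * gaussWeight σ x) hab ?_
      (fun s hs => ?_) (cont.intervalIntegrable _ _)).symm
    · have : Continuous fun s => φ (θ s x) * gaussWeight σ x := by
        have := cφ.comp (by fun_prop : Continuous fun s : ℝ => (s, x))
        exact this.mul continuous_const
      exact this.continuousOn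
    · have h1 := H.hasDerivAt s ⟨ha.trans_lt hs.1, hs.2.trans_le hb⟩ x
      have h2 := ((hφ (θ s x)).comp s h1).mul_const (gaussWeight σ x)
      refine h2.congr_deriv ?_
      simp only [hP, hQ, hR]; ring
  have hmain : ∫ x, φ (θ b x) * gaussWeight σ x ≤
      (∫ x, φ (θ a x) * gaussWeight σ x) + ∫ p, |P p| ∂μ + ∫ p, S p ∂μ := by
    have e1 : (∫ x, φ (θ b x) * gaussWeight σ x) - ∫ x, φ (θ a x) * gaussWeight σ x =
        ∫ p, (P p - Q p - R p) ∂μ := by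
      rw [← integral_sub (iX b) (iX a), integral_prod_symm _ iPQR]
      exact integral_congr_ae (Eventually.of_forall hftc)
    have e2 : ∫ p, (P p - Q p - R p) ∂μ ≤ ∫ p, |P p| ∂μ + ∫ p, S p ∂μ := by
      rw [integral_sub (f := fun p => P p - Q p) (iP.sub iQ) iR, integral_sub iP iQ]
      have h1 : ∫ p, P p ∂μ ≤ ∫ p, |P p| ∂μ := integral_mono iP iP.abs fun p => le_abs_self _
      -- At almost every time, the Córdoba–Córdoba inequality bounds the `Q` term and
      -- incompressibility the `R` term; together they make up `gaussFlux`.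
      have h2 : -∫ p, Q p ∂μ - ∫ p, R p ∂μ ≤ ∫ p, S p ∂μ := by
        rw [← integral_neg, ← integral_sub (f := fun p => -Q p) iQ.neg iR,
          integral_prod (fun p => -Q p - R p) (iQ.neg.sub iR), integral_prod _ iS]
        refine integral_mono_ae (iQ.neg.sub iR).integral_prod_left iS.integral_prod_left ?_
        filter_upwards [iQ.prod_right_ae, iR.prod_right_ae] with s hs1 hs2
        beta_reduce
        rw [integral_sub (f := fun y => -Q (s, y)) hs1.neg hs2, integral_neg]
        have k1 := H.dissipative φ φ' hφc hφ' hφ0 htan σ hσ s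
        have k2 := H.integral_fderiv_mul_gaussWeight_le hφ hφ' hφ0 hσ s
        have j1 : Integrable fun x => φ (θ s x) * gaussExcess ν σ x :=
          integrable_mul_gaussExcess hpos hmin (hφc.comp (H.contDiff_theta s).continuous)
            (hK s) hσ
        have j2 : Integrable fun x => φ (θ s x) * gaussFlux ν κ A σ x :=
          (integrable_gaussFlux hpos hmin κ A hσ).bdd_mul
            (hφc.comp (H.contDiff_theta s).continuous).aestronglyMeasurable
            (Eventually.of_forall (hK s))
        have k3 : ∫ x, S (s, x) = (∫ x, φ (θ s x) * (A * ((1 + ‖x‖) * (‖x‖ / (2 * σ)) *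
            gaussWeight σ x))) + κ * ∫ x, φ (θ s x) * gaussExcess ν σ x := by
          rw [← integral_const_mul, ← integral_add]
          · congr 1; ext x; simp only [hS, gaussFlux]; ring
          · refine (j2.sub (j1.const_mul κ)).congr (Eventually.of_forall fun x => ?_)
            simp only [Pi.sub_apply, gaussFlux]; ring
          · exact j1.const_mul κ
        rw [k3]
        simp only [hQ, hR]
        linarith
      linarith
    linarith
  rw [← ofReal_integral_eq_lintegral_ofReal (iX b) (Eventually.of_forall (X0 b)),
    ← ofReal_integral_eq_lintegral_ofReal (iX a) (Eventually.of_forall (X0 a))]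
  have f1 : ∫⁻ s in Ioc a b, ∫⁻ x, ENNReal.ofReal (|φ' (θ s x)| * |f s x| * gaussWeight σ x) =
      ENNReal.ofReal (∫ p, |P p| ∂μ) := by
    rw [ofReal_integral_eq_lintegral_ofReal iP.abs (Eventually.of_forall fun p => abs_nonneg _),
      lintegral_prod _ cP.abs.aemeasurable.ennreal_ofReal]
    simp_rw [hPabs]
  have f2 : ∫⁻ s in Ioc a b, ∫⁻ x, ENNReal.ofReal (φ (θ s x) * gaussFlux ν κ A σ x) =
      ENNReal.ofReal (∫ p, S p ∂μ) := by
    rw [ofReal_integral_eq_lintegral_ofReal iS (Eventually.of_forall hS0),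
      lintegral_prod _ cS.aemeasurable.ennreal_ofReal]
  rw [f1, f2, ← ENNReal.ofReal_add (integral_nonneg (X0 a)) (integral_nonneg fun p => abs_nonneg _),
    ← ENNReal.ofReal_add (add_nonneg (integral_nonneg (X0 a)) (integral_nonneg fun p => abs_nonneg _))
      (integral_nonneg hS0)]
  exact ENNReal.ofReal_le_ofReal hmain

end EnergyInequality

/-! ### Energy inequalities for powers. -/

section PowerEnergy

open Filter Topology

set_option linter.unusedSectionVars false

/-- For `a ≠ 0`, this is Bernoulli's inequality for the ratio `|b| / |a|`, together with `a b ≤ |a|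
|b|`. -/
theorem abs_rpow_tangent {q : ℝ} (hq : 1 < q) (a b : ℝ) :
    |a| ^ q + q * |a| ^ (q - 2) * a * (b - a) ≤ |b| ^ q := by
  rcases eq_or_ne a 0 with rfl | ha
  · simpa [Real.zero_rpow (by positivity : q ≠ 0)] using by positivity
  have h0 : 0 < |a| := abs_pos.2 ha
  have h1 := one_add_mul_self_le_rpow_one_add (s := |b| / |a| - 1) (by
    have : 0 ≤ |b| / |a| := by positivity
    linarith) hq.le
  rw [add_sub_cancel, Real.div_rpow (abs_nonneg _) (abs_nonneg _),
    le_div_iff₀ (by positivity)] at h1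
  have h2 : |a| ^ q = |a| ^ (q - 2) * |a| ^ 2 := by
    rw [← Real.rpow_natCast, ← Real.rpow_add h0]; norm_num
  have h3 : a * b ≤ |a| * |b| := by rw [← abs_mul]; exact le_abs_self _
  have h4 : 0 < |a| ^ (q - 2) := by positivity
  refine le_trans ?_ h1
  rw [h2]
  have h5 : (1 + q * (|b| / |a| - 1)) * (|a| ^ (q - 2) * |a| ^ 2) =
      |a| ^ (q - 2) * (|a| ^ 2 + q * (|a| * |b| - |a| ^ 2)) := by field_simp
  rw [h5, sq_abs]
  have h6 : q * (a * b) ≤ q * (|a| * |b|) := by gcongr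
  nlinarith

theorem continuous_abs_rpow_mul {q : ℝ} (hq : 1 < q) :
    Continuous fun a : ℝ => q * |a| ^ (q - 2) * a := by
  have h := (contDiff_norm_rpow (E := ℝ) hq).continuous_deriv le_rfl
  convert h using 1
  ext a
  exact (hasDerivAt_abs_rpow a hq).deriv.symm

theorem abs_rpow_mul {q : ℝ} (hq : 1 < q) (a : ℝ) : |q * |a| ^ (q - 2) * a| = q * |a| ^ (q - 1) := by
  rcases eq_or_ne a 0 with rfl | ha
  · simp [Real.zero_rpow (sub_ne_zero.2 hq.ne')]
  have h0 : 0 < |a| := abs_pos.2 ha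
  rw [abs_mul, abs_of_nonneg (by positivity), mul_assoc]
  congr 1
  conv_lhs => rw [← Real.rpow_one |a|]
  rw [Real.rpow_one |a|]
  nth_rewrite 2 [← Real.rpow_one |a|]
  rw [← Real.rpow_add h0]; congr 1; ring

/-- The Cauchy–Schwarz inequality for the vectors `(a, δ)` and `(b, δ)`. -/
theorem sqrt_sq_add_tangent {δ : ℝ} (hδ : 0 < δ) (a b : ℝ) :
    Real.sqrt (a ^ 2 + δ ^ 2) + a / Real.sqrt (a ^ 2 + δ ^ 2) * (b - a) ≤
      Real.sqrt (b ^ 2 + δ ^ 2) := by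
  have ha : 0 < Real.sqrt (a ^ 2 + δ ^ 2) := Real.sqrt_pos.2 (by positivity)
  have hb : 0 ≤ Real.sqrt (b ^ 2 + δ ^ 2) := Real.sqrt_nonneg _
  have ha2 := Real.sq_sqrt (show 0 ≤ a ^ 2 + δ ^ 2 by positivity)
  have hb2 := Real.sq_sqrt (show 0 ≤ b ^ 2 + δ ^ 2 by positivity)
  set u := Real.sqrt (a ^ 2 + δ ^ 2)
  set w := Real.sqrt (b ^ 2 + δ ^ 2)
  have key : a * b + δ ^ 2 ≤ u * w := by
    refine le_of_sq_le_sq ?_ (by positivity)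
    rw [mul_pow, ha2, hb2]
    nlinarith [sq_nonneg (δ * (a - b))]
  have : u + a / u * (b - a) = (a * b + δ ^ 2) / u := by
    field_simp; nlinarith
  rw [this, div_le_iff₀ ha]; linarith

theorem hasDerivAt_sqrt_sq_add {δ : ℝ} (hδ : 0 < δ) (a : ℝ) :
    HasDerivAt (fun a => Real.sqrt (a ^ 2 + δ ^ 2)) (a / Real.sqrt (a ^ 2 + δ ^ 2)) a := by
  have h := ((hasDerivAt_pow 2 a).add_const (δ ^ 2)).sqrt (by positivity)
  refine h.congr_deriv ?_
  push_cast; field_simp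

theorem sqrt_sq_add_le {δ : ℝ} (hδ : 0 < δ) (a : ℝ) : Real.sqrt (a ^ 2 + δ ^ 2) ≤ |a| + δ := by
  rw [Real.sqrt_le_left (by positivity)]
  nlinarith [sq_abs a, mul_nonneg (abs_nonneg a) hδ.le]

theorem abs_le_sqrt_sq_add (δ a : ℝ) : |a| ≤ Real.sqrt (a ^ 2 + δ ^ 2) :=
  Real.abs_le_sqrt (by nlinarith [sq_nonneg δ])

theorem ENNReal.le_of_forall_pos_le_add_ofReal_mul {X Y c : ℝ≥0∞} (hc : c ≠ ⊤)
    (h : ∀ δ : ℝ, 0 < δ → X ≤ Y + ENNReal.ofReal δ * c) : X ≤ Y := by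
  have hlim : Tendsto (fun δ : ℝ => Y + ENNReal.ofReal δ * c) (𝓝[>] 0) (𝓝 (Y + 0 * c)) := by
    refine Tendsto.const_add _ (ENNReal.Tendsto.mul_const ?_ (Or.inr hc))
    rw [← ENNReal.ofReal_zero]
    exact (ENNReal.continuous_ofReal.tendsto 0).mono_left nhdsWithin_le_nhds
  rw [zero_mul, add_zero] at hlim
  exact ge_of_tendsto hlim (eventually_mem_nhdsWithin.mono fun δ hδ => h δ hδ)

variable {d : ℕ} {ν : Measure ℝ} [SFinite ν] {κ T A : ℝ}
  {θ f B : ℝ → EuclideanSpace ℝ (Fin d) → ℝ}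
  {v : ℝ → EuclideanSpace ℝ (Fin d) → EuclideanSpace ℝ (Fin d)}

/-- The integrated weighted `L^q` energy inequality for a weight `G`, with error weight `H`. -/
def PowerEnergyBound {Ω : Type*} [MeasureSpace Ω] (T q : ℝ) (θ f : ℝ → Ω → ℝ) (G H : Ω → ℝ≥0∞) :
    Prop :=
  ∀ a b, 0 ≤ a → a ≤ b → b ≤ T →
    ∫⁻ x, ‖θ b x‖ₑ ^ q * G x ≤ (∫⁻ x, ‖θ a x‖ₑ ^ q * G x) +
      (∫⁻ s in Ioc a b, ∫⁻ x, ENNReal.ofReal q * (‖f s x‖ₑ * ‖θ s x‖ₑ ^ (q - 1)) * G x) +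
      ∫⁻ s in Ioc a b, ∫⁻ x, ‖θ s x‖ₑ ^ q * H x

theorem ofReal_abs_rpow (a : ℝ) {q : ℝ} (hq : 0 ≤ q) : ENNReal.ofReal (|a| ^ q) = ‖a‖ₑ ^ q := by
  rw [← ENNReal.ofReal_rpow_of_nonneg (abs_nonneg a) hq, ← Real.enorm_eq_ofReal_abs]

theorem IsTransportSolution.powerEnergyBound_of_one_lt
    (H : IsTransportSolution ν κ T A θ f B v) (hκ : 0 ≤ κ)
    (hpos : ∀ᵐ s ∂ν, 0 < s) (hmin : Integrable (fun s => min 1 s) ν) {q : ℝ} (hq : 1 < q)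
    {σ : ℝ} (hσ : 0 < σ) :
    PowerEnergyBound T q θ f (fun x => ENNReal.ofReal (gaussWeight σ x))
      (fun x => ENNReal.ofReal (gaussFlux ν κ A σ x)) := by
  intro a b ha hab hb
  have h := H.energy hκ hpos hmin (fun a => hasDerivAt_abs_rpow a hq) (continuous_abs_rpow_mul hq)
    (fun a => by positivity) (abs_rpow_tangent hq) hσ ha hab hb
  simp_rw [abs_rpow_mul hq] at h
  have e1 : ∀ (w c : ℝ), ENNReal.ofReal (|w| ^ q * c) = ‖w‖ₑ ^ q * ENNReal.ofReal c := fun w c => by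
    rw [ENNReal.ofReal_mul (by positivity), ofReal_abs_rpow w (by positivity)]
  have e2 : ∀ (w u c : ℝ), ENNReal.ofReal (q * |w| ^ (q - 1) * |u| * c) =
      ENNReal.ofReal q * (‖u‖ₑ * ‖w‖ₑ ^ (q - 1)) * ENNReal.ofReal c := fun w u c => by
    rw [ENNReal.ofReal_mul (by positivity), ENNReal.ofReal_mul (by positivity),
      ENNReal.ofReal_mul (by positivity), ofReal_abs_rpow w (by linarith),
      ← Real.enorm_eq_ofReal_abs]
    ring
  simp_rw [e1, e2] at h
  exact h

/-- As `|·|` is not differentiable at `0`, it is replaced by `√(a ^ 2 + δ ^ 2)`, whose derivative is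
bounded by `1` and which exceeds `|a|` by at most `δ`. The weight and its flux have finite mass, so
the error vanishes as `δ → 0`. -/
theorem IsTransportSolution.powerEnergyBound_one
    (H : IsTransportSolution ν κ T A θ f B v) (hκ : 0 ≤ κ)
    (hpos : ∀ᵐ s ∂ν, 0 < s) (hmin : Integrable (fun s => min 1 s) ν)
    {σ : ℝ} (hσ : 0 < σ) :
    PowerEnergyBound T 1 θ f (fun x => ENNReal.ofReal (gaussWeight σ x))
      (fun x => ENNReal.ofReal (gaussFlux ν κ A σ x)) := by
  intro a b ha hab hb
  have hA := H.A_nonneg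
  simp only [ENNReal.rpow_one, ENNReal.ofReal_one, one_mul, sub_self, ENNReal.rpow_zero, mul_one]
  have hgm : Measurable fun x : EuclideanSpace ℝ (Fin d) => ENNReal.ofReal (gaussWeight σ x) :=
    (continuous_gaussWeight σ).measurable.ennreal_ofReal
  have hFm : Measurable fun x : EuclideanSpace ℝ (Fin d) => ENNReal.ofReal (gaussFlux ν κ A σ x) :=
    (continuous_gaussFlux hpos hmin κ A hσ).measurable.ennreal_ofReal
  set c₁ := ∫⁻ x : EuclideanSpace ℝ (Fin d), ENNReal.ofReal (gaussWeight σ x) with hc₁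
  set c₂ := ∫⁻ x : EuclideanSpace ℝ (Fin d), ENNReal.ofReal (gaussFlux ν κ A σ x) with hc₂
  have hc₁t : c₁ ≠ ⊤ := (integrable_gaussWeight hσ).lintegral_lt_top.ne
  have hc₂t : c₂ ≠ ⊤ := (integrable_gaussFlux hpos hmin κ A hσ).lintegral_lt_top.ne
  have hmeas : ∀ s, Measurable fun x => ‖θ s x‖ₑ := fun s =>
    (H.contDiff_theta s).continuous.measurable.enorm
  refine ENNReal.le_of_forall_pos_le_add_ofReal_mul
    (c := c₁ + c₂ * volume (Ioc a b)) ?_ fun δ hδ => ?_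
  · exact ENNReal.add_ne_top.2 ⟨hc₁t, ENNReal.mul_ne_top hc₂t (by simp)⟩
  have h := H.energy hκ hpos hmin (hasDerivAt_sqrt_sq_add hδ)
    (by
      refine continuous_id.div (by fun_prop) fun a => (Real.sqrt_pos.2 (by positivity)).ne')
    (fun a => Real.sqrt_nonneg _) (sqrt_sq_add_tangent hδ) hσ ha hab hb
  have hup : ∀ w c : ℝ, ENNReal.ofReal (Real.sqrt (w ^ 2 + δ ^ 2) * c) ≤
      ‖w‖ₑ * ENNReal.ofReal c + ENNReal.ofReal δ * ENNReal.ofReal c := fun w c => by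
    rw [ENNReal.ofReal_mul (Real.sqrt_nonneg _), ← add_mul, Real.enorm_eq_ofReal_abs,
      ← ENNReal.ofReal_add (abs_nonneg _) hδ.le]
    gcongr
    exact sqrt_sq_add_le hδ w
  have b1 : ∫⁻ x, ‖θ b x‖ₑ * ENNReal.ofReal (gaussWeight σ x) ≤
      ∫⁻ x, ENNReal.ofReal (Real.sqrt (θ b x ^ 2 + δ ^ 2) * gaussWeight σ x) := by
    refine lintegral_mono fun x => ?_
    rw [ENNReal.ofReal_mul (Real.sqrt_nonneg _), Real.enorm_eq_ofReal_abs]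
    gcongr
    exact abs_le_sqrt_sq_add _ _
  have b2 : ∫⁻ x, ENNReal.ofReal (Real.sqrt (θ a x ^ 2 + δ ^ 2) * gaussWeight σ x) ≤
      (∫⁻ x, ‖θ a x‖ₑ * ENNReal.ofReal (gaussWeight σ x)) + ENNReal.ofReal δ * c₁ := by
    refine (lintegral_mono fun x => hup _ _).trans_eq ?_
    rw [lintegral_add_right _ (hgm.const_mul _), lintegral_const_mul _ hgm]
  have b3 : ∫⁻ s in Ioc a b, ∫⁻ x, ENNReal.ofReal
        (|θ s x / Real.sqrt (θ s x ^ 2 + δ ^ 2)| * |f s x| * gaussWeight σ x) ≤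
      ∫⁻ s in Ioc a b, ∫⁻ x, ‖f s x‖ₑ * ENNReal.ofReal (gaussWeight σ x) := by
    refine lintegral_mono fun s => lintegral_mono fun x => ?_
    rw [Real.enorm_eq_ofReal_abs, ← ENNReal.ofReal_mul (abs_nonneg _)]
    refine ENNReal.ofReal_le_ofReal (mul_le_mul_of_nonneg_right
      (mul_le_of_le_one_left (abs_nonneg _) ?_) (gaussWeight_pos σ x).le)
    rw [abs_div, abs_of_nonneg (Real.sqrt_nonneg _)]
    exact div_le_one_of_le₀ (abs_le_sqrt_sq_add _ _) (Real.sqrt_nonneg _)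
  have b4 : ∫⁻ s in Ioc a b, ∫⁻ x, ENNReal.ofReal
        (Real.sqrt (θ s x ^ 2 + δ ^ 2) * gaussFlux ν κ A σ x) ≤
      (∫⁻ s in Ioc a b, ∫⁻ x, ‖θ s x‖ₑ * ENNReal.ofReal (gaussFlux ν κ A σ x)) +
        ENNReal.ofReal δ * (c₂ * volume (Ioc a b)) := by
    calc _ ≤ ∫⁻ s in Ioc a b, ((∫⁻ x, ‖θ s x‖ₑ * ENNReal.ofReal (gaussFlux ν κ A σ x)) +
            ENNReal.ofReal δ * c₂) := by
          refine lintegral_mono fun s => (lintegral_mono fun x => hup _ _).trans_eq ?_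
          rw [lintegral_add_right _ (hFm.const_mul _), lintegral_const_mul _ hFm]
      _ = _ := by
          rw [lintegral_add_right _ measurable_const, lintegral_const, Measure.restrict_apply_univ]
          ring
  calc _ ≤ _ := b1.trans h
    _ ≤ _ := add_le_add (add_le_add b2 b3) b4
    _ = _ := by ring

theorem IsTransportSolution.powerEnergyBound
    (H : IsTransportSolution ν κ T A θ f B v) (hκ : 0 ≤ κ)
    (hpos : ∀ᵐ s ∂ν, 0 < s) (hmin : Integrable (fun s => min 1 s) ν) {q : ℝ} (hq : 1 ≤ q)
    {σ : ℝ} (hσ : 0 < σ) :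
    PowerEnergyBound T q θ f (fun x => ENNReal.ofReal (gaussWeight σ x))
      (fun x => ENNReal.ofReal (gaussFlux ν κ A σ x)) := by
  rcases hq.eq_or_lt with rfl | hq
  · exact H.powerEnergyBound_one hκ hpos hmin hσ
  · exact H.powerEnergyBound_of_one_lt hκ hpos hmin hq hσ

end PowerEnergy

/-! ### Superposition of weights. -/

section WeightSum

open Filter Topology

theorem lintegral_mul_tsum {Ω : Type*} [MeasurableSpace Ω] {μ : Measure Ω} {w : Ω → ℝ≥0∞}
    {G : ℕ → Ω → ℝ≥0∞} (c : ℕ → ℝ≥0∞) (hw : Measurable w) (hG : ∀ k, Measurable (G k)) :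
    ∫⁻ x, w x * ∑' k, c k * G k x ∂μ = ∑' k, c k * ∫⁻ x, w x * G k x ∂μ := by
  simp_rw [← ENNReal.tsum_mul_left]
  rw [lintegral_tsum (f := fun k x => w x * (c k * G k x))
    fun k => (hw.mul ((hG k).const_mul _)).aemeasurable]
  congr 1; ext k
  rw [← lintegral_const_mul (f := fun x => w x * G k x) _ (hw.mul (hG k))]
  congr 1; ext x
  ring

/-- The inequality is linear in the pair (weight, error weight). All terms live in `ℝ≥0∞`, so it may
be summed without any convergence condition. -/
theorem PowerEnergyBound.tsum {Ω : Type*} [MeasureSpace Ω] [SFinite (volume : Measure Ω)]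
    {T q : ℝ} {θ f : ℝ → Ω → ℝ} {G H : ℕ → Ω → ℝ≥0∞} (c : ℕ → ℝ≥0∞)
    (hG : ∀ k, Measurable (G k)) (hH : ∀ k, Measurable (H k))
    (hθ : Measurable (Function.uncurry θ)) (hf : Measurable (Function.uncurry f))
    (h : ∀ k, PowerEnergyBound T q θ f (G k) (H k)) :
    PowerEnergyBound T q θ f (fun x => ∑' k, c k * G k x) (fun x => ∑' k, c k * H k x) := by
  intro a b ha hab hb
  have hθq : Measurable fun p : ℝ × Ω => ‖θ p.1 p.2‖ₑ ^ q := hθ.enorm.pow_const q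
  have hfq : Measurable fun p : ℝ × Ω =>
      ENNReal.ofReal q * (‖f p.1 p.2‖ₑ * ‖θ p.1 p.2‖ₑ ^ (q - 1)) :=
    (hf.enorm.mul (hθ.enorm.pow_const (q - 1))).const_mul _
  have hθs : ∀ s, Measurable fun x => ‖θ s x‖ₑ ^ q := fun s => hθq.comp measurable_prodMk_left
  have hfs : ∀ s, Measurable fun x => ENNReal.ofReal q * (‖f s x‖ₑ * ‖θ s x‖ₑ ^ (q - 1)) :=
    fun s => hfq.comp measurable_prodMk_left
  have hGs : ∀ k, Measurable fun s => ∫⁻ x, ENNReal.ofReal q *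
      (‖f s x‖ₑ * ‖θ s x‖ₑ ^ (q - 1)) * G k x := fun k =>
    (hfq.mul ((hG k).comp measurable_snd)).lintegral_prod_right'
  have hHs : ∀ k, Measurable fun s => ∫⁻ x, ‖θ s x‖ₑ ^ q * H k x := fun k =>
    (hθq.mul ((hH k).comp measurable_snd)).lintegral_prod_right'
  rw [lintegral_mul_tsum c (hθs b) hG, lintegral_mul_tsum c (hθs a) hG]
  simp_rw [fun s => lintegral_mul_tsum c (hfs s) hG (μ := volume),
    fun s => lintegral_mul_tsum c (hθs s) hH (μ := volume)]
  rw [lintegral_tsum fun k => ((hGs k).const_mul _).aemeasurable,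
    lintegral_tsum fun k => ((hHs k).const_mul _).aemeasurable,
    ← ENNReal.tsum_add, ← ENNReal.tsum_add]
  refine ENNReal.tsum_le_tsum fun k => ?_
  rw [lintegral_const_mul _ (hGs k), lintegral_const_mul _ (hHs k), ← mul_add, ← mul_add]
  exact mul_le_mul_right (h k a b ha hab hb) _

theorem PowerEnergyBound.mono {Ω : Type*} [MeasureSpace Ω] {T q : ℝ} {θ f : ℝ → Ω → ℝ}
    {G H H' : Ω → ℝ≥0∞} (h : PowerEnergyBound T q θ f G H) (hH : ∀ x, H x ≤ H' x) :
    PowerEnergyBound T q θ f G H' := fun a b ha hab hb =>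
  (h a b ha hab hb).trans (by gcongr with s x; exact hH _)

end WeightSum

/-! ### A weight that dominates its own flux. -/

section DyadicWeight

open Filter Topology Module

set_option linter.unusedSectionVars false

variable (V : Type*) [NormedAddCommGroup V] [InnerProductSpace ℝ V] [FiniteDimensional ℝ V]
  [MeasurableSpace V] [BorelSpace V]

/-- The ratio of the coefficients in `dyadicWeight`. -/
noncomputable def dyadicRatio (b : ℝ) : ℝ := (4 : ℝ) ^ (-(b + (finrank ℝ V / 2 : ℝ)))

variable {V}

/-- A superposition of Gaussians with polynomial decay, controlled by the scale `4 ^ j`. -/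
noncomputable def dyadicWeight (b : ℝ) (j : ℕ) (x : V) : ℝ≥0∞ :=
  ∑' k : ℕ, ENNReal.ofReal (dyadicRatio V b ^ k) * ENNReal.ofReal (gaussWeight (4 ^ (k + j)) x)

variable {b : ℝ}

theorem dyadicRatio_pos : 0 < dyadicRatio V b := by unfold dyadicRatio; positivity

theorem dyadicRatio_pow (k : ℕ) :
    dyadicRatio V b ^ k = ((4 : ℝ) ^ k) ^ (-(b + (finrank ℝ V / 2 : ℝ))) := by
  rw [dyadicRatio, ← Real.rpow_natCast, ← Real.rpow_natCast, ← Real.rpow_mul (by norm_num),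
    ← Real.rpow_mul (by norm_num), mul_comm]

theorem dyadicRatio_lt_one (hb : 0 < b) : dyadicRatio V b < 1 :=
  Real.rpow_lt_one_of_one_lt_of_neg (by norm_num) (by
    have : (0 : ℝ) ≤ finrank ℝ V / 2 := by positivity
    linarith)

theorem measurable_dyadicWeight (j : ℕ) : Measurable (dyadicWeight b j : V → ℝ≥0∞) :=
  Measurable.tsum fun _ =>
    (continuous_gaussWeight _).measurable.ennreal_ofReal.const_mul _

theorem le_dyadicWeight (j i : ℕ) (x : V) :
    ENNReal.ofReal (dyadicRatio V b ^ i * gaussWeight (4 ^ (i + j)) x) ≤ dyadicWeight b j x := by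
  rw [ENNReal.ofReal_mul (pow_nonneg dyadicRatio_pos.le _)]
  exact ENNReal.le_tsum (f := fun k : ℕ => ENNReal.ofReal (dyadicRatio V b ^ k) *
    ENNReal.ofReal (gaussWeight (4 ^ (k + j)) x)) i

theorem dyadicWeight_pos (j : ℕ) (x : V) : 0 < dyadicWeight b j x :=
  (ENNReal.ofReal_pos.2 (mul_pos (pow_pos dyadicRatio_pos 0) (gaussWeight_pos _ x))).trans_le
    (le_dyadicWeight j 0 x)

theorem tsum_ofReal_pow_ne_top {r : ℝ} (h0 : 0 ≤ r) (h1 : r < 1) :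
    ∑' k : ℕ, ENNReal.ofReal (r ^ k) ≠ ⊤ := by
  rw [← ENNReal.ofReal_tsum_of_nonneg (fun k => pow_nonneg h0 k)
    (summable_geometric_of_lt_one h0 h1)]
  exact ENNReal.ofReal_ne_top

theorem dyadicWeight_le (j : ℕ) (x : V) :
    dyadicWeight b j x ≤ ∑' k : ℕ, ENNReal.ofReal (dyadicRatio V b ^ k) := by
  refine ENNReal.tsum_le_tsum fun k => mul_le_of_le_one_right (zero_le) ?_
  rw [← ENNReal.ofReal_one]
  exact ENNReal.ofReal_le_ofReal (gaussWeight_le_one (by positivity) x)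

theorem lintegral_gaussWeight {σ : ℝ} (hσ : 0 < σ) :
    ∫⁻ x : V, ENNReal.ofReal (gaussWeight σ x) =
      ENNReal.ofReal ((4 * Real.pi * σ) ^ (finrank ℝ V / 2 : ℝ)) := by
  rw [← ofReal_integral_eq_lintegral_ofReal (integrable_gaussWeight hσ)
    (Eventually.of_forall fun x => (gaussWeight_pos σ x).le)]
  have h := GaussianFourier.integral_rexp_neg_mul_sq_norm (V := V) (b := 1 / (4 * σ))
    (by positivity)
  congr 1
  rw [show 4 * Real.pi * σ = Real.pi / (1 / (4 * σ)) by field_simp, ← h]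
  congr 1; ext x
  rw [gaussWeight]; congr 1; ring

/-- In dimension `n`, the mass of the `k`-th Gaussian grows like `4 ^ (k n / 2)`, while its
coefficient is `4 ^ (-k (b + n / 2))`; a geometric series of ratio `4 ^ (-b)` remains. -/
theorem lintegral_dyadicWeight_ne_top (hb : 0 < b) (j : ℕ) :
    ∫⁻ x : V, dyadicWeight b j x ≠ ⊤ := by
  unfold dyadicWeight
  rw [lintegral_tsum fun k => ((continuous_gaussWeight _).measurable.ennreal_ofReal.const_mul
    _).aemeasurable]
  have hr : (4 : ℝ) ^ (-b) < 1 := Real.rpow_lt_one_of_one_lt_of_neg (by norm_num) (by linarith)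
  have key : ∀ k : ℕ, ∫⁻ x : V, ENNReal.ofReal (dyadicRatio V b ^ k) *
      ENNReal.ofReal (gaussWeight (4 ^ (k + j)) x) =
      ENNReal.ofReal ((4 * Real.pi * 4 ^ j) ^ (finrank ℝ V / 2 : ℝ)) *
        ENNReal.ofReal (((4 : ℝ) ^ (-b)) ^ k) := fun k => by
    rw [lintegral_const_mul _ (continuous_gaussWeight _).measurable.ennreal_ofReal,
      lintegral_gaussWeight (by positivity), ← ENNReal.ofReal_mul (by
        have := dyadicRatio_pos (V := V) (b := b); positivity), ← ENNReal.ofReal_mul (by positivity)]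
    congr 1
    rw [dyadicRatio_pow, show 4 * Real.pi * 4 ^ (k + j) = 4 ^ k * (4 * Real.pi * 4 ^ j) by ring,
      Real.mul_rpow (by positivity) (by positivity), ← mul_assoc, ← Real.rpow_add (by positivity),
      mul_comm]
    congr 1
    rw [← Real.rpow_natCast, ← Real.rpow_natCast, ← Real.rpow_mul (by norm_num),
      ← Real.rpow_mul (by norm_num)]
    congr 1; ring
  simp_rw [key]
  rw [ENNReal.tsum_mul_left]
  exact ENNReal.mul_ne_top ENNReal.ofReal_ne_top (tsum_ofReal_pow_ne_top (by positivity) hr)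

/-- Quadrupling the width of every Gaussian only shifts the index by one; this absorbs the widening
in the flux estimates. -/
theorem tsum_gaussWeight_four_mul_le (j : ℕ) (x : V) :
    ∑' k : ℕ, ENNReal.ofReal (dyadicRatio V b ^ (k + 1)) *
      ENNReal.ofReal (gaussWeight (4 ^ (k + 1 + j)) x) ≤ dyadicWeight b j x :=
  ENNReal.tsum_comp_le_tsum_of_injective (add_left_injective 1)
    (fun k : ℕ => ENNReal.ofReal (dyadicRatio V b ^ k) *
      ENNReal.ofReal (gaussWeight (4 ^ (k + j)) x))

/-- Let `σ = 4 ^ (k + j)`. If `s ≤ σ`, the gain is at most `4 s / σ` times the next Gaussian, and `s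
/ σ ≤ min s (s ^ b)`. If `s > σ`, the heat flow of the `k`-th Gaussian is at most `(σ / s) ^ e`
times a Gaussian of width comparable to `s`, where `e` is half the dimension. That Gaussian occurs
in the weight with a coefficient that loses a power `b + e` of the scale, so the cost is a multiple
of `s ^ b (4 ^ (-b)) ^ k`, which is summable in `k`. No constant depends on `j`. -/
theorem ofReal_gaussGain_le (hb : 0 < b) (hb1 : b ≤ 1) {s : ℝ} (hs : 0 < s) (j k : ℕ) (x : V) :
    ENNReal.ofReal (dyadicRatio V b ^ k) * ENNReal.ofReal (gaussGain (4 ^ (k + j)) s x) ≤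
      ENNReal.ofReal ((4 / dyadicRatio V b + 8 ^ (b + (finrank ℝ V / 2 : ℝ))) * min s (s ^ b)) *
      (ENNReal.ofReal (dyadicRatio V b ^ (k + 1)) *
        ENNReal.ofReal (gaussWeight (4 ^ (k + 1 + j)) x) +
        ENNReal.ofReal (((4 : ℝ) ^ (-b)) ^ k) * dyadicWeight b j x) := by
  have ha := dyadicRatio_pos (V := V) (b := b)
  have hm0 : 0 < min s (s ^ b) := by positivity
  set a := dyadicRatio V b with ha_def
  set e : ℝ := finrank ℝ V / 2 with he
  have he0 : 0 ≤ e := by positivity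
  have hP : 0 < (8 : ℝ) ^ (b + e) := by positivity
  have h1σ : (1 : ℝ) ≤ 4 ^ (k + j) := one_le_pow₀ (by norm_num)
  rcases le_or_gt s (4 ^ (k + j)) with h | h
  · have hmin : s / 4 ^ (k + j) ≤ min s (s ^ b) := by
      refine le_min (div_le_self hs.le h1σ) ?_
      rcases le_total s 1 with h1 | h1
      · exact (div_le_self hs.le h1σ).trans (Real.self_le_rpow_of_le_one hs.le h1 hb1)
      · exact ((div_le_one (by positivity)).2 h).trans (Real.one_le_rpow h1 hb.le)
    have hg := gaussWeight_pos (4 ^ (k + 1 + j)) x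
    have h2 := gaussGain_le_of_le (by positivity) hs.le h x
    rw [show (4 : ℝ) * 4 ^ (k + j) = 4 ^ (k + 1 + j) by ring] at h2
    refine le_trans ?_ (mul_le_mul_right le_self_add _)
    rw [← ENNReal.ofReal_mul (by positivity), ← ENNReal.ofReal_mul (by positivity),
      ← ENNReal.ofReal_mul (by positivity)]
    refine ENNReal.ofReal_le_ofReal ?_
    calc a ^ k * gaussGain (4 ^ (k + j)) s x
        ≤ a ^ k * (4 * min s (s ^ b) * gaussWeight (4 ^ (k + 1 + j)) x) := by
          refine mul_le_mul_of_nonneg_left (h2.trans ?_) (by positivity)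
          gcongr
      _ = 4 / a * min s (s ^ b) * (a ^ (k + 1) * gaussWeight (4 ^ (k + 1 + j)) x) := by
          rw [pow_succ]; field_simp
      _ ≤ _ := by gcongr; linarith
  · have hs1 : 1 < s := h1σ.trans_lt h
    have hmin : min s (s ^ b) = s ^ b :=
      min_eq_right ((Real.rpow_le_rpow_of_exponent_le hs1.le hb1).trans_eq (Real.rpow_one s))
    -- The scale `4 ^ (n + 1)` lies in `[2 s, 8 s]`: it dominates the width `4 ^ (k + j) + s` after
    -- the heat flow, and it costs only the factor `8 ^ (b + e)`.
    obtain ⟨n, hn1, hn2⟩ := exists_nat_pow_near (x := 2 * s) (y := (4 : ℝ)) (by linarith) (by norm_num)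
    have hjn : j ≤ n + 1 := by
      by_contra hlt
      have h3 : (4 : ℝ) ^ (n + 1) ≤ 4 ^ (k + j) := pow_le_pow_right₀ (by norm_num) (by omega)
      linarith
    obtain ⟨i, hi⟩ : ∃ i, n + 1 = i + j := ⟨n + 1 - j, by omega⟩
    have hN1 : 2 * s ≤ 4 ^ (i + j) := by rw [← hi]; exact hn2.le
    have hN2 : (4 : ℝ) ^ (i + j) ≤ 8 * s := by rw [← hi, pow_succ]; linarith
    have hg := gaussWeight_pos (4 ^ (i + j)) x
    have h3 : gaussGain (4 ^ (k + j)) s x ≤ (4 ^ (k + j) / s) ^ e * gaussWeight (4 ^ (i + j)) x := by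
      refine (gaussGain_le_heatMean _ _ _).trans ?_
      rw [heatMean_gaussWeight (by positivity) hs.le]
      have hgm := gaussWeight_mono (V := V) (σ := 4 ^ (k + j) + s) (τ := 4 ^ (i + j))
        (by positivity) (by linarith) x
      have := gaussWeight_pos (4 ^ (k + j) + s) x
      gcongr
      linarith [show (0 : ℝ) ≤ 4 ^ (k + j) by positivity]
    have hX : (0 : ℝ) < 4 ^ k := by positivity
    have hY : (1 : ℝ) ≤ 4 ^ j := one_le_pow₀ (by norm_num)
    have hZ : (0 : ℝ) < 4 ^ i := by positivity
    have h4 : a ^ k * (4 ^ (k + j) / s) ^ e ≤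
        8 ^ (b + e) * s ^ b * ((4 ^ (-b)) ^ k * a ^ i) := by
      have e1 : ((4 : ℝ) ^ (-b)) ^ k = ((4 : ℝ) ^ k) ^ (-b) := by
        rw [← Real.rpow_natCast, ← Real.rpow_natCast, ← Real.rpow_mul (by norm_num),
          ← Real.rpow_mul (by norm_num), mul_comm]
      have e2 : a ^ i * ((4 : ℝ) ^ i) ^ (b + e) = 1 := by
        rw [ha_def, dyadicRatio_pow, ← Real.rpow_add hZ]; simp [he]
      have e3 : a ^ k * ((4 : ℝ) ^ k) ^ e = ((4 : ℝ) ^ k) ^ (-b) := by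
        rw [ha_def, dyadicRatio_pow, ← Real.rpow_add hX]; congr 1; simp [he]
      have e4 : ((4 : ℝ) ^ j) ^ e ≤ a ^ i * (8 ^ (b + e) * s ^ b * s ^ e) := by
        calc ((4 : ℝ) ^ j) ^ e ≤ ((4 : ℝ) ^ j) ^ (b + e) :=
              Real.rpow_le_rpow_of_exponent_le hY (by linarith)
          _ = a ^ i * (((4 : ℝ) ^ i) ^ (b + e) * ((4 : ℝ) ^ j) ^ (b + e)) := by
              rw [← mul_assoc, e2, one_mul]
          _ = a ^ i * ((4 : ℝ) ^ (i + j)) ^ (b + e) := by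
              rw [pow_add, Real.mul_rpow (by positivity) (by positivity)]
          _ ≤ a ^ i * (8 * s) ^ (b + e) := by gcongr
          _ = _ := by rw [Real.mul_rpow (by norm_num) hs.le, Real.rpow_add hs, mul_assoc]
      rw [e1, Real.div_rpow (by positivity) hs.le, pow_add,
        Real.mul_rpow (by positivity) (by positivity), ← e3, mul_div_assoc', div_le_iff₀ (by positivity)]
      calc _ = a ^ k * ((4 : ℝ) ^ k) ^ e * ((4 : ℝ) ^ j) ^ e := by ring
        _ ≤ a ^ k * ((4 : ℝ) ^ k) ^ e * (a ^ i * (8 ^ (b + e) * s ^ b * s ^ e)) := by gcongr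
        _ = _ := by ring
    refine le_trans ?_ (mul_le_mul_right le_add_self _)
    refine le_trans ?_ (mul_le_mul_right (mul_le_mul_right (le_dyadicWeight j i x) _) _)
    rw [← ENNReal.ofReal_mul (by positivity), ← ENNReal.ofReal_mul (by positivity),
      ← ENNReal.ofReal_mul (by positivity), hmin]
    refine ENNReal.ofReal_le_ofReal ?_
    calc a ^ k * gaussGain (4 ^ (k + j)) s x
        ≤ a ^ k * ((4 ^ (k + j) / s) ^ e * gaussWeight (4 ^ (i + j)) x) := by gcongr
      _ = a ^ k * (4 ^ (k + j) / s) ^ e * gaussWeight (4 ^ (i + j)) x := by ring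
      _ ≤ 8 ^ (b + e) * s ^ b * ((4 ^ (-b)) ^ k * a ^ i) * gaussWeight (4 ^ (i + j)) x := by gcongr
      _ = 8 ^ (b + e) * s ^ b * ((4 ^ (-b)) ^ k * (a ^ i * gaussWeight (4 ^ (i + j)) x)) := by ring
      _ ≤ _ := by
          gcongr
          have : 0 < 4 / a := by positivity
          linarith

variable (V) in
-- The drift part of the flux is controlled by a shift of the index, the nonlocal part by
-- integrating `ofReal_gaussGain_le` against `ν`, whose fractional moment is finite. Uniformity in
-- `j` is what later allows the weight to be spread out to infinity.
theorem exists_tsum_gaussFlux_le {ν : Measure ℝ} [SFinite ν] {κ A : ℝ} (hκ : 0 ≤ κ) (hA : 0 ≤ A)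
    (hb : 0 < b) (hb1 : b ≤ 1) (hpos : ∀ᵐ s ∂ν, 0 < s) (hmin : Integrable (fun s => min 1 s) ν)
    (hfin : ∫⁻ s, ENNReal.ofReal (min s (s ^ b)) ∂ν < ⊤) :
    ∃ C : ℝ≥0∞, C ≠ ⊤ ∧ ∀ (j : ℕ) (x : V),
      ∑' k : ℕ, ENNReal.ofReal (dyadicRatio V b ^ k) *
        ENNReal.ofReal (gaussFlux ν κ A (4 ^ (k + j)) x) ≤ C * dyadicWeight b j x := by
  have ha := dyadicRatio_pos (V := V) (b := b)
  set a := dyadicRatio V b with ha_def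
  set c₀ : ℝ := 4 / a + 8 ^ (b + (finrank ℝ V / 2 : ℝ)) with hc₀
  set R := ∑' k : ℕ, ENNReal.ofReal (((4 : ℝ) ^ (-b)) ^ k) with hR
  have hRt : R ≠ ⊤ := tsum_ofReal_pow_ne_top (by positivity)
    (Real.rpow_lt_one_of_one_lt_of_neg (by norm_num) (by linarith))
  have hc₀0 : 0 ≤ c₀ := by positivity
  set I := ∫⁻ s, ENNReal.ofReal (min s (s ^ b)) ∂ν with hI
  have hgain : ∀ s, 0 < s → ∀ (j : ℕ) (x : V), ∑' k : ℕ, ENNReal.ofReal (a ^ k) *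
      ENNReal.ofReal (gaussGain (4 ^ (k + j)) s x) ≤
      ENNReal.ofReal (min s (s ^ b)) * (ENNReal.ofReal c₀ * ((1 + R) * dyadicWeight b j x)) :=
    fun s hs j x => by
      refine (ENNReal.tsum_le_tsum fun k => ofReal_gaussGain_le hb hb1 hs j k x).trans ?_
      rw [ENNReal.tsum_mul_left, ENNReal.tsum_add, ENNReal.tsum_mul_right, ENNReal.ofReal_mul hc₀0,
        mul_comm (ENNReal.ofReal c₀), mul_assoc, one_add_mul]
      gcongr
      exact tsum_gaussWeight_four_mul_le j x
  have hexc : ∀ (j : ℕ) (x : V), ∑' k : ℕ, ENNReal.ofReal (a ^ k) *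
      ENNReal.ofReal (gaussExcess ν (4 ^ (k + j)) x) ≤
      I * (ENNReal.ofReal c₀ * ((1 + R) * dyadicWeight b j x)) := fun j x => by
    have hcont : ∀ k : ℕ, Continuous fun s => gaussGain (4 ^ (k + j)) s x := fun k => by
      have h := (continuous_gaussGain (V := V) (σ := 4 ^ (k + j)) (by positivity)).comp
        (by fun_prop : Continuous fun s : ℝ => (x, s))
      exact h
    have h1 : ∀ k : ℕ, ENNReal.ofReal (a ^ k) * ENNReal.ofReal (gaussExcess ν (4 ^ (k + j)) x) =
        ∫⁻ s, ENNReal.ofReal (a ^ k) * ENNReal.ofReal (gaussGain (4 ^ (k + j)) s x) ∂ν := fun k => by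
      rw [lintegral_const_mul _ (hcont k).measurable.ennreal_ofReal, gaussExcess,
        ofReal_integral_eq_lintegral_ofReal _ (Eventually.of_forall fun s => gaussGain_nonneg _ _ _)]
      refine (hmin.const_mul (1 + 4 / 4 ^ (k + j))).mono' (hcont k).aestronglyMeasurable
        (hpos.mono fun s hs => ?_)
      rw [Real.norm_of_nonneg (gaussGain_nonneg _ _ _)]
      exact gaussGain_le_min (by positivity) hs.le x
    simp_rw [h1]
    rw [← lintegral_tsum fun k => ((hcont k).measurable.ennreal_ofReal.const_mul _).aemeasurable, hI,
      ← lintegral_mul_const _ (by fun_prop)]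
    exact lintegral_mono_ae (hpos.mono fun s hs => hgain s hs j x)
  refine ⟨ENNReal.ofReal (9 * A / a) + ENNReal.ofReal κ * (I * (ENNReal.ofReal c₀ * (1 + R))),
    ?_, fun j x => ?_⟩
  · exact ENNReal.add_ne_top.2 ⟨ENNReal.ofReal_ne_top, ENNReal.mul_ne_top ENNReal.ofReal_ne_top
      (ENNReal.mul_ne_top hfin.ne (ENNReal.mul_ne_top ENNReal.ofReal_ne_top
        (ENNReal.add_ne_top.2 ⟨ENNReal.one_ne_top, hRt⟩)))⟩
  · have hterm : ∀ k : ℕ, ENNReal.ofReal (a ^ k) *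
        ENNReal.ofReal (gaussFlux ν κ A (4 ^ (k + j)) x) ≤
        ENNReal.ofReal (9 * A / a) * (ENNReal.ofReal (a ^ (k + 1)) *
          ENNReal.ofReal (gaussWeight (4 ^ (k + 1 + j)) x)) +
        ENNReal.ofReal κ * (ENNReal.ofReal (a ^ k) *
          ENNReal.ofReal (gaussExcess ν (4 ^ (k + j)) x)) := fun k => by
      have h1σ : (1 : ℝ) ≤ 4 ^ (k + j) := one_le_pow₀ (by norm_num)
      have hg := gaussWeight_pos (4 ^ (k + 1 + j)) x
      have he := gaussExcess_nonneg ν (4 ^ (k + j)) x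
      rw [← ENNReal.ofReal_mul (by positivity), ← ENNReal.ofReal_mul (by positivity),
        ← ENNReal.ofReal_mul (by positivity), ← ENNReal.ofReal_mul (by positivity),
        ← ENNReal.ofReal_mul (by positivity), ← ENNReal.ofReal_add (by positivity) (by positivity)]
      refine ENNReal.ofReal_le_ofReal ?_
      have h1 := one_add_norm_mul_norm_gaussWeight_le (σ := 4 ^ (k + j)) (by positivity) x
      have h2 : (1 / (2 * 4 ^ (k + j)) + 8 : ℝ) ≤ 9 := by
        have : (1 : ℝ) / (2 * 4 ^ (k + j)) ≤ 1 := by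
          rw [div_le_one (by positivity)]; linarith
        linarith
      have h3 := gaussWeight_mono (V := V) (σ := 2 * 4 ^ (k + j)) (τ := 4 ^ (k + 1 + j))
        (by positivity) (by rw [show (4 : ℝ) ^ (k + 1 + j) = 4 * 4 ^ (k + j) by ring]; linarith) x
      have hg2 := gaussWeight_pos (2 * 4 ^ (k + j)) x
      rw [gaussFlux, mul_add]
      refine add_le_add ?_ (by linarith [mul_left_comm (a ^ k) κ (gaussExcess ν (4 ^ (k + j)) x)])
      calc _ ≤ a ^ k * (A * (9 * gaussWeight (4 ^ (k + 1 + j)) x)) := by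
            refine mul_le_mul_of_nonneg_left (mul_le_mul_of_nonneg_left (h1.trans ?_) hA)
              (by positivity)
            gcongr
        _ = _ := by rw [pow_succ]; field_simp
    refine (ENNReal.tsum_le_tsum hterm).trans ?_
    rw [ENNReal.tsum_add, ENNReal.tsum_mul_left, ENNReal.tsum_mul_left, add_mul]
    refine add_le_add (mul_le_mul_right (tsum_gaussWeight_four_mul_le j x) _) ?_
    refine (mul_le_mul_right (hexc j x) _).trans_eq (by ring)

end DyadicWeight

/-! ### Gronwall lemmas. -/

section Gronwall

open Filter Topology

/-- Bernoulli's inequality gives `y ^ q ≥ x ^ q + q x ^ (q - 1) (y - x)`. In the application `m`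
bounds the function on a short interval starting from the value `x`, so `m / x` is close to `1`. -/
theorem sub_le_of_rpow_sub_le {q x y m I : ℝ} (hq : 1 ≤ q) (hx : 0 < x) (hy : 0 < y)
    (h : y ^ q ≤ x ^ q + q * (I * m ^ (q - 1))) (hm : 0 < m) : y ≤ x + (m / x) ^ (q - 1) * I := by
  have h1 := one_add_mul_self_le_rpow_one_add (s := y / x - 1) (by
    have : 0 < y / x := by positivity
    linarith) hq
  rw [add_sub_cancel, Real.div_rpow hy.le hx.le, le_div_iff₀ (by positivity)] at h1
  have h2 : x ^ q = x ^ (q - 1) * x := by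
    rw [← Real.rpow_add_one hx.ne']; congr 1; ring
  have h3 : (1 + q * (y / x - 1)) * x ^ q = x ^ q + q * (x ^ (q - 1) * (y - x)) := by
    rw [h2]; field_simp
  rw [h3] at h1
  have h4 : x ^ (q - 1) * (y - x) ≤ I * m ^ (q - 1) :=
    le_of_mul_le_mul_left (by linarith) (by linarith : 0 < q)
  have h5 : 0 < x ^ (q - 1) := by positivity
  rw [Real.div_rpow hm.le hx.le, div_mul_eq_mul_div, ← sub_le_iff_le_add', le_div_iff₀ h5]
  linarith

/-- A nonlinear Gronwall lemma: the integrated form of `(z ^ q)' ≤ q K z ^ (q - 1)` implies the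
integrated form of `z' ≤ K`. -/
theorem le_add_lintegral_of_rpow_le {z : ℝ → ℝ} {K : ℝ → ℝ≥0∞} {q t : ℝ} (hq : 1 ≤ q)
    (ht : 0 ≤ t) (hz : ContinuousOn z (Icc 0 t)) (hpos : ∀ s ∈ Icc 0 t, 0 < z s)
    (h : ∀ a b, 0 ≤ a → a ≤ b → b ≤ t → ENNReal.ofReal (z b ^ q) ≤ ENNReal.ofReal (z a ^ q) +
      ENNReal.ofReal q * ∫⁻ s in Ioc a b, K s * ENNReal.ofReal (z s ^ (q - 1))) :
    ENNReal.ofReal (z t) ≤ ENNReal.ofReal (z 0) + ∫⁻ s in Ioc 0 t, K s := by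
  rcases eq_or_ne (∫⁻ s in Ioc 0 t, K s) ⊤ with htop | hfin
  · rw [htop]; simp
  have hIfin : ∀ a b, 0 ≤ a → b ≤ t → ∫⁻ s in Ioc a b, K s ≠ ⊤ := fun a b ha hb =>
    ((lintegral_mono_set (Ioc_subset_Ioc ha hb)).trans_lt hfin.lt_top).ne
  set J : ℝ → ℝ → ℝ := fun a b => (∫⁻ s in Ioc a b, K s).toReal with hJ
  have hJ0 : ∀ a b, 0 ≤ J a b := fun a b => ENNReal.toReal_nonneg
  have hJadd : ∀ b c, 0 ≤ b → b ≤ c → c ≤ t → J 0 c = J 0 b + J b c := fun b c hb hbc hc => by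
    simp only [hJ]
    rw [← Ioc_union_Ioc_eq_Ioc hb hbc, lintegral_union measurableSet_Ioc (Ioc_disjoint_Ioc_of_le le_rfl),
      ENNReal.toReal_add (hIfin _ _ le_rfl (hbc.trans hc)) (hIfin _ _ hb hc)]
  have hstep : ∀ a b m, 0 ≤ a → a ≤ b → b ≤ t → (∀ s ∈ Icc a b, z s ≤ m) →
      z b ≤ z a + (m / z a) ^ (q - 1) * J a b := fun a b m ha hab hb hm => by
    have hza := hpos a ⟨ha, hab.trans hb⟩
    have hzb := hpos b ⟨ha.trans hab, hb⟩
    have hm0 : 0 < m := hza.trans_le (hm a ⟨le_rfl, hab⟩)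
    refine sub_le_of_rpow_sub_le hq hza hzb ?_ hm0
    have h1 : ∫⁻ s in Ioc a b, K s * ENNReal.ofReal (z s ^ (q - 1)) ≤
        ENNReal.ofReal (J a b * m ^ (q - 1)) := by
      rw [ENNReal.ofReal_mul (hJ0 a b), hJ, ENNReal.ofReal_toReal (hIfin a b ha hb),
        ← lintegral_mul_const' _ _ ENNReal.ofReal_ne_top]
      refine setLIntegral_mono' measurableSet_Ioc fun s hs => ?_
      have := (hpos s ⟨ha.trans hs.1.le, hs.2.trans hb⟩).le
      have hmz := hm s ⟨hs.1.le, hs.2⟩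
      gcongr
    have h2 := (h a b ha hab hb).trans (add_le_add_right (mul_le_mul_right h1 _) _)
    rw [← ENNReal.ofReal_mul (by linarith), ← ENNReal.ofReal_add (by positivity)
      (mul_nonneg (by linarith) (mul_nonneg (hJ0 a b) (by positivity)))] at h2
    exact (ENNReal.ofReal_le_ofReal_iff (add_nonneg (by positivity)
      (mul_nonneg (by linarith) (mul_nonneg (hJ0 a b) (by positivity))))).1 h2
  obtain ⟨c, hc, hcz⟩ : ∃ c, 0 < c ∧ ∀ s ∈ Icc 0 t, c ≤ z s := by
    obtain ⟨s₀, hs₀, hmin⟩ := isCompact_Icc.exists_isMinOn (nonempty_Icc.2 ht) hz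
    exact ⟨z s₀, hpos s₀ hs₀, fun s hs => hmin hs⟩
  -- By uniform continuity, `[0, t]` splits into `N` intervals on which `z` rises by less than `ρ`
  -- above its initial value. The factor in `hstep` is then at most `(1 + ρ / c) ^ (q - 1) ≤ 1 + ε`,
  -- and the steps add up. No regularity of `K` is needed, as its integrals are only split over
  -- intervals.
  have hmain : ∀ ε, 0 < ε → z t ≤ z 0 + (1 + ε) * J 0 t := fun ε hε => by
    obtain ⟨ρ, hρ, hρε⟩ : ∃ ρ, 0 < ρ ∧ (1 + ρ / c) ^ (q - 1) ≤ 1 + ε := by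
      have hlim : Tendsto (fun ρ : ℝ => (1 + ρ / c) ^ (q - 1)) (𝓝[>] 0)
          (𝓝 ((1 + 0 / c) ^ (q - 1))) := by
        refine Tendsto.mono_left ?_ nhdsWithin_le_nhds
        have hcont : ContinuousAt (fun ρ : ℝ => (1 + ρ / c) ^ (q - 1)) 0 :=
          ContinuousAt.rpow_const (by fun_prop) (Or.inl (by simp))
        exact hcont
      have hlt : (1 + 0 / c) ^ (q - 1) < 1 + ε := by simpa using hε
      have hev := (hlim.eventually_le_const hlt).and self_mem_nhdsWithin
      obtain ⟨ρ, h1, h2⟩ := hev.exists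
      exact ⟨ρ, h2, h1⟩
    obtain ⟨δ, hδ, hδz⟩ := Metric.uniformContinuousOn_iff.1
      (isCompact_Icc.uniformContinuousOn_of_continuous hz) ρ hρ
    obtain ⟨N, hN⟩ := exists_nat_gt (t / δ)
    have hN0 : (0 : ℝ) < N := lt_of_le_of_lt (by positivity) hN
    have htN : t / N < δ := by
      rw [div_lt_iff₀ hN0]; rw [div_lt_iff₀ hδ] at hN; linarith
    have hind : ∀ i : ℕ, i ≤ N → z (i * (t / N)) ≤ z 0 + (1 + ε) * J 0 (i * (t / N)) := by
      intro i
      induction i with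
      | zero => intro _; simpa using mul_nonneg (by linarith) (hJ0 0 0)
      | succ i ih =>
        intro hi
        have hi' : ((i : ℝ) + 1) ≤ N := by exact_mod_cast hi
        have htN0 : 0 ≤ t / N := by positivity
        set a : ℝ := i * (t / N) with ha
        set b : ℝ := ((i + 1 : ℕ) : ℝ) * (t / N) with hb
        have hba : b = a + t / N := by rw [hb, ha]; push_cast; ring
        have ha0 : 0 ≤ a := by positivity
        have hbt : b ≤ t := by
          rw [hb]; push_cast
          calc ((i : ℝ) + 1) * (t / N) ≤ N * (t / N) := by gcongr
            _ = t := by field_simp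
        have hat : a ∈ Icc 0 t := ⟨ha0, by linarith⟩
        have h1 := hstep a b (z a + ρ) ha0 (by linarith) hbt fun s hs => by
          have hd := hδz s ⟨ha0.trans hs.1, hs.2.trans hbt⟩ a hat (by
            rw [Real.dist_eq, abs_of_nonneg (by linarith [hs.1])]; linarith [hs.2])
          rw [Real.dist_eq] at hd
          linarith [(abs_lt.1 hd).2]
        have hza := hpos a hat
        have h2 : ((z a + ρ) / z a) ^ (q - 1) ≤ 1 + ε := by
          refine le_trans (Real.rpow_le_rpow (by positivity) ?_ (by linarith)) hρε
          rw [add_div, div_self hza.ne']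
          have := hcz a hat
          gcongr
        have h3 := ih (by omega)
        rw [hJadd a b ha0 (by linarith) hbt]
        have h4 := mul_le_mul_of_nonneg_right h2 (hJ0 a b)
        linarith
    have hNt : (N : ℝ) * (t / N) = t := by field_simp
    simpa [hNt] using hind N le_rfl
  have hle : z t ≤ z 0 + J 0 t := by
    have hlim : Tendsto (fun ε : ℝ => z 0 + (1 + ε) * J 0 t) (𝓝[>] 0)
        (𝓝 (z 0 + (1 + 0) * J 0 t)) :=
      Tendsto.mono_left (Continuous.tendsto (by fun_prop) 0) nhdsWithin_le_nhds
    rw [add_zero, one_mul] at hlim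
    exact ge_of_tendsto hlim (eventually_mem_nhdsWithin.mono hmain)
  calc ENNReal.ofReal (z t) ≤ ENNReal.ofReal (z 0 + J 0 t) := ENNReal.ofReal_le_ofReal hle
    _ = _ := by
      rw [ENNReal.ofReal_add (hpos 0 ⟨le_rfl, ht⟩).le (hJ0 0 t), hJ, ENNReal.ofReal_toReal hfin]

theorem le_mul_exp_of_le_add_mul_integral {z : ℝ → ℝ} {D c t : ℝ} (hc : 0 ≤ c) (ht : 0 ≤ t)
    (hD : 0 ≤ D) (hz : Continuous z) (hz0 : ∀ s, 0 ≤ z s)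
    (h : ∀ s ∈ Icc 0 t, z s ≤ D + c * ∫ τ in (0 : ℝ)..s, z τ) : z t ≤ D * Real.exp (c * t) := by
  set m : ℝ → ℝ := fun s => D + c * ∫ τ in (0 : ℝ)..s, z τ with hm
  have hder : ∀ s, HasDerivAt m (c * z s) s := fun s =>
    ((intervalIntegral.integral_hasDerivAt_right (hz.intervalIntegrable _ _)
      (hz.stronglyMeasurableAtFilter _ _) hz.continuousAt).const_mul c).const_add D
  have hm0 : ∀ s ∈ Icc 0 t, 0 ≤ m s := fun s hs => (hz0 s).trans (h s hs)
  have hg := norm_le_gronwallBound_of_norm_deriv_right_le (f := m) (f' := fun s => c * z s)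
    (δ := D) (K := c) (ε := 0) (a := 0) (b := t)
    (fun s _ => (hder s).continuousAt.continuousWithinAt)
    (fun s _ => (hder s).hasDerivWithinAt) (by simp [hm, abs_of_nonneg hD])
    (fun s hs => by
      have hs' : s ∈ Icc 0 t := ⟨hs.1, hs.2.le⟩
      rw [Real.norm_of_nonneg (mul_nonneg hc (hz0 s)), Real.norm_of_nonneg (hm0 s hs'), add_zero]
      exact mul_le_mul_of_nonneg_left (h s hs') hc) t ⟨ht, le_rfl⟩
  rw [gronwallBound_ε0, sub_zero, Real.norm_of_nonneg (hm0 t ⟨ht, le_rfl⟩)] at hg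
  exact (h t ⟨ht, le_rfl⟩).trans hg

end Gronwall

/-! ### From powers to norms. -/

section RootBound

open Filter Topology

theorem lintegral_mul_rpow_mul_weight_le {Ω : Type*} [MeasurableSpace Ω] {μ : Measure Ω}
    {q : ℝ} (hq : 1 ≤ q) {u w G : Ω → ℝ≥0∞} (hu : Measurable u) (hw : Measurable w)
    (hG : Measurable G) :
    ∫⁻ x, u x * w x ^ (q - 1) * G x ∂μ ≤
      (∫⁻ x, u x ^ q * G x ∂μ) ^ (1 / q) * (∫⁻ x, w x ^ q * G x ∂μ) ^ ((q - 1) / q) := by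
  rcases hq.eq_or_lt with rfl | hq1
  · simp
  have e : ∀ h : Ω → ℝ≥0∞, Measurable h → ∫⁻ x, h x ∂(μ.withDensity G) = ∫⁻ x, h x * G x ∂μ :=
    fun h hh => by
      rw [lintegral_withDensity_eq_lintegral_mul _ hG hh]
      congr 1; ext x; exact mul_comm _ _
  have hc := Real.HolderConjugate.conjExponent hq1
  have key := ENNReal.lintegral_mul_rpow_le_lintegral_rpow_mul_lintegral_rpow (μ := μ.withDensity G)
    hc hu.aemeasurable hw.aemeasurable
  rw [e (fun x => u x * w x ^ (q - 1)) (hu.mul (hw.pow_const _)), e _ (hu.pow_const _), e _ (hw.pow_const _)] at key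
  convert key using 3
  rw [Real.conjExponent]; field_simp

/-- The nonlinear Gronwall lemma is applied to `z = (y + η) ^ (1 / q)`, where `η` keeps `z`
positive. Hölder's inequality puts the forcing term in the form `q K z ^ (q - 1)`, and the flux term
is divided by `q z ^ (q - 1)`. -/
theorem PowerEnergyBound.root_le {Ω : Type*} [MeasureSpace Ω] {T q : ℝ} (hq : 1 ≤ q)
    {θ f : ℝ → Ω → ℝ} {G H : Ω → ℝ≥0∞} (h : PowerEnergyBound T q θ f G H) (hG : Measurable G)
    (hθ : ∀ s, Measurable (θ s)) (hf : ∀ s, Measurable (f s)) {y : ℝ → ℝ} (hy : Continuous y)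
    (hy0 : ∀ s, 0 ≤ y s) (hyG : ∀ s, ∫⁻ x, ‖θ s x‖ₑ ^ q * G x = ENNReal.ofReal (y s))
    {η : ℝ} (hη : 0 < η) {t : ℝ} (ht : t ∈ Icc 0 T) :
    ENNReal.ofReal ((y t + η) ^ (1 / q)) ≤ ENNReal.ofReal ((y 0 + η) ^ (1 / q)) +
      ∫⁻ s in Ioc 0 t, ((∫⁻ x, ‖f s x‖ₑ ^ q * G x) ^ (1 / q) +
        (∫⁻ x, ‖θ s x‖ₑ ^ q * H x) * ENNReal.ofReal ((y s + η) ^ ((1 - q) / q) / q)) := by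
  have hq0 : 0 < q := by linarith
  have hyη : ∀ s, 0 < y s + η := fun s => by linarith [hy0 s]
  have hzq : ∀ s, ((y s + η) ^ (1 / q)) ^ q = y s + η := fun s => by
    rw [← Real.rpow_mul (hyη s).le, one_div_mul_cancel hq0.ne', Real.rpow_one]
  have hzq1 : ∀ s, ((y s + η) ^ (1 / q)) ^ (q - 1) = (y s + η) ^ ((q - 1) / q) := fun s => by
    rw [← Real.rpow_mul (hyη s).le]; congr 1; ring
  refine le_add_lintegral_of_rpow_le (z := fun s => (y s + η) ^ (1 / q)) hq ht.1
    ((hy.add continuous_const).rpow_const fun s => Or.inl (hyη s).ne').continuousOn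
    (fun s _ => Real.rpow_pos_of_pos (hyη s) _) fun a b ha hab hb => ?_
  have h1 := h a b ha hab (hb.trans ht.2)
  rw [hyG, hyG] at h1
  simp only [hzq, hzq1]
  rw [ENNReal.ofReal_add (hy0 b) hη.le, ENNReal.ofReal_add (hy0 a) hη.le, add_right_comm]
  refine add_le_add_left (h1.trans ?_) _
  rw [add_assoc, ← lintegral_const_mul' _ _ ENNReal.ofReal_ne_top]
  -- Superadditivity of the lower integral suffices here, so no measurability in time is required.
  refine add_le_add_right ((le_lintegral_add _ _).trans (lintegral_mono fun s => ?_)) _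
  have h2 : ∫⁻ x, ENNReal.ofReal q * (‖f s x‖ₑ * ‖θ s x‖ₑ ^ (q - 1)) * G x ≤
      ENNReal.ofReal q * ((∫⁻ x, ‖f s x‖ₑ ^ q * G x) ^ (1 / q) *
        ENNReal.ofReal ((y s + η) ^ ((q - 1) / q))) := by
    simp_rw [mul_assoc (ENNReal.ofReal q)]
    rw [lintegral_const_mul' _ _ ENNReal.ofReal_ne_top]
    gcongr
    refine (lintegral_mul_rpow_mul_weight_le hq (hf s).enorm (hθ s).enorm hG).trans ?_
    gcongr
    rw [hyG, ENNReal.ofReal_rpow_of_nonneg (hy0 s) (div_nonneg (by linarith) hq0.le)]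
    refine ENNReal.ofReal_le_ofReal (Real.rpow_le_rpow (hy0 s) (by linarith)
      (div_nonneg (by linarith) hq0.le))
  have h3 : ∫⁻ x, ‖θ s x‖ₑ ^ q * H x = ENNReal.ofReal q * ((∫⁻ x, ‖θ s x‖ₑ ^ q * H x) *
      ENNReal.ofReal ((y s + η) ^ ((1 - q) / q) / q) *
        ENNReal.ofReal ((y s + η) ^ ((q - 1) / q))) := by
    rw [mul_assoc, mul_left_comm, ← ENNReal.ofReal_mul (by have := hyη s; positivity),
      ← ENNReal.ofReal_mul hq0.le]
    have : q * ((y s + η) ^ ((1 - q) / q) / q * (y s + η) ^ ((q - 1) / q)) = 1 := by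
      rw [div_mul_eq_mul_div, ← Real.rpow_add (hyη s), mul_div_cancel₀ _ hq0.ne', ← add_div]
      simp
    rw [this]; simp
  refine (add_le_add h2 h3.le).trans_eq ?_
  ring

variable {d : ℕ}

theorem exists_continuous_lintegral_rpow_eq {θ : ℝ → EuclideanSpace ℝ (Fin d) → ℝ}
    (hθ : Continuous (Function.uncurry θ)) {M : ℝ} (hM : ∀ s x, |θ s x| ≤ M) {q : ℝ} (hq : 0 < q)
    {G : EuclideanSpace ℝ (Fin d) → ℝ≥0∞} (hG : Measurable G) (hGi : ∫⁻ x, G x ≠ ⊤) :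
    ∃ y : ℝ → ℝ, Continuous y ∧ (∀ s, 0 ≤ y s) ∧
      ∀ s, ∫⁻ x, ‖θ s x‖ₑ ^ q * G x = ENNReal.ofReal (y s) := by
  have hfinite : IsFiniteMeasure (volume.withDensity G) := isFiniteMeasure_withDensity hGi
  have hθs : ∀ s, Continuous (θ s) := fun s => hθ.comp (by fun_prop : Continuous fun x => (s, x))
  have hc : ∀ s, Continuous fun x => |θ s x| ^ q := fun s =>
    (hθs s).abs.rpow_const fun _ => Or.inr hq.le
  have hbd : ∀ s x, ‖|θ s x| ^ q‖ ≤ M ^ q := fun s x => by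
    rw [Real.norm_of_nonneg (by positivity)]
    exact Real.rpow_le_rpow (abs_nonneg _) (hM s x) hq.le
  refine ⟨fun s => ∫ x, |θ s x| ^ q ∂(volume.withDensity G), ?_, fun s => ?_, fun s => ?_⟩
  · refine continuous_of_dominated (bound := fun _ => M ^ q) (fun s => (hc s).aestronglyMeasurable)
      (fun s => Eventually.of_forall (hbd s)) (integrable_const _) (Eventually.of_forall fun x => ?_)
    have : Continuous fun s => θ s x := hθ.comp (by fun_prop : Continuous fun s => (s, x))
    exact this.abs.rpow_const fun _ => Or.inr hq.le
  · exact integral_nonneg fun x => by positivity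
  · rw [ofReal_integral_eq_lintegral_ofReal ((integrable_const (M ^ q)).mono'
      (hc s).aestronglyMeasurable (Eventually.of_forall (hbd s)))
      (Eventually.of_forall fun x => by positivity)]
    simp_rw [ofReal_abs_rpow _ hq.le]
    rw [lintegral_withDensity_eq_lintegral_mul _ hG ((hθs s).measurable.enorm.pow_const q)]
    congr 1; ext x; exact mul_comm _ _

/-- When the flux is at most `c` times the weight, the flux term in `root_le` is at most `(c / q) z`
and the linear Gronwall lemma applies. The rate `c / q`, rather than `c`, makes the loss disappear
as `q → ∞`. -/
theorem PowerEnergyBound.exp_bound {T q : ℝ} (hq : 1 ≤ q)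
    {θ f : ℝ → EuclideanSpace ℝ (Fin d) → ℝ} {G : EuclideanSpace ℝ (Fin d) → ℝ≥0∞} {c : ℝ}
    (hc : 0 ≤ c) (h : PowerEnergyBound T q θ f G fun x => ENNReal.ofReal c * G x)
    (hG : Measurable G) (hGi : ∫⁻ x, G x ≠ ⊤) (hθ : Continuous (Function.uncurry θ)) {M : ℝ}
    (hM : ∀ s x, |θ s x| ≤ M) (hf : ∀ s, Measurable (f s)) {t : ℝ} (ht : t ∈ Icc 0 T) :
    (∫⁻ x, ‖θ t x‖ₑ ^ q * G x) ^ (1 / q) ≤ ENNReal.ofReal (Real.exp (c / q * t)) *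
      ((∫⁻ x, ‖θ 0 x‖ₑ ^ q * G x) ^ (1 / q) +
        ∫⁻ s in Ioc 0 t, (∫⁻ x, ‖f s x‖ₑ ^ q * G x) ^ (1 / q)) := by
  have hq0 : 0 < q := by linarith
  have hθs : ∀ s, Continuous (θ s) := fun s => hθ.comp (by fun_prop : Continuous fun x => (s, x))
  obtain ⟨y, hy, hy0, hyG⟩ := exists_continuous_lintegral_rpow_eq hθ hM hq0 hG hGi
  set F := ∫⁻ s in Ioc 0 t, (∫⁻ x, ‖f s x‖ₑ ^ q * G x) ^ (1 / q) with hF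
  rcases eq_or_ne F ⊤ with htop | hfin
  · rw [htop, add_top, ENNReal.mul_top (by simp [Real.exp_pos])]; exact le_top
  have hcq : 0 ≤ c / q := by positivity
  have hmain : ∀ η, 0 < η → y t ^ (1 / q) ≤
      ((y 0 + η) ^ (1 / q) + F.toReal) * Real.exp (c / q * t) := fun η hη => by
    have hyη : ∀ s, 0 < y s + η := fun s => by linarith [hy0 s]
    have hzc : Continuous fun s => (y s + η) ^ (1 / q) :=
      (hy.add continuous_const).rpow_const fun s => Or.inl (hyη s).ne'
    refine (Real.rpow_le_rpow (hy0 t) (by linarith) (by positivity)).trans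
      (le_mul_exp_of_le_add_mul_integral (z := fun s => (y s + η) ^ (1 / q)) hcq ht.1
      (add_nonneg (Real.rpow_nonneg (hyη 0).le _) ENNReal.toReal_nonneg) hzc
      (fun s => Real.rpow_nonneg (hyη s).le _) fun s hs => ?_)
    have h1 := h.root_le hq hG (fun s => (hθs s).measurable) hf hy hy0 hyG hη
      ⟨hs.1, hs.2.trans ht.2⟩
    have hz0 : ∀ τ, 0 ≤ (y τ + η) ^ (1 / q) := fun τ => Real.rpow_nonneg (hyη τ).le _
    have h2 : ∫⁻ τ in Ioc 0 s, ((∫⁻ x, ‖f τ x‖ₑ ^ q * G x) ^ (1 / q) +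
        (∫⁻ x, ‖θ τ x‖ₑ ^ q * (ENNReal.ofReal c * G x)) *
          ENNReal.ofReal ((y τ + η) ^ ((1 - q) / q) / q)) ≤
        F + ENNReal.ofReal (c / q * ∫ τ in (0 : ℝ)..s, (y τ + η) ^ (1 / q)) := by
      calc _ ≤ ∫⁻ τ in Ioc 0 s, ((∫⁻ x, ‖f τ x‖ₑ ^ q * G x) ^ (1 / q) +
            ENNReal.ofReal (c / q * (y τ + η) ^ (1 / q))) := by
            refine lintegral_mono fun τ => add_le_add_right ?_ _
            simp_rw [mul_left_comm _ (ENNReal.ofReal c)]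
            rw [lintegral_const_mul' _ _ ENNReal.ofReal_ne_top, hyG,
              ← ENNReal.ofReal_mul hc, ← ENNReal.ofReal_mul (mul_nonneg hc (hy0 τ))]
            refine ENNReal.ofReal_le_ofReal ?_
            have e1 : (y τ + η) ^ (1 / q) = (y τ + η) * (y τ + η) ^ ((1 - q) / q) := by
              rw [← Real.rpow_one_add' (hyη τ).le] <;>
                rw [show 1 + (1 - q) / q = 1 / q by field_simp; ring]
              positivity
            have := Real.rpow_nonneg (hyη τ).le ((1 - q) / q)
            rw [e1]
            calc _ = c / q * (y τ * (y τ + η) ^ ((1 - q) / q)) := by ring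
              _ ≤ _ := by gcongr; linarith
        _ = (∫⁻ τ in Ioc 0 s, (∫⁻ x, ‖f τ x‖ₑ ^ q * G x) ^ (1 / q)) +
            ENNReal.ofReal (c / q * ∫ τ in (0 : ℝ)..s, (y τ + η) ^ (1 / q)) := by
            rw [lintegral_add_right _ (by fun_prop), intervalIntegral.integral_of_le hs.1,
              ← integral_const_mul, ofReal_integral_eq_lintegral_ofReal
                ((hzc.integrableOn_Icc.mono_set Ioc_subset_Icc_self).const_mul _)
                (Eventually.of_forall fun τ => mul_nonneg hcq (hz0 τ))]
        _ ≤ _ := add_le_add_left (lintegral_mono_set (Ioc_subset_Ioc_right hs.2)) _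
    have hint : 0 ≤ ∫ τ in (0 : ℝ)..s, (y τ + η) ^ (1 / q) :=
      intervalIntegral.integral_nonneg hs.1 fun τ _ => hz0 τ
    have h3 := h1.trans (add_le_add_right h2 _)
    rw [← ENNReal.ofReal_toReal hfin, ← ENNReal.ofReal_add ENNReal.toReal_nonneg (by positivity),
      ← ENNReal.ofReal_add (hz0 0) (by positivity), ENNReal.ofReal_le_ofReal_iff
        (add_nonneg (hz0 0) (by positivity))] at h3
    linarith
  have hlim : Tendsto (fun η : ℝ => ((y 0 + η) ^ (1 / q) + F.toReal) * Real.exp (c / q * t))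
      (𝓝[>] 0) (𝓝 (((y 0 + 0) ^ (1 / q) + F.toReal) * Real.exp (c / q * t))) := by
    refine Tendsto.mono_left (Continuous.tendsto (Continuous.mul (Continuous.add ?_
      continuous_const) continuous_const) 0) nhdsWithin_le_nhds
    exact (continuous_const.add continuous_id).rpow_const fun _ => Or.inr (by positivity)
  have hle := ge_of_tendsto hlim (eventually_mem_nhdsWithin.mono hmain)
  rw [add_zero] at hle
  have hy0q := Real.rpow_nonneg (hy0 0) (1 / q)
  rw [hyG, hyG, ENNReal.ofReal_rpow_of_nonneg (hy0 t) (by positivity),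
    ENNReal.ofReal_rpow_of_nonneg (hy0 0) (by positivity), ← ENNReal.ofReal_toReal hfin,
    ← ENNReal.ofReal_add hy0q ENNReal.toReal_nonneg, ← ENNReal.ofReal_mul (Real.exp_pos _).le,
    mul_comm (Real.exp _)]
  exact ENNReal.ofReal_le_ofReal hle

end RootBound

/-! ### Limits of the Gaussian weights as the width tends to infinity. -/

section Limits

open Filter Topology

set_option linter.unusedSectionVars false

variable {V : Type*} [NormedAddCommGroup V] [InnerProductSpace ℝ V] [FiniteDimensional ℝ V]
  [MeasurableSpace V] [BorelSpace V] {ν : Measure ℝ} [SFinite ν]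

theorem tendsto_inv_four_pow : Tendsto (fun n : ℕ => ((4 : ℝ) ^ n)⁻¹) atTop (𝓝 0) := by
  simpa using tendsto_pow_atTop_nhds_zero_of_lt_one (r := (4 : ℝ)⁻¹) (by norm_num) (by norm_num)

theorem tendsto_gaussWeight (x : V) :
    Tendsto (fun n : ℕ => gaussWeight (4 ^ n) x) atTop (𝓝 1) := by
  have h : Tendsto (fun n : ℕ => Real.exp (-‖x‖ ^ 2 / 4 * ((4 : ℝ) ^ n)⁻¹)) atTop
      (𝓝 (Real.exp (-‖x‖ ^ 2 / 4 * 0))) :=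
    (Real.continuous_exp.tendsto _).comp (tendsto_inv_four_pow.const_mul _)
  rw [mul_zero, Real.exp_zero] at h
  refine h.congr fun n => ?_
  rw [gaussWeight]; congr 1; field_simp

theorem tendsto_lintegral_mul_gaussWeight {h : V → ℝ≥0∞} (hh : Measurable h) :
    Tendsto (fun n : ℕ => ∫⁻ x, h x * ENNReal.ofReal (gaussWeight (4 ^ n) x)) atTop
      (𝓝 (∫⁻ x, h x)) := by
  refine lintegral_tendsto_of_tendsto_of_monotone
    (fun n => (hh.mul (continuous_gaussWeight _).measurable.ennreal_ofReal).aemeasurable)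
    (Eventually.of_forall fun x n m hnm => ?_) (Eventually.of_forall fun x => ?_)
  · refine mul_le_mul_right (ENNReal.ofReal_le_ofReal (gaussWeight_mono (by positivity) ?_ x)) _
    exact pow_le_pow_right₀ (by norm_num) hnm
  · have h1 := ENNReal.tendsto_ofReal (tendsto_gaussWeight x)
    have h2 := ENNReal.Tendsto.const_mul (a := h x) h1 (Or.inl (by simp))
    simpa using h2

theorem tendsto_gaussGain {s : ℝ} (hs : 0 ≤ s) (x : V) :
    Tendsto (fun n : ℕ => gaussGain (4 ^ n) s x) atTop (𝓝 0) := by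
  have h1 : Tendsto (fun n : ℕ => 4 * s * ((4 : ℝ) ^ n)⁻¹) atTop (𝓝 0) := by
    simpa using tendsto_inv_four_pow.const_mul (4 * s)
  have hev : ∀ᶠ n : ℕ in atTop, s ≤ 4 ^ n :=
    (tendsto_pow_atTop_atTop_of_one_lt (by norm_num : (1 : ℝ) < 4)).eventually_ge_atTop s
  refine tendsto_of_tendsto_of_tendsto_of_le_of_le' tendsto_const_nhds h1
    (Eventually.of_forall fun n => gaussGain_nonneg _ _ _) (hev.mono fun n hn => ?_)
  refine (gaussGain_le_of_le (by positivity) hs hn x).trans ?_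
  have := gaussWeight_le_one (show (0 : ℝ) ≤ 4 * 4 ^ n by positivity) x
  calc _ ≤ 4 * (s / 4 ^ n) * 1 := by gcongr
    _ = _ := by ring

theorem gaussGain_four_pow_le {s : ℝ} (hs : 0 ≤ s) (n : ℕ) (x : V) :
    gaussGain (4 ^ n) s x ≤ 5 * min 1 s := by
  refine (gaussGain_le_min (by positivity) hs x).trans ?_
  have h1 : (4 : ℝ) / 4 ^ n ≤ 4 := div_le_self (by norm_num) (one_le_pow₀ (by norm_num))
  have : 0 ≤ min 1 s := by positivity
  gcongr
  linarith

/-- At fixed `x` and `s` both parts are `O(1 / σ)`. The average over `s` is dominated by `5 min 1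
s`, uniformly in the width. -/
theorem tendsto_gaussFlux (hpos : ∀ᵐ s ∂ν, 0 < s) (hmin : Integrable (fun s => min 1 s) ν)
    (κ A : ℝ) (x : V) : Tendsto (fun n : ℕ => gaussFlux ν κ A (4 ^ n) x) atTop (𝓝 0) := by
  have h1 : Tendsto (fun n : ℕ => gaussExcess ν (4 ^ n) x) atTop (𝓝 0) := by
    unfold gaussExcess
    have h := tendsto_integral_of_dominated_convergence (μ := ν) (f := fun _ => (0 : ℝ))
      (F := fun (n : ℕ) s => gaussGain (4 ^ n) s x) (fun s => 5 * min 1 s) (fun n => ?_)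
      (hmin.const_mul 5) (fun n => hpos.mono fun s hs => ?_) (hpos.mono fun s hs => ?_)
    · simpa using h
    · have h := (continuous_gaussGain (V := V) (σ := 4 ^ n) (by positivity)).comp
        (by fun_prop : Continuous fun s : ℝ => (x, s))
      exact h.aestronglyMeasurable
    · rw [Real.norm_of_nonneg (gaussGain_nonneg _ _ _)]
      exact gaussGain_four_pow_le hs.le n x
    · exact tendsto_gaussGain hs.le x
  have h2 : Tendsto (fun n : ℕ => (1 + ‖x‖) * (‖x‖ / (2 * 4 ^ n)) * gaussWeight (4 ^ n) x) atTop
      (𝓝 0) := by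
    have h := (tendsto_inv_four_pow.const_mul ((1 + ‖x‖) * (‖x‖ / 2))).mul (tendsto_gaussWeight x)
    rw [mul_zero, zero_mul] at h
    refine h.congr fun n => ?_
    field_simp
  have h := (h2.const_mul A).add (h1.const_mul κ)
  rw [mul_zero, mul_zero, add_zero] at h
  exact h

theorem gaussFlux_four_pow_le (hpos : ∀ᵐ s ∂ν, 0 < s) (hmin : Integrable (fun s => min 1 s) ν)
    {κ A : ℝ} (hκ : 0 ≤ κ) (hA : 0 ≤ A) (n : ℕ) (x : V) :
    gaussFlux ν κ A (4 ^ n) x ≤ A * 9 + κ * ∫ s, 5 * min 1 s ∂ν := by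
  have h1n : (1 : ℝ) ≤ 4 ^ n := one_le_pow₀ (by norm_num)
  unfold gaussFlux gaussExcess
  refine add_le_add (mul_le_mul_of_nonneg_left ?_ hA) (mul_le_mul_of_nonneg_left ?_ hκ)
  · refine (one_add_norm_mul_norm_gaussWeight_le (by positivity) x).trans ?_
    have h1 := gaussWeight_le_one (show (0 : ℝ) ≤ 2 * 4 ^ n by positivity) x
    have h2 : (1 / (2 * 4 ^ n) + 8 : ℝ) ≤ 9 := by
      have : (1 : ℝ) / (2 * 4 ^ n) ≤ 1 := by
        rw [div_le_one (by positivity)]; linarith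
      linarith
    calc _ ≤ (9 : ℝ) * 1 := by
          have := (gaussWeight_pos (2 * 4 ^ n) x).le
          gcongr
      _ = 9 := by norm_num
  · exact integral_mono_of_nonneg (Eventually.of_forall fun s => gaussGain_nonneg _ _ _)
      (hmin.const_mul 5) (hpos.mono fun s hs => gaussGain_four_pow_le hs.le n x)

theorem tendsto_const_rpow_one_div {x : ℝ≥0∞} (h0 : x ≠ 0) (ht : x ≠ ⊤) :
    Tendsto (fun n : ℕ => x ^ (1 / ((n : ℝ) + 1))) atTop (𝓝 1) := by
  have hx : 0 < x.toReal := ENNReal.toReal_pos h0 ht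
  have h1 : Tendsto (fun n : ℕ => x.toReal ^ (1 / ((n : ℝ) + 1))) atTop (𝓝 (x.toReal ^ (0 : ℝ))) :=
    (Real.continuousAt_const_rpow hx.ne').tendsto.comp tendsto_one_div_add_atTop_nhds_zero_nat
  have h2 := ENNReal.tendsto_ofReal h1
  rw [Real.rpow_zero, ENNReal.ofReal_one] at h2
  refine h2.congr fun n => ?_
  rw [← ENNReal.ofReal_rpow_of_pos hx, ENNReal.ofReal_toReal ht]

end Limits

/-! ### Weighted norms and the bound in `L^∞`. -/

section LpBounds

open Filter Topology

set_option linter.unusedSectionVars false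

variable {d : ℕ} {ν : Measure ℝ} [SFinite ν] {κ T A b : ℝ}
  {θ f B : ℝ → EuclideanSpace ℝ (Fin d) → ℝ}
  {v : ℝ → EuclideanSpace ℝ (Fin d) → EuclideanSpace ℝ (Fin d)}

/-- The order of quantifiers matters: one constant `c` serves for all scales `j` and all exponents
`q`. -/
theorem IsTransportSolution.exists_dyadicWeight_bound
    (H : IsTransportSolution ν κ T A θ f B v) (hκ : 0 ≤ κ)
    (hpos : ∀ᵐ s ∂ν, 0 < s) (hmin : Integrable (fun s => min 1 s) ν) (hb : 0 < b) (hb1 : b ≤ 1)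
    (hfin : ∫⁻ s, ENNReal.ofReal (min s (s ^ b)) ∂ν < ⊤) :
    ∃ c : ℝ, 0 ≤ c ∧ ∀ (j : ℕ) (q : ℝ), 1 ≤ q → ∀ t ∈ Icc 0 T,
      (∫⁻ x, ‖θ t x‖ₑ ^ q * dyadicWeight b j x) ^ (1 / q) ≤ ENNReal.ofReal (Real.exp (c / q * t)) *
        ((∫⁻ x, ‖θ 0 x‖ₑ ^ q * dyadicWeight b j x) ^ (1 / q) +
          ∫⁻ s in Ioc 0 t, (∫⁻ x, ‖f s x‖ₑ ^ q * dyadicWeight b j x) ^ (1 / q)) := by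
  obtain ⟨C, hC, hCle⟩ := exists_tsum_gaussFlux_le (EuclideanSpace ℝ (Fin d)) hκ H.A_nonneg hb hb1
    hpos hmin hfin
  obtain ⟨M, hM⟩ := H.bounded_theta
  refine ⟨C.toReal, ENNReal.toReal_nonneg, fun j q hq t ht => ?_⟩
  have hfs : ∀ s, Measurable (f s) := fun s =>
    (H.continuous_f.comp (by fun_prop : Continuous fun x => (s, x))).measurable
  have h1 : PowerEnergyBound T q θ f (dyadicWeight b j)
      (fun x => ∑' k : ℕ, ENNReal.ofReal (dyadicRatio (EuclideanSpace ℝ (Fin d)) b ^ k) *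
        ENNReal.ofReal (gaussFlux ν κ A (4 ^ (k + j)) x)) :=
    PowerEnergyBound.tsum _ (fun k => (continuous_gaussWeight _).measurable.ennreal_ofReal)
      (fun k => (continuous_gaussFlux hpos hmin κ A (by positivity)).measurable.ennreal_ofReal)
      H.continuous_theta.measurable H.continuous_f.measurable
      fun k => H.powerEnergyBound hκ hpos hmin hq (by positivity)
  have h2 := h1.mono (hCle j)
  rw [← ENNReal.ofReal_toReal hC] at h2
  exact h2.exp_bound hq ENNReal.toReal_nonneg (measurable_dyadicWeight j)
    (lintegral_dyadicWeight_ne_top hb j) H.continuous_theta hM hfs ht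

/-- The weight `W` is positive with finite mass. As `q → ∞`, the weighted `L^q` norms of the data
are bounded by their sup norms times `m ^ (1 / q) → 1`, and `exp (c t / q) → 1`. For every `l'`
below the sup norm of `θ t`, the superlevel set has positive `W`-mass `m'`, so the left-hand side is
at least `l' * m' ^ (1 / q) → l'`. -/
theorem IsTransportSolution.eLpNorm_top_le
    (H : IsTransportSolution ν κ T A θ f B v) (hκ : 0 ≤ κ)
    (hpos : ∀ᵐ s ∂ν, 0 < s) (hmin : Integrable (fun s => min 1 s) ν) (hb : 0 < b) (hb1 : b ≤ 1)
    (hfin : ∫⁻ s, ENNReal.ofReal (min s (s ^ b)) ∂ν < ⊤) {t : ℝ} (ht : t ∈ Icc 0 T) :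
    eLpNorm (θ t) ⊤ volume ≤ eLpNorm (θ 0) ⊤ volume +
      ∫⁻ s in Ioc 0 t, eLpNorm (f s) ⊤ volume := by
  obtain ⟨c, -, hbound⟩ := H.exists_dyadicWeight_bound hκ hpos hmin hb hb1 hfin
  set W : EuclideanSpace ℝ (Fin d) → ℝ≥0∞ := dyadicWeight b 0 with hW
  have hWm : Measurable W := measurable_dyadicWeight 0
  set m := ∫⁻ x, W x with hm
  have hmt : m ≠ ⊤ := lintegral_dyadicWeight_ne_top hb 0
  set R := eLpNorm (θ 0) ⊤ volume + ∫⁻ s in Ioc 0 t, eLpNorm (f s) ⊤ volume with hR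
  rcases eq_or_ne R ⊤ with hRt | hRt
  · rw [hRt]; exact le_top
  have hup : ∀ (u : EuclideanSpace ℝ (Fin d) → ℝ) (q : ℝ), 0 < q →
      (∫⁻ x, ‖u x‖ₑ ^ q * W x) ^ (1 / q) ≤ m ^ (1 / q) * eLpNorm u ⊤ volume := fun u q hq => by
    calc _ ≤ (∫⁻ x, eLpNorm u ⊤ volume ^ q * W x) ^ (1 / q) := by
          refine ENNReal.rpow_le_rpow (lintegral_mono_ae ?_) (by positivity)
          rw [eLpNorm_exponent_top]
          refine (enorm_ae_le_eLpNormEssSup u volume).mono fun x hx => ?_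
          gcongr
      _ = _ := by
          rw [lintegral_const_mul _ hWm, ENNReal.mul_rpow_of_nonneg _ _ (by positivity),
            ← ENNReal.rpow_mul, mul_one_div_cancel hq.ne', ENNReal.rpow_one, mul_comm]
  refine le_of_forall_lt fun l hl => ?_
  obtain ⟨l', hll', hl'⟩ := exists_between hl
  refine hll'.trans_le ?_
  set S := {x | l' < ‖θ t x‖ₑ} with hS
  have hθt : Measurable (θ t) := (H.contDiff_theta t).continuous.measurable
  have hSm : MeasurableSet S := measurableSet_lt measurable_const hθt.enorm
  have hSpos : volume S ≠ 0 := fun h0 => by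
    refine absurd hl' (not_lt.2 ?_)
    rw [eLpNorm_exponent_top]
    refine essSup_le_of_ae_le _ ?_
    filter_upwards [measure_eq_zero_iff_ae_notMem.1 h0] with x hx
    exact not_lt.1 hx
  set m' := ∫⁻ x in S, W x with hm'
  have hm'0 : m' ≠ 0 := fun h0 => by
    rw [hm', lintegral_eq_zero_iff hWm] at h0
    refine hSpos ?_
    have h1 : ∀ᵐ x ∂(volume.restrict S), False := h0.mono fun x hx => (dyadicWeight_pos 0 x).ne' hx
    rw [ae_iff] at h1
    simpa using h1
  have hm't : m' ≠ ⊤ := ((setLIntegral_le_lintegral S W).trans_lt hmt.lt_top).ne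
  have hm0 : m ≠ 0 := fun h0 => hm'0 (le_antisymm ((setLIntegral_le_lintegral S W).trans h0.le) bot_le)
  have hlow : ∀ q : ℝ, 0 < q → l' * m' ^ (1 / q) ≤ (∫⁻ x, ‖θ t x‖ₑ ^ q * W x) ^ (1 / q) :=
    fun q hq => by
      calc l' * m' ^ (1 / q) = (∫⁻ x in S, l' ^ q * W x) ^ (1 / q) := by
            rw [lintegral_const_mul _ hWm, ENNReal.mul_rpow_of_nonneg _ _ (by positivity),
              ← ENNReal.rpow_mul, mul_one_div_cancel hq.ne', ENNReal.rpow_one]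
        _ ≤ _ := by
            refine ENNReal.rpow_le_rpow (le_trans (setLIntegral_mono' hSm fun x hx => ?_)
              (setLIntegral_le_lintegral S _)) (by positivity)
            have : l' ≤ ‖θ t x‖ₑ := le_of_lt hx
            gcongr
  have hall : ∀ n : ℕ, l' * m' ^ (1 / ((n : ℝ) + 1)) ≤
      ENNReal.ofReal (Real.exp (c * t * (1 / ((n : ℝ) + 1)))) * (m ^ (1 / ((n : ℝ) + 1)) * R) :=
    fun n => by
      have hq0 : (0 : ℝ) < (n : ℝ) + 1 := by positivity
      have h1 := hbound 0 ((n : ℝ) + 1) (by linarith [n.cast_nonneg (α := ℝ)]) t ht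
      rw [show c / ((n : ℝ) + 1) * t = c * t * (1 / ((n : ℝ) + 1)) by ring] at h1
      refine (hlow _ hq0).trans (h1.trans (mul_le_mul_right ?_ _))
      rw [hR, mul_add]
      refine add_le_add (hup _ _ hq0) ?_
      rw [← lintegral_const_mul' _ _ (ENNReal.rpow_ne_top_of_nonneg (by positivity) hmt)]
      exact lintegral_mono fun s => hup _ _ hq0
  have hlimL : Tendsto (fun n : ℕ => l' * m' ^ (1 / ((n : ℝ) + 1))) atTop (𝓝 (l' * 1)) :=
    ENNReal.Tendsto.const_mul (tendsto_const_rpow_one_div hm'0 hm't) (Or.inl one_ne_zero)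
  have hlimR : Tendsto (fun n : ℕ => ENNReal.ofReal (Real.exp (c * t * (1 / ((n : ℝ) + 1)))) *
      (m ^ (1 / ((n : ℝ) + 1)) * R)) atTop (𝓝 (1 * (1 * R))) := by
    have h1 : Tendsto (fun n : ℕ => Real.exp (c * t * (1 / ((n : ℝ) + 1)))) atTop
        (𝓝 (Real.exp (c * t * 0))) :=
      (Real.continuous_exp.tendsto _).comp (tendsto_one_div_add_atTop_nhds_zero_nat.const_mul _)
    have h2 := ENNReal.tendsto_ofReal h1
    rw [mul_zero, Real.exp_zero, ENNReal.ofReal_one] at h2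
    refine ENNReal.Tendsto.mul h2 (Or.inl one_ne_zero) (ENNReal.Tendsto.mul_const
      (tendsto_const_rpow_one_div hm0 hmt) (Or.inr hRt)) (Or.inr ENNReal.one_ne_top)
  have := le_of_tendsto_of_tendsto' hlimL hlimR hall
  simpa using this

end LpBounds

/-! ### The bound in `L^q`, `q < ∞`. -/

section FiniteExponent

open Filter Topology

set_option linter.unusedSectionVars false

variable {d : ℕ} {ν : Measure ℝ} [SFinite ν] {κ T A b : ℝ}
  {θ f B : ℝ → EuclideanSpace ℝ (Fin d) → ℝ}
  {v : ℝ → EuclideanSpace ℝ (Fin d) → EuclideanSpace ℝ (Fin d)}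

theorem IsTransportSolution.measurable_theta (H : IsTransportSolution ν κ T A θ f B v) (s : ℝ) :
    Measurable (θ s) := (H.contDiff_theta s).continuous.measurable

theorem IsTransportSolution.measurable_f (H : IsTransportSolution ν κ T A θ f B v) (s : ℝ) :
    Measurable (f s) :=
  (H.continuous_f.comp (by fun_prop : Continuous fun x => (s, x))).measurable

/-- The `L^q` norm of the solution stays bounded as long as the claimed bound is finite. -/
theorem IsTransportSolution.exists_lintegral_rpow_le
    (H : IsTransportSolution ν κ T A θ f B v) (hκ : 0 ≤ κ)
    (hpos : ∀ᵐ s ∂ν, 0 < s) (hmin : Integrable (fun s => min 1 s) ν) (hb : 0 < b) (hb1 : b ≤ 1)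
    (hfin : ∫⁻ s, ENNReal.ofReal (min s (s ^ b)) ∂ν < ⊤) {q : ℝ} (hq : 1 ≤ q)
    {t : ℝ} (ht : t ∈ Icc 0 T) (h0 : ∫⁻ x, ‖θ 0 x‖ₑ ^ q ≠ ⊤)
    (hF : ∫⁻ s in Ioc 0 t, (∫⁻ x, ‖f s x‖ₑ ^ q) ^ (1 / q) ≠ ⊤) :
    ∃ L : ℝ≥0∞, L ≠ ⊤ ∧ ∀ s ∈ Icc 0 t, ∫⁻ x, ‖θ s x‖ₑ ^ q ≤ L := by
  obtain ⟨c, hc, hbound⟩ := H.exists_dyadicWeight_bound hκ hpos hmin hb hb1 hfin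
  have hq0 : 0 < q := by linarith
  set S := ∑' k : ℕ, ENNReal.ofReal (dyadicRatio (EuclideanSpace ℝ (Fin d)) b ^ k) with hS
  have hSt : S ≠ ⊤ := tsum_ofReal_pow_ne_top dyadicRatio_pos.le (dyadicRatio_lt_one hb)
  have hup : ∀ (u : EuclideanSpace ℝ (Fin d) → ℝ) (j : ℕ),
      (∫⁻ x, ‖u x‖ₑ ^ q * dyadicWeight b j x) ^ (1 / q) ≤
        S ^ (1 / q) * (∫⁻ x, ‖u x‖ₑ ^ q) ^ (1 / q) := fun u j => by
    rw [← ENNReal.mul_rpow_of_nonneg _ _ (by positivity), ← lintegral_const_mul' _ _ hSt]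
    refine ENNReal.rpow_le_rpow (lintegral_mono fun x => ?_) (by positivity)
    rw [mul_comm]
    gcongr
    exact dyadicWeight_le j x
  set R := (∫⁻ x, ‖θ 0 x‖ₑ ^ q) ^ (1 / q) + ∫⁻ s in Ioc 0 t, (∫⁻ x, ‖f s x‖ₑ ^ q) ^ (1 / q) with hR
  have hRt : R ≠ ⊤ :=
    ENNReal.add_ne_top.2 ⟨ENNReal.rpow_ne_top_of_nonneg (by positivity) h0, hF⟩
  have hSq : S ^ (1 / q) ≠ ⊤ := ENNReal.rpow_ne_top_of_nonneg (by positivity) hSt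
  set K := ENNReal.ofReal (Real.exp (c / q * t)) * (S ^ (1 / q) * R) with hK
  have hKt : K ≠ ⊤ := ENNReal.mul_ne_top ENNReal.ofReal_ne_top (ENNReal.mul_ne_top hSq hRt)
  refine ⟨K ^ q, ENNReal.rpow_ne_top_of_nonneg hq0.le hKt, fun s hs => ?_⟩
  have hm : Measurable fun x => ‖θ s x‖ₑ ^ q := (H.measurable_theta s).enorm.pow_const q
  -- The term `k = 0` of `dyadicWeight b j` is the Gaussian of width `4 ^ j`, which increases to
  -- `1`, while the bound `K ^ q` does not depend on `j`.
  refine le_of_tendsto' (tendsto_lintegral_mul_gaussWeight hm) fun j => ?_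
  have h1 : ∫⁻ x, ‖θ s x‖ₑ ^ q * ENNReal.ofReal (gaussWeight (4 ^ j) x) ≤
      ∫⁻ x, ‖θ s x‖ₑ ^ q * dyadicWeight b j x := lintegral_mono fun x => by
    have := le_dyadicWeight (b := b) j 0 x
    simp only [pow_zero, one_mul, zero_add] at this
    beta_reduce
    gcongr
  refine h1.trans ?_
  rw [← ENNReal.rpow_inv_le_iff hq0, inv_eq_one_div]
  refine (hbound j q hq s ⟨hs.1, hs.2.trans ht.2⟩).trans ?_
  have h2 : c / q * s ≤ c / q * t := mul_le_mul_of_nonneg_left hs.2 (by positivity)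
  refine mul_le_mul' (ENNReal.ofReal_le_ofReal (Real.exp_le_exp.2 h2)) ?_
  rw [hR, mul_add]
  refine add_le_add (hup _ j) ?_
  rw [← lintegral_const_mul' _ _ hSq]
  exact (lintegral_mono fun τ => hup _ j).trans (lintegral_mono_set (Ioc_subset_Ioc_right hs.2))

/-- The a priori `L^q` bound provides the integrable majorant on `(0, t] × ℝ^d`; the flux is bounded
uniformly in `n` and tends to `0` pointwise. -/
theorem IsTransportSolution.tendsto_lintegral_gaussFlux
    (H : IsTransportSolution ν κ T A θ f B v) (hκ : 0 ≤ κ)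
    (hpos : ∀ᵐ s ∂ν, 0 < s) (hmin : Integrable (fun s => min 1 s) ν) {q : ℝ} {t : ℝ} {L : ℝ≥0∞}
    (hL : L ≠ ⊤) (hθL : ∀ s ∈ Icc 0 t, ∫⁻ x, ‖θ s x‖ₑ ^ q ≤ L) :
    Tendsto (fun n : ℕ => ∫⁻ s in Ioc 0 t, ∫⁻ x, ‖θ s x‖ₑ ^ q *
      ENNReal.ofReal (gaussFlux ν κ A (4 ^ n) x)) atTop (𝓝 0) := by
  have hm : Measurable fun p : ℝ × EuclideanSpace ℝ (Fin d) => ‖θ p.1 p.2‖ₑ ^ q :=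
    H.continuous_theta.measurable.enorm.pow_const q
  set K := A * 9 + κ * ∫ s, 5 * min 1 s ∂ν with hK
  have hFm : ∀ n : ℕ, Measurable fun p : ℝ × EuclideanSpace ℝ (Fin d) =>
      ‖θ p.1 p.2‖ₑ ^ q * ENNReal.ofReal (gaussFlux ν κ A (4 ^ n) p.2) := fun n =>
    hm.mul ((continuous_gaussFlux hpos hmin κ A (by positivity)).comp
      continuous_snd).measurable.ennreal_ofReal
  have hint : ∫⁻ p : ℝ × EuclideanSpace ℝ (Fin d), ‖θ p.1 p.2‖ₑ ^ q
      ∂((volume.restrict (Ioc 0 t)).prod volume) ≠ ⊤ := by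
    rw [lintegral_prod _ hm.aemeasurable]
    have h1 : ∫⁻ s in Ioc 0 t, ∫⁻ x, ‖θ s x‖ₑ ^ q ≤ ∫⁻ s in Ioc 0 t, L :=
      setLIntegral_mono' measurableSet_Ioc fun s hs => hθL s ⟨hs.1.le, hs.2⟩
    refine (h1.trans_lt ?_).ne
    rw [setLIntegral_const]
    exact ENNReal.mul_lt_top hL.lt_top (by simp)
  have hae : ∀ᵐ p : ℝ × EuclideanSpace ℝ (Fin d) ∂((volume.restrict (Ioc 0 t)).prod volume),
      ‖θ p.1 p.2‖ₑ ^ q < ⊤ := ae_lt_top hm hint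
  have h := tendsto_lintegral_of_dominated_convergence
    (μ := (volume.restrict (Ioc 0 t)).prod (volume : Measure (EuclideanSpace ℝ (Fin d))))
    (F := fun (n : ℕ) p => ‖θ p.1 p.2‖ₑ ^ q * ENNReal.ofReal (gaussFlux ν κ A (4 ^ n) p.2))
    (f := fun _ => 0) (fun p => ‖θ p.1 p.2‖ₑ ^ q * ENNReal.ofReal K) hFm
    (fun n => Eventually.of_forall fun p => ?_) ?_ (hae.mono fun p hp => ?_)
  · rw [lintegral_zero] at h
    refine h.congr fun n => ?_
    rw [lintegral_prod _ (hFm n).aemeasurable]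
  · refine mul_le_mul_right (ENNReal.ofReal_le_ofReal ?_) _
    exact gaussFlux_four_pow_le hpos hmin hκ H.A_nonneg n p.2
  · rw [lintegral_mul_const _ hm]
    exact ENNReal.mul_ne_top hint ENNReal.ofReal_ne_top
  · have h1 := ENNReal.tendsto_ofReal (tendsto_gaussFlux hpos hmin κ A p.2)
    rw [ENNReal.ofReal_zero] at h1
    simpa using ENNReal.Tendsto.const_mul h1 (Or.inr hp.ne)

/-- With the a priori bound available, a single Gaussian weight is used instead of the dyadic one.
Its flux term vanishes in the limit instead of being absorbed by Gronwall's lemma, so no exponential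
factor appears. The limit `n → ∞` is taken before `η → 0`. -/
theorem IsTransportSolution.lintegral_rpow_le
    (H : IsTransportSolution ν κ T A θ f B v) (hκ : 0 ≤ κ)
    (hpos : ∀ᵐ s ∂ν, 0 < s) (hmin : Integrable (fun s => min 1 s) ν) (hb : 0 < b) (hb1 : b ≤ 1)
    (hfin : ∫⁻ s, ENNReal.ofReal (min s (s ^ b)) ∂ν < ⊤) {q : ℝ} (hq : 1 ≤ q)
    {t : ℝ} (ht : t ∈ Icc 0 T) :
    (∫⁻ x, ‖θ t x‖ₑ ^ q) ^ (1 / q) ≤ (∫⁻ x, ‖θ 0 x‖ₑ ^ q) ^ (1 / q) +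
      ∫⁻ s in Ioc 0 t, (∫⁻ x, ‖f s x‖ₑ ^ q) ^ (1 / q) := by
  have hq0 : 0 < q := by linarith
  rcases eq_or_ne (∫⁻ x, ‖θ 0 x‖ₑ ^ q) ⊤ with h0 | h0
  · rw [h0, ENNReal.top_rpow_of_pos (by positivity), top_add]; exact le_top
  rcases eq_or_ne (∫⁻ s in Ioc 0 t, (∫⁻ x, ‖f s x‖ₑ ^ q) ^ (1 / q)) ⊤ with hF | hF
  · rw [hF, add_top]; exact le_top
  obtain ⟨L, hL, hθL⟩ := H.exists_lintegral_rpow_le hκ hpos hmin hb hb1 hfin hq ht h0 hF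
  obtain ⟨M, hM⟩ := H.bounded_theta
  set F := ∫⁻ s in Ioc 0 t, (∫⁻ x, ‖f s x‖ₑ ^ q) ^ (1 / q) with hFdef
  set Y := (∫⁻ x, ‖θ 0 x‖ₑ ^ q).toReal with hY
  have hY0 : 0 ≤ Y := ENNReal.toReal_nonneg
  have hYe : ENNReal.ofReal Y = ∫⁻ x, ‖θ 0 x‖ₑ ^ q := ENNReal.ofReal_toReal h0
  have hflux := H.tendsto_lintegral_gaussFlux hκ hpos hmin hL hθL
  have hθm := H.measurable_theta
  have hmq : Measurable fun p : ℝ × EuclideanSpace ℝ (Fin d) => ‖θ p.1 p.2‖ₑ ^ q :=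
    H.continuous_theta.measurable.enorm.pow_const q
  have hle : ∀ (u : EuclideanSpace ℝ (Fin d) → ℝ) (n : ℕ),
      ∫⁻ x, ‖u x‖ₑ ^ q * ENNReal.ofReal (gaussWeight (4 ^ n) x) ≤ ∫⁻ x, ‖u x‖ₑ ^ q := fun u n =>
    lintegral_mono fun x => mul_le_of_le_one_right zero_le
      (ENNReal.ofReal_le_one.2 (gaussWeight_le_one (by positivity) x))
  have hη : ∀ η : ℝ, 0 < η → (∫⁻ x, ‖θ t x‖ₑ ^ q) ^ (1 / q) ≤
      ENNReal.ofReal ((Y + η) ^ (1 / q)) + F := fun η hη => by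
    -- The exponent `(1 - q) / q` is nonpositive, so `(y s + η) ^ ((1 - q) / q)` is at most its
    -- value at `y s = 0`. This bound is independent of `n` and of time, although it may blow up as
    -- `η → 0`.
    set cη : ℝ := η ^ ((1 - q) / q) / q with hcη
    have hn : ∀ n : ℕ, (∫⁻ x, ‖θ t x‖ₑ ^ q * ENNReal.ofReal (gaussWeight (4 ^ n) x)) ^ (1 / q) ≤
        ENNReal.ofReal ((Y + η) ^ (1 / q)) + (F + (∫⁻ s in Ioc 0 t, ∫⁻ x, ‖θ s x‖ₑ ^ q *
          ENNReal.ofReal (gaussFlux ν κ A (4 ^ n) x)) * ENNReal.ofReal cη) := fun n => by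
      have hGm : Measurable fun x : EuclideanSpace ℝ (Fin d) =>
          ENNReal.ofReal (gaussWeight (4 ^ n) x) :=
        (continuous_gaussWeight _).measurable.ennreal_ofReal
      have hσ : (0 : ℝ) < 4 ^ n := by positivity
      have hHm : Measurable fun x : EuclideanSpace ℝ (Fin d) =>
          ENNReal.ofReal (gaussFlux ν κ A (4 ^ n) x) :=
        (continuous_gaussFlux hpos hmin κ A hσ).measurable.ennreal_ofReal
      have hEm : Measurable fun s => ∫⁻ x, ‖θ s x‖ₑ ^ q *
          ENNReal.ofReal (gaussFlux ν κ A (4 ^ n) x) :=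
        (hmq.mul (hHm.comp measurable_snd)).lintegral_prod_right'
      obtain ⟨y, hy, hy0, hyG⟩ := exists_continuous_lintegral_rpow_eq H.continuous_theta hM hq0 hGm
        (integrable_gaussWeight hσ).lintegral_lt_top.ne
      have h1 := (H.powerEnergyBound hκ hpos hmin hq hσ).root_le hq hGm hθm H.measurable_f hy hy0 hyG
        hη ht
      have hy0Y : y 0 ≤ Y := by
        have h2 := hle (θ 0) n
        rw [hyG, ← hYe] at h2
        exact (ENNReal.ofReal_le_ofReal_iff hY0).1 h2
      rw [hyG, ENNReal.ofReal_rpow_of_nonneg (hy0 t) (by positivity)]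
      refine (ENNReal.ofReal_le_ofReal (Real.rpow_le_rpow (hy0 t) (by linarith : y t ≤ y t + η)
        (by positivity))).trans (h1.trans (add_le_add (ENNReal.ofReal_le_ofReal
          (Real.rpow_le_rpow (by linarith [hy0 0]) (by linarith) (by positivity))) ?_))
      rw [← lintegral_mul_const _ hEm, hFdef, ← lintegral_add_right _ (hEm.mul_const _)]
      refine lintegral_mono fun s => add_le_add
        (ENNReal.rpow_le_rpow (hle _ n) (by positivity)) (mul_le_mul_right ?_ _)
      refine ENNReal.ofReal_le_ofReal ?_
      rw [hcη]
      refine div_le_div_of_nonneg_right ?_ hq0.le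
      exact Real.rpow_le_rpow_of_nonpos hη (by linarith [hy0 s])
        (div_nonpos_of_nonpos_of_nonneg (by linarith) hq0.le)
    have hl1 : Tendsto (fun n : ℕ => (∫⁻ x, ‖θ t x‖ₑ ^ q *
        ENNReal.ofReal (gaussWeight (4 ^ n) x)) ^ (1 / q)) atTop
        (𝓝 ((∫⁻ x, ‖θ t x‖ₑ ^ q) ^ (1 / q))) :=
      (ENNReal.continuous_rpow_const.tendsto _).comp
        (tendsto_lintegral_mul_gaussWeight ((hθm t).enorm.pow_const q))
    have hl2 : Tendsto (fun n : ℕ => ENNReal.ofReal ((Y + η) ^ (1 / q)) + (F +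
        (∫⁻ s in Ioc 0 t, ∫⁻ x, ‖θ s x‖ₑ ^ q *
          ENNReal.ofReal (gaussFlux ν κ A (4 ^ n) x)) * ENNReal.ofReal cη)) atTop
        (𝓝 (ENNReal.ofReal ((Y + η) ^ (1 / q)) + (F + 0 * ENNReal.ofReal cη))) :=
      ((ENNReal.Tendsto.mul_const hflux (Or.inr ENNReal.ofReal_ne_top)).const_add _).const_add _
    rw [zero_mul, add_zero] at hl2
    exact le_of_tendsto_of_tendsto' hl1 hl2 hn
  have hlim : Tendsto (fun η : ℝ => ENNReal.ofReal ((Y + η) ^ (1 / q)) + F) (𝓝[>] 0)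
      (𝓝 (ENNReal.ofReal ((Y + 0) ^ (1 / q)) + F)) := by
    refine Tendsto.add_const _ (ENNReal.tendsto_ofReal (Tendsto.mono_left ?_ nhdsWithin_le_nhds))
    have hcont : Continuous fun η : ℝ => (Y + η) ^ (1 / q) :=
      (continuous_const.add continuous_id).rpow_const fun _ => Or.inr (by positivity)
    exact hcont.tendsto 0
  have hres := ge_of_tendsto hlim (eventually_mem_nhdsWithin.mono hη)
  rwa [add_zero, ← ENNReal.ofReal_rpow_of_nonneg hY0 (by positivity), hYe] at hres

theorem IsTransportSolution.eLpNorm_le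
    (H : IsTransportSolution ν κ T A θ f B v) (hκ : 0 ≤ κ)
    (hpos : ∀ᵐ s ∂ν, 0 < s) (hmin : Integrable (fun s => min 1 s) ν) (hb : 0 < b) (hb1 : b ≤ 1)
    (hfin : ∫⁻ s, ENNReal.ofReal (min s (s ^ b)) ∂ν < ⊤) {p : ℝ≥0∞} (hp : 1 ≤ p)
    {t : ℝ} (ht : t ∈ Icc 0 T) :
    eLpNorm (θ t) p volume ≤ eLpNorm (θ 0) p volume + ∫⁻ s in Ioc 0 t, eLpNorm (f s) p volume := by
  rcases eq_or_ne p ⊤ with rfl | hpt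
  · exact H.eLpNorm_top_le hκ hpos hmin hb hb1 hfin ht
  · have hp0 : p ≠ 0 := (zero_lt_one.trans_le hp).ne'
    have hq : 1 ≤ p.toReal := by
      rw [← ENNReal.toReal_one]; exact ENNReal.toReal_mono hpt hp
    simp_rw [eLpNorm_eq_lintegral_rpow_enorm_toReal hp0 hpt]
    exact H.lintegral_rpow_le hκ hpos hmin hb hb1 hfin hq ht

end FiniteExponent

/-! ### Smooth solutions as transport solutions. -/

section SmoothSolution

open Filter Topology

theorem exists_isLevySymbol_logDissipationSymbol (d : ℕ) {α β lam : ℝ} (hβ : 0 < β) (hβ1 : β ≤ 1)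
    (hα : 0 ≤ α) (hlam : Real.exp ((3 + 2 * α) / β) ≤ lam) :
    ∃ ν : Measure ℝ, SFinite ν ∧
      IsLevySymbol ν (logDissipationSymbol α β lam : EuclideanSpace ℝ (Fin d) → ℝ) ∧
      ∫⁻ s, ENNReal.ofReal (min s (s ^ (β / 4))) ∂ν < ⊤ := by
  obtain ⟨ν, hν, h0, hsymb, hfin⟩ := exists_levy_measure hβ hβ1 hα hlam
  have hlam1 : 1 ≤ lam := le_trans (Real.one_le_exp (by positivity)) hlam
  have hpos : ∀ᵐ s ∂ν, 0 < s := by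
    rw [ae_iff]
    simpa [not_lt, Iic_def] using h0
  refine ⟨ν, hν, ⟨hpos, ?_, fun ξ => ?_, fun ξ => ?_⟩, hfin⟩
  · refine ⟨by fun_prop, ?_⟩
    rw [hasFiniteIntegral_iff_norm]
    refine lt_of_le_of_lt (lintegral_mono_ae (hpos.mono fun s hs => ?_)) hfin
    refine ENNReal.ofReal_le_ofReal ?_
    rw [Real.norm_of_nonneg (by positivity)]
    rcases le_total s 1 with h1 | h1
    · rw [min_eq_right h1]
      exact le_min le_rfl (Real.self_le_rpow_of_le_one hs.le h1 (by linarith))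
    · rw [min_eq_left h1]
      exact le_min h1 (Real.one_le_rpow h1 (by positivity))
  · unfold logDissipationSymbol
    have : 0 ≤ Real.log (lam + 2 * Real.pi * ‖ξ‖) :=
      Real.log_nonneg (le_add_of_le_of_nonneg hlam1 (by positivity))
    positivity
  · rw [logDissipationSymbol, ← hsymb (2 * Real.pi * ‖ξ‖) (by positivity)]
    congr 1; ext s; congr 3; ring

/-! ### Time slices of functions that are smooth on a closed slab. -/

section Slices

set_option linter.unusedSectionVars false

variable {E F : Type*} [NormedAddCommGroup E] [NormedSpace ℝ E] [NormedAddCommGroup F]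
  [NormedSpace ℝ F] {T : ℝ} {u : ℝ → E → F}

theorem continuous_projIcc_comp (hT : 0 ≤ T)
    (hu : ContinuousOn (Function.uncurry u) (Icc 0 T ×ˢ univ)) :
    Continuous fun p : ℝ × E => u (projIcc 0 T hT p.1) p.2 := by
  have h : Continuous fun p : ℝ × E => ((projIcc 0 T hT p.1 : ℝ), p.2) :=
    (continuous_subtype_val.comp (continuous_projIcc.comp continuous_fst)).prodMk continuous_snd
  exact hu.comp_continuous h fun p => ⟨(projIcc 0 T hT p.1).2, mem_univ _⟩

theorem contDiff_slice {n : WithTop ℕ∞} (hu : ContDiffOn ℝ n (Function.uncurry u) (Icc 0 T ×ˢ univ))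
    {t : ℝ} (ht : t ∈ Icc 0 T) : ContDiff ℝ n (u t) := by
  rw [← contDiffOn_univ]
  exact hu.comp (contDiff_prodMk_right t).contDiffOn fun x _ => ⟨ht, mem_univ _⟩

theorem hasFDerivWithinAt_uncurry
    (hu : ContDiffOn ℝ 1 (Function.uncurry u) (Icc 0 T ×ˢ univ)) {t : ℝ} (ht : t ∈ Icc 0 T) (x : E) :
    HasFDerivWithinAt (Function.uncurry u)
      (fderivWithin ℝ (Function.uncurry u) (Icc 0 T ×ˢ univ) (t, x)) (Icc 0 T ×ˢ univ) (t, x) :=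
  ((hu.differentiableOn one_ne_zero) (t, x) ⟨ht, mem_univ _⟩).hasFDerivWithinAt

theorem hasFDerivAt_slice
    (hu : ContDiffOn ℝ 1 (Function.uncurry u) (Icc 0 T ×ˢ univ)) {t : ℝ} (ht : t ∈ Icc 0 T) (x : E) :
    HasFDerivAt (u t) ((fderivWithin ℝ (Function.uncurry u) (Icc 0 T ×ˢ univ) (t, x)).comp
      (ContinuousLinearMap.inr ℝ ℝ E)) x := by
  rw [← hasFDerivWithinAt_univ]
  exact (hasFDerivWithinAt_uncurry hu ht x).comp (f := fun y => (t, y)) x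
    (hasFDerivAt_prodMk_right t x).hasFDerivWithinAt fun y _ => ⟨ht, mem_univ _⟩

theorem hasDerivWithinAt_slice
    (hu : ContDiffOn ℝ 1 (Function.uncurry u) (Icc 0 T ×ˢ univ)) {t : ℝ} (ht : t ∈ Icc 0 T) (x : E) :
    HasDerivWithinAt (fun s => u s x)
      (fderivWithin ℝ (Function.uncurry u) (Icc 0 T ×ˢ univ) (t, x) (1, 0)) (Icc 0 T) t :=
  ((hasFDerivWithinAt_uncurry hu ht x).comp (f := fun s => (s, x)) t
    (hasFDerivAt_prodMk_left t x).hasFDerivWithinAt fun _ hs => ⟨hs, mem_univ _⟩).hasDerivWithinAt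

theorem continuousOn_fderivWithin_uncurry (hT : 0 < T)
    (hu : ContDiffOn ℝ 1 (Function.uncurry u) (Icc 0 T ×ˢ univ)) :
    ContinuousOn (fderivWithin ℝ (Function.uncurry u) (Icc 0 T ×ˢ univ)) (Icc 0 T ×ˢ univ) :=
  hu.continuousOn_fderivWithin ((uniqueDiffOn_Icc hT).prod uniqueDiffOn_univ) le_rfl

theorem continuousOn_fderiv_slice (hT : 0 < T)
    (hu : ContDiffOn ℝ 1 (Function.uncurry u) (Icc 0 T ×ˢ univ)) :
    ContinuousOn (Function.uncurry fun t x => fderiv ℝ (u t) x) (Icc 0 T ×ˢ univ) :=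
  ((continuousOn_fderivWithin_uncurry hT hu).clm_comp continuousOn_const).congr
    fun p hp => (hasFDerivAt_slice hu hp.1 p.2).fderiv

theorem continuousOn_derivWithin_slice (hT : 0 < T)
    (hu : ContDiffOn ℝ 1 (Function.uncurry u) (Icc 0 T ×ˢ univ)) :
    ContinuousOn (Function.uncurry fun t x => derivWithin (fun s => u s x) (Icc 0 T) t)
      (Icc 0 T ×ˢ univ) :=
  ((continuousOn_fderivWithin_uncurry hT hu).clm_apply continuousOn_const).congr
    fun p hp => (hasDerivWithinAt_slice hu hp.1 p.2).derivWithin (uniqueDiffOn_Icc hT p.1 hp.1)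

end Slices

theorem Continuous.abs_le_of_ae {d : ℕ} {g : EuclideanSpace ℝ (Fin d) → ℝ} (hg : Continuous g)
    {K : ℝ} (h : ∀ᵐ x, |g x| ≤ K) (x : EuclideanSpace ℝ (Fin d)) : |g x| ≤ K := by
  by_contra hx
  have hopen : IsOpen {y | K < |g y|} := isOpen_lt continuous_const hg.abs
  refine (hopen.measure_pos volume ⟨x, not_le.1 hx⟩).ne' ?_
  rw [ae_iff] at h
  simpa [not_le] using h

variable {d : ℕ} {κ α β lam T : ℝ} {v : ℝ → EuclideanSpace ℝ (Fin d) → EuclideanSpace ℝ (Fin d)}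
  {f θ : ℝ → EuclideanSpace ℝ (Fin d) → ℝ}

/-- Clamping time to `[0, T]` makes all the data globally continuous without changing the equation
on `(0, T)`. The dissipation `B` is defined as what the equation leaves, so it is continuous. The
multiplier hypothesis identifies it almost everywhere with an average of heat differences, which
gives its bound, first almost everywhere and then everywhere by continuity, and its dissipativity.
-/
theorem IsSmoothSolution.exists_isTransportSolution (hsol : IsSmoothSolution κ α β lam T v f θ)
    (hκ : 0 ≤ κ) (hT : 0 < T) {ν : Measure ℝ} [SFinite ν]
    (H : IsLevySymbol ν (logDissipationSymbol α β lam : EuclideanSpace ℝ (Fin d) → ℝ)) :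
    ∃ A B w, IsTransportSolution ν κ T A (fun t => θ (projIcc 0 T hT.le t))
      (fun t => f (projIcc 0 T hT.le t)) B w := by
  have hθ1 : ContDiffOn ℝ 1 (Function.uncurry θ) (Icc 0 T ×ˢ univ) :=
    hsol.smooth_theta.of_le (by norm_cast)
  have hv1 : ContDiffOn ℝ 1 (Function.uncurry v) (Icc 0 T ×ˢ univ) :=
    hsol.smooth_v.of_le (by norm_cast)
  set τ : ℝ → ℝ := fun t => projIcc 0 T hT.le t with hτ
  have hτm : ∀ t, τ t ∈ Icc 0 T := fun t => (projIcc 0 T hT.le t).2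
  obtain ⟨A, hA⟩ := hsol.growth_v
  obtain ⟨M, hM⟩ := hsol.bounded_theta 0
  obtain ⟨M₁, hM₁⟩ := hsol.bounded_theta 1
  obtain ⟨M₂, hM₂⟩ := hsol.bounded_theta 2
  simp only [norm_iteratedFDeriv_zero, norm_iteratedFDeriv_one] at hM hM₁
  have hM₂0 : 0 ≤ M₂ := (norm_nonneg _).trans (hM₂ 0 ⟨le_rfl, hT.le⟩ 0)
  have hlip : ∀ t ∈ Icc 0 T, ∀ x y, ‖fderiv ℝ (θ t) x - fderiv ℝ (θ t) y‖ ≤ M₂ * ‖x - y‖ :=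
    fun t ht x y => by
      have hd : ContDiff ℝ 2 (θ t) :=
        (contDiff_slice hsol.smooth_theta ht).of_le (by norm_cast)
      have hd1 : ContDiff ℝ 1 (fderiv ℝ (θ t)) := hd.fderiv_right le_rfl
      refine convex_univ.norm_image_sub_le_of_norm_fderiv_le (𝕜 := ℝ)
        (fun z _ => hd1.differentiable one_ne_zero z) (fun z _ => ?_) (mem_univ y) (mem_univ x)
      rw [← norm_iteratedFDeriv_one, norm_iteratedFDeriv_fderiv]
      exact hM₂ t ht z
  set C := 2 * (M + M₂ * gaussSecondMoment (EuclideanSpace ℝ (Fin d))) with hC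
  have hheat : ∀ t ∈ Icc 0 T, ∀ r, 0 ≤ r → ∀ x, |θ t x - heatMean r (θ t) x| ≤ C * min 1 r :=
    fun t ht r hr x => abs_sub_heatMean_le
      ((contDiff_slice hθ1 ht).differentiable one_ne_zero) (hM t ht) hM₂0 (hlip t ht) hr x
  have cf := continuous_projIcc_comp hT.le hsol.smooth_f.continuousOn
  have cv := continuous_projIcc_comp hT.le hsol.smooth_v.continuousOn
  have cd := continuous_projIcc_comp hT.le (continuousOn_fderiv_slice hT hθ1)
  have cdt := continuous_projIcc_comp hT.le (continuousOn_derivWithin_slice hT hθ1)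
  set B : ℝ → EuclideanSpace ℝ (Fin d) → ℝ := fun t x => f (τ t) x -
    derivWithin (fun s => θ s x) (Icc 0 T) (τ t) - fderiv ℝ (θ (τ t)) x (v (τ t) x) with hB
  have cB : Continuous (Function.uncurry B) := (cf.sub cdt).sub (cd.clm_apply cv)
  have cBs : ∀ t, Continuous (B t) := fun t => cB.comp (by fun_prop : Continuous fun x => (t, x))
  have hBae := fun t => H.ae_eq (contDiff_slice hθ1 (hτm t)).continuous (hM _ (hτm t))
    (hheat _ (hτm t)) (cBs t) (hsol.equation _ (hτm t))
  refine ⟨A, B, fun t => v (τ t), ?_⟩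
  constructor
  · exact continuous_projIcc_comp hT.le hsol.smooth_theta.continuousOn
  · exact cf
  · exact cB
  · exact cv
  · exact fun t => contDiff_slice hθ1 (hτm t)
  · exact fun t => contDiff_slice hv1 (hτm t)
  · exact cd
  · exact fun t => hsol.div_v _ (hτm t)
  · exact fun t => hA _ (hτm t)
  · exact ⟨M, fun t => hM _ (hτm t)⟩
  · exact ⟨M₁, fun t => hM₁ _ (hτm t)⟩
  · refine ⟨κ * ∫ s, C * min 1 s ∂ν, fun t => (cBs t).abs_le_of_ae ((hBae t).mono fun x hx => ?_)⟩
    rw [hx, abs_mul, abs_of_nonneg hκ]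
    refine mul_le_mul_of_nonneg_left ?_ hκ
    rw [← Real.norm_eq_abs]
    refine norm_integral_le_of_norm_le (H.integrable_min.const_mul C) (H.pos.mono fun s hs => ?_)
    exact hheat _ (hτm t) s hs.le x
  · intro t ht x
    have htI : t ∈ Icc 0 T := ⟨ht.1.le, ht.2.le⟩
    have hτt : τ t = t := by simp only [hτ]; rw [projIcc_of_mem hT.le htI]
    have h1 := (hasDerivWithinAt_slice hθ1 htI x).differentiableWithinAt.hasDerivWithinAt.hasDerivAt
      (Icc_mem_nhds ht.1 ht.2)
    have h2 : (fun s => θ (τ s) x) =ᶠ[𝓝 t] fun s => θ s x := by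
      filter_upwards [Icc_mem_nhds ht.1 ht.2] with s hs
      simp only [hτ]; rw [projIcc_of_mem hT.le hs]
    refine (h1.congr_of_eventuallyEq h2).congr_deriv ?_
    simp only [hB]
    rw [hτt, projIcc_of_mem hT.le htI]; ring
  · intro φ φ' hφ hφ' hφ0 htan σ hσ t
    exact H.le_integral_mul hκ (contDiff_slice hθ1 (hτm t)).continuous (hM _ (hτm t))
      (hheat _ (hτm t)) (cBs t) (hsol.equation _ (hτm t)) hφ hφ' hφ0 htan hσ

end SmoothSolution

theorem mainTheorem2 (d : ℕ) (hd : 1 ≤ d) (p : ℝ≥0∞) (hp : 1 ≤ p)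
    (κ α β lam : ℝ) (hκ : 0 ≤ κ) (hβ : 0 < β) (hβ1 : β ≤ 1) (hα : 0 ≤ α)
    (hlam : Real.exp ((3 + 2 * α) / β) ≤ lam)
    (T : ℝ) (hT : 0 < T)
    (v : ℝ → EuclideanSpace ℝ (Fin d) → EuclideanSpace ℝ (Fin d))
    (f θ : ℝ → EuclideanSpace ℝ (Fin d) → ℝ)
    (hsol : IsSmoothSolution κ α β lam T v f θ) :
    ∀ t ∈ Icc 0 T,
      eLpNorm (θ t) p volume
          ≤ eLpNorm (θ 0) p volume + ∫⁻ τ in Icc 0 t, eLpNorm (f τ) p volume ∧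
      ((∀ τ ∈ Icc 0 t, ∀ x, f τ x = 0) →
        eLpNorm (θ t) p volume ≤ eLpNorm (θ 0) p volume) := by
  intro t ht
  have hmain : eLpNorm (θ t) p volume
      ≤ eLpNorm (θ 0) p volume + ∫⁻ τ in Icc 0 t, eLpNorm (f τ) p volume := by
    obtain ⟨ν, hν, hsymb, hfin⟩ := exists_isLevySymbol_logDissipationSymbol d hβ hβ1 hα hlam
    obtain ⟨A, B, w, H⟩ := hsol.exists_isTransportSolution hκ hT hsymb
    have h := H.eLpNorm_le hκ hsymb.pos hsymb.integrable_min (b := β / 4) (by positivity)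
      (by linarith) hfin hp ht
    rw [projIcc_of_mem hT.le ht, projIcc_of_mem hT.le ⟨le_rfl, hT.le⟩] at h
    refine h.trans (add_le_add_right ?_ _)
    rw [← setLIntegral_congr (Ioc_ae_eq_Icc (μ := volume))]
    refine setLIntegral_mono' measurableSet_Ioc fun s hs => ?_
    rw [projIcc_of_mem hT.le ⟨hs.1.le, hs.2.trans ht.2⟩]
  refine ⟨hmain, fun hf => hmain.trans_eq ?_⟩
  have h0 : ∫⁻ τ in Icc 0 t, eLpNorm (f τ) p volume = 0 := by
    rw [setLIntegral_congr_fun measurableSet_Icc (g := fun _ => 0) fun τ hτ => ?_, lintegral_zero]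
    rw [show f τ = 0 from funext (hf τ hτ), eLpNorm_zero]
  rw [h0, add_zero]
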